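/- Let $\Sigma=\{0,1\}$. A parameterized language is a set $L\subseteq\Sigma^*\times\mathbb N$, and a parameterized counting function is a function $F:\Sigma^*\times\mathbb N\to\mathbb N$; in an instance $(x,k)$ the number $k$ is the parameter, and $n=|x|$. A (nondeterministic) Turing machine $M$ with binary nondeterministic moves is called $k$-restricted if there are computable functions $f,g:\mathbb N\to\mathbb N$ and a polynomial $p$ such that every computation of $M$ on every $(x,k)$ has at most $g(k)\,p(n)$ steps, at most $f(k)\log (n+2)$ of which are nondeterministic. Define the following classes. - $\#\mathsf{W[P]}$ is the class of all $F$ for which there is a $k$-restricted Turing machine $M$ such that, for all $(x,k)$, $F(x,k)=\#\mathsf{acc}_M(x,k)$ is the number of accepting computation paths of $M$ on $(x,k)$. - $\mathsf{W[P]}\text{-}\mathsf{PFPT}$ is the class of all $L$ for which there is a $k$-restricted probabilistic Turing machine $M$ (a $k$-restricted machine whose nondeterministic moves are decided by independent fair coins) such that for all $(x,k)$: if $(x,k)\in L$ then $\Pr[M\text{ accepts }(x,k)]>\tfrac12$, and if $(x,k)\notin L$ then $\Pr[M\text{ accepts }(x,k)]\le\tfrac12$. - For a class $\mathcal C$ of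 parameterized counting functions or of parameterized languages, $\mathsf{FPT}^{\mathcal C}$ is the class of all parameterized languages $L$ that are decided by a deterministic oracle Turing machine with an oracle $O\in\mathcal C$ which, for some computable functions $g,h$ and some polynomial $p$, halts on every $(x,k)$ within $g(k)\,p(n)$ steps and asks only queries $(y,k')$ with $k'\le h(k)$. A function oracle answers a query with the value $O(y,k')$ in binary; a language oracle answers whether $(y,k')\in O$. A query counts as one step. Theorem. $\mathsf{FPT}^{\#\mathsf{W[P]}}=\mathsf{FPT}^{\mathsf{W[P]}\text{-}\mathsf{PFPT}}$. -/

import Mathlib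

namespace ParamComplexity

open Turing

/-- The distinguished stacks of a machine, all over the binary alphabet: the input string, the
parameter (in unary), the query string, the query parameter (in unary), and the oracle's answer. -/
inductive Port
  | input | param | queryInput | queryParam | answer
  deriving DecidableEq

/-- The alphabets of the stacks: `Bool` on the distinguished stacks, `Γ k` on work stack `k`. -/
abbrev Alph {K : Type} (Γ : K → Type) : Port ⊕ K → Type
  | .inl _ => Bool
  | .inr k => Γ k

/-- What a machine does at a label: an ordinary deterministic statement of a multi-stack Turing
machine, a binary nondeterministic (or probabilistic) move between two such statements,
or an oracle query, after which the machine continues at the given label. -/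
inductive Instr {K : Type} (Γ : K → Type) (Λ σ : Type)
  | det (s : TM2.Stmt (Alph Γ) Λ σ)
  | guess (s₀ s₁ : TM2.Stmt (Alph Γ) Λ σ)
  | query (q : Λ)

/-- A Turing machine with finitely many stacks (two stacks make one two-way infinite tape), with
finite alphabets and finite control, in the style of `Turing.FinTM2`, extended by binary
nondeterministic moves and oracle queries. Whether a halting computation accepts depends on the
internal state in which it halts. -/
structure Machine where
  /-- indices of the work stacks -/
  K : Type
  [decK : DecidableEq K]
  [finK : Finite K]
  /-- alphabets of the work stacks -/
  Γ : K → Type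
  [finΓ : ∀ k, Finite (Γ k)]
  /-- labels -/
  Λ : Type
  [finΛ : Finite Λ]
  /-- internal states -/
  σ : Type
  [finσ : Finite σ]
  /-- the program -/
  instr : Λ → Instr Γ Λ σ
  /-- the initial label -/
  main : Λ
  /-- the initial internal state -/
  start : σ
  /-- the accepting internal states -/
  accept : σ → Bool

attribute [instance] Machine.decK Machine.finK Machine.finΓ Machine.finΛ Machine.finσ

/-- A parameterized language over `{0,1}`. -/
abbrev ParamLang := Set (List Bool × ℕ)

/-- A parameterized counting function over `{0,1}`. -/
abbrev ParamFun := List Bool × ℕ → ℕ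

namespace Machine

variable (M : Machine)

abbrev Cfg := TM2.Cfg (Alph M.Γ) M.Λ M.σ

/-- The initial configuration on the instance `(x, k)`: the string `x` is on the input stack (its
first letter on top), `k` is on the parameter stack, and all other stacks are empty. -/
def init (x : List Bool) (k : ℕ) : M.Cfg where
  l := some M.main
  var := M.start
  stk
    | .inl .input => x
    | .inl .param => List.replicate k true
    | .inl .queryInput => []
    | .inl .queryParam => []
    | .inl .answer => []
    | .inr _ => []

/-- The stacks after a query to the oracle `O`: the query stacks, which held the query `(y, k')`,
are emptied, and the answer stack holds the binary expansion of `O (y, k')`, with the least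
significant bit on top (it is empty if the value is `0`). -/
def answered (O : ParamFun) (S : ∀ i, List (Alph M.Γ i)) : ∀ i, List (Alph M.Γ i)
  | .inl .input => S (.inl .input)
  | .inl .param => S (.inl .param)
  | .inl .queryInput => []
  | .inl .queryParam => []
  | .inl .answer => (O (S (.inl .queryInput), (S (.inl .queryParam)).length)).bits
  | .inr k => S (.inr k)

/-- `M.Path O c w t c'`: there is a partial computation of `M` with oracle `O` that leads from `c`
to `c'` in exactly `t` steps, and `w` is the sequence of its nondeterministic choices. -/
inductive Path (O : ParamFun) : M.Cfg → List Bool → ℕ → M.Cfg → Prop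
  | refl (c : M.Cfg) : Path O c [] 0 c
  | det {c c' : M.Cfg} {q : M.Λ} {s : TM2.Stmt (Alph M.Γ) M.Λ M.σ} {w : List Bool} {t : ℕ}
      (hq : c.l = some q) (hi : M.instr q = .det s)
      (h : Path O (TM2.stepAux s c.var c.stk) w t c') : Path O c w (t + 1) c'
  | guess {c c' : M.Cfg} {q : M.Λ} {s₀ s₁ : TM2.Stmt (Alph M.Γ) M.Λ M.σ} {w : List Bool} {t : ℕ}
      (b : Bool) (hq : c.l = some q) (hi : M.instr q = .guess s₀ s₁)
      (h : Path O (TM2.stepAux (cond b s₁ s₀) c.var c.stk) w t c') : Path O c (b :: w) (t + 1) c'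
  | query {c c' : M.Cfg} {q q' : M.Λ} {w : List Bool} {t : ℕ}
      (hq : c.l = some q) (hi : M.instr q = .query q')
      (h : Path O ⟨some q', c.var, M.answered O c.stk⟩ w t c') : Path O c w (t + 1) c'

/-- The machine is deterministic: it has no nondeterministic moves. -/
def Deterministic : Prop := ∀ q s₀ s₁, M.instr q ≠ .guess s₀ s₁

/-- The machine makes no oracle queries. -/
def OracleFree : Prop := ∀ q q', M.instr q ≠ .query q'

/-- Computations of a machine without queries: the oracle is irrelevant, take the zero function. -/
abbrev FreePath : M.Cfg → List Bool → ℕ → M.Cfg → Prop := M.Path 0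

/-- The accepting (complete) computation paths of an oracle-free machine on `(x, k)`, each given
by the sequence of its nondeterministic choices. -/
def accPaths (x : List Bool) (k : ℕ) : Set (List Bool) :=
  {w | ∃ t c, M.FreePath (M.init x k) w t c ∧ c.l = none ∧ M.accept c.var = true}

/-- The number of accepting paths on `(x, k)`. -/
noncomputable def numAcc (x : List Bool) (k : ℕ) : ℕ := (M.accPaths x k).ncard

/-- The probability that the machine accepts `(x, k)` when every nondeterministic move is decided
by an independent fair coin: a path with `j` such moves has probability `2⁻ʲ`. -/
noncomputable def acceptProb (x : List Bool) (k : ℕ) : ℝ :=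
  ∑' w : M.accPaths x k, (1 / 2 : ℝ) ^ w.1.length

/-- `k`-restricted Turing machines (without oracle): for computable `f` and `g` and a polynomial
`p`, every computation on `(x, k)` with `n = |x|` has at most `g(k) p(n)` steps, of which at most
`f(k) log (n + 2)` are nondeterministic. (The `+ 2` matters only for `n ≤ 1`.) -/
def KRestricted : Prop :=
  M.OracleFree ∧
  ∃ (f g : ℕ → ℕ) (p : Polynomial ℕ), Computable f ∧ Computable g ∧
    ∀ (x : List Bool) (k : ℕ) (w : List Bool) (t : ℕ) (c : M.Cfg),
      M.FreePath (M.init x k) w t c →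
        t ≤ g k * p.eval x.length ∧ w.length ≤ f k * Nat.log 2 (x.length + 2)

/-- The deterministic machine `M` with oracle `O` decides `L` in fpt time: it halts on every
`(x, k)` within `g(k) p(|x|)` steps with the right answer, and every query `(y, k')` which it makes
on `(x, k)` has `k' ≤ h(k)`, where `g` and `h` are computable and `p` is a polynomial. -/
def DecidesFPT (O : ParamFun) (L : ParamLang) : Prop :=
  M.Deterministic ∧
  ∃ (g h : ℕ → ℕ) (p : Polynomial ℕ), Computable g ∧ Computable h ∧
    ∀ (x : List Bool) (k : ℕ),
      (∃ (t : ℕ) (c : M.Cfg), M.Path O (M.init x k) [] t c ∧ c.l = none ∧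
        t ≤ g k * p.eval x.length ∧ (M.accept c.var = true ↔ (x, k) ∈ L)) ∧
      (∀ (t : ℕ) (c : M.Cfg) (q q' : M.Λ), M.Path O (M.init x k) [] t c → c.l = some q →
        M.instr q = .query q' → (c.stk (.inl .queryParam)).length ≤ h k)

end Machine

/-- The counting class `#W[P]`. -/
def SharpWP : Set ParamFun :=
  {F | ∃ M : Machine, M.KRestricted ∧ ∀ x k, F (x, k) = M.numAcc x k}

/-- The class `W[P]-PFPT`. -/
def WPPFPT : Set ParamLang :=
  {L | ∃ M : Machine, M.KRestricted ∧ ∀ x k,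
    ((x, k) ∈ L → 1 / 2 < M.acceptProb x k) ∧ ((x, k) ∉ L → M.acceptProb x k ≤ 1 / 2)}

/-- Languages decidable in fpt time relative to the function oracle `O`. -/
def FPTRel (O : ParamFun) : Set ParamLang := {L | ∃ M : Machine, M.DecidesFPT O L}

/-- `FPT^𝓕` for a class `𝓕` of parameterized functions. -/
def FPTRelFuns (𝓕 : Set ParamFun) : Set ParamLang := {L | ∃ O ∈ 𝓕, L ∈ FPTRel O}

/-- `FPT^𝓛` for a class `𝓛` of parameterized languages; a language `A` is queried through its
characteristic function, so that the answer is `1` on members and `0` on non-members. -/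
noncomputable def FPTRelLangs (𝓛 : Set ParamLang) : Set ParamLang :=
  {L | ∃ A ∈ 𝓛, L ∈ FPTRel (A.indicator 1)}

end ParamComplexity

/-! Fix a k-restricted machine `M₀`. One auxiliary machine, `countingMachine M₀`, serves as oracle
in both directions. Its input encodes three mode bits m₁, m₂, m₃, a number a in unary, a threshold z
and a string x, and its parameter is k + a. It takes a back off the parameter, puts j = a · log(|x|
+ 2), and guesses a bit b and a word u of length j. If b = 1, it accepts when m₁ is set and z ≤ u as
binary numbers. If b = 0, it runs `M₀` on (x, k) with the choices u and accepts according to m₂ and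
m₃. So its number of accepting paths is a count of words for `M₀` plus, if m₁ is set, 2^j - z
(`countingMachine_numAcc`). All these paths have j + 1 choices; hence, with m₁ set, acceptance has
probability above 1/2 exactly if z is less than the count (`countingMachine_acceptProb`). A majority
query is thereby a threshold query about a count.

The computable bound f on the nondeterminism of `M₀` is never evaluated by a machine. With m₂ set,
the words counted are those after which `M₀` still asks for a choice. A program with oracle raises a
from 0 until this count is zero, which happens at a = f(k) at the latest; the query parameters stay
below k + f(k), and j choices are then enough for `M₀`. Since a is charged to the parameter, the
auxiliary machine is itself k-restricted.

With m₂ off and m₃ on, unused choices must be zero, so the count is the number of accepting paths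
(`Machine.count_numAcc`). With both off, a path w is counted 2^(j - |w|) times, and the count is 2^j
times the acceptance probability (`Machine.count_acceptProb`). Counts are obtained from majority
queries by determining binary digits from the top (`answers_answerCount`). Majority is obtained from
counting queries by comparing twice the count with 2^j, itself an answer of the oracle
(`answers_answerMajority`). `fptRel_subset` turns such a procedure into an inclusion: the oracle
machine is simulated, and the procedure replaces each query.

The machines are written in a structured language `Prog`. Compilation costs one extra step in total
(`Run.bPath`), and programs are verified by timed total correctness triples `Tri`. -/

namespace ParamComplexity

open Turing

/-! ### Computation paths with bounded queries -/

namespace Machine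

variable {M : Machine} {O : ParamFun} {H : ℕ}

/-- A computation path all of whose queries have a parameter at most `H`. -/
inductive BPath (M : Machine) (O : ParamFun) (H : ℕ) : M.Cfg → List Bool → ℕ → M.Cfg → Prop
  | refl (c : M.Cfg) : BPath M O H c [] 0 c
  | det {c c' : M.Cfg} {q : M.Λ} {s : TM2.Stmt (Alph M.Γ) M.Λ M.σ} {w : List Bool} {t : ℕ}
      (hq : c.l = some q) (hi : M.instr q = .det s)
      (h : BPath M O H (TM2.stepAux s c.var c.stk) w t c') : BPath M O H c w (t + 1) c'
  | guess {c c' : M.Cfg} {q : M.Λ} {s₀ s₁ : TM2.Stmt (Alph M.Γ) M.Λ M.σ} {w : List Bool} {t : ℕ}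
      (b : Bool) (hq : c.l = some q) (hi : M.instr q = .guess s₀ s₁)
      (h : BPath M O H (TM2.stepAux (cond b s₁ s₀) c.var c.stk) w t c') :
      BPath M O H c (b :: w) (t + 1) c'
  | query {c c' : M.Cfg} {q q' : M.Λ} {w : List Bool} {t : ℕ}
      (hq : c.l = some q) (hi : M.instr q = .query q')
      (hH : (c.stk (.inl .queryParam)).length ≤ H)
      (h : BPath M O H ⟨some q', c.var, M.answered O c.stk⟩ w t c') : BPath M O H c w (t + 1) c'

theorem BPath.path {c c' : M.Cfg} {w t} (h : M.BPath O H c w t c') : M.Path O c w t c' := by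
  induction h with
  | refl c => exact .refl c
  | det hq hi _ ih => exact .det hq hi ih
  | guess b hq hi _ ih => exact .guess b hq hi ih
  | query hq hi _ _ ih => exact .query hq hi ih

theorem BPath.trans {c c' c'' : M.Cfg} {w w' t t'} (h : M.BPath O H c w t c')
    (h' : M.BPath O H c' w' t' c'') : M.BPath O H c (w ++ w') (t + t') c'' := by
  induction h with
  | refl c => simpa using h'
  | det hq hi _ ih => rw [Nat.add_right_comm]; exact .det hq hi (ih h')
  | guess b hq hi _ ih => rw [Nat.add_right_comm]; exact .guess b hq hi (ih h')
  | query hq hi hH _ ih => rw [Nat.add_right_comm]; exact .query hq hi hH (ih h')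

theorem Path.trans {c c' c'' : M.Cfg} {w w' t t'} (h : M.Path O c w t c')
    (h' : M.Path O c' w' t' c'') : M.Path O c (w ++ w') (t + t') c'' := by
  induction h with
  | refl c => simpa using h'
  | det hq hi _ ih => rw [Nat.add_right_comm]; exact .det hq hi (ih h')
  | guess b hq hi _ ih => rw [Nat.add_right_comm]; exact .guess b hq hi (ih h')
  | query hq hi _ ih => rw [Nat.add_right_comm]; exact .query hq hi (ih h')

/-- Computations are determined by their choices: a path whose choices are compatible with those
of a halting path is an initial segment of it. -/
theorem BPath.compat {c c' : M.Cfg} {w t} (h : M.BPath O H c w t c') (hc : c'.l = none)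
    {w₁ t₁} {c₁ : M.Cfg} (h₁ : M.Path O c w₁ t₁ c₁) (hw : w₁ <+: w ∨ w <+: w₁) :
    t₁ ≤ t ∧ w₁ <+: w ∧ (c₁.l = none → w₁ = w ∧ c₁ = c') ∧
      ∀ q q', c₁.l = some q → M.instr q = .query q' →
        (c₁.stk (.inl .queryParam)).length ≤ H := by
  induction h generalizing w₁ t₁ with
  | refl c =>
    cases h₁ with
    | refl => exact ⟨le_rfl, List.prefix_rfl, fun _ => ⟨rfl, rfl⟩, fun q q' h => by simp_all⟩
    | det hq => simp_all
    | guess b hq => simp_all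
    | query hq => simp_all
  | @det c c' q s w t hq hi h ih =>
    cases h₁ with
    | refl =>
      refine ⟨Nat.zero_le _, List.nil_prefix, fun h => by simp_all, fun q₁ q' h h' => ?_⟩
      rw [hq] at h; cases h; rw [hi] at h'; cases h'
    | det hq₁ hi₁ h₁ =>
      rw [hq] at hq₁; cases hq₁; rw [hi] at hi₁; cases hi₁
      obtain ⟨a, b, c, d⟩ := ih hc h₁ hw
      exact ⟨by omega, b, c, d⟩
    | guess b hq₁ hi₁ => rw [hq] at hq₁; cases hq₁; rw [hi] at hi₁; cases hi₁
    | query hq₁ hi₁ => rw [hq] at hq₁; cases hq₁; rw [hi] at hi₁; cases hi₁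
  | @guess c c' q s₀ s₁ w t b hq hi h ih =>
    cases h₁ with
    | refl =>
      refine ⟨Nat.zero_le _, List.nil_prefix, fun h => by simp_all, fun q₁ q' h h' => ?_⟩
      rw [hq] at h; cases h; rw [hi] at h'; cases h'
    | det hq₁ hi₁ h₁ => rw [hq] at hq₁; cases hq₁; rw [hi] at hi₁; cases hi₁
    | guess b₁ hq₁ hi₁ h₁ =>
      rw [hq] at hq₁; cases hq₁; rw [hi] at hi₁; cases hi₁
      have hb : b₁ = b := by
        rcases hw with hw | hw
        · exact (List.cons_prefix_cons.1 hw).1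
        · exact (List.cons_prefix_cons.1 hw).1.symm
      subst hb
      obtain ⟨a, b, c, d⟩ := ih hc h₁ (by simpa [List.cons_prefix_cons] using hw)
      exact ⟨by omega, by simpa [List.cons_prefix_cons] using b, fun h => by simp [c h], d⟩
    | query hq₁ hi₁ => rw [hq] at hq₁; cases hq₁; rw [hi] at hi₁; cases hi₁
  | @query c c' q q' w t hq hi hH h ih =>
    cases h₁ with
    | refl =>
      refine ⟨Nat.zero_le _, List.nil_prefix, fun h => by simp_all, fun q₁ q' h h' => hH⟩
    | det hq₁ hi₁ h₁ => rw [hq] at hq₁; cases hq₁; rw [hi] at hi₁; cases hi₁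
    | guess b hq₁ hi₁ => rw [hq] at hq₁; cases hq₁; rw [hi] at hi₁; cases hi₁
    | query hq₁ hi₁ h₁ =>
      rw [hq] at hq₁; cases hq₁; rw [hi] at hi₁; cases hi₁
      obtain ⟨a, b, c, d⟩ := ih hc h₁ hw
      exact ⟨by omega, b, c, d⟩

/-- The bound on queries is vacuous here; this makes `BPath.compat` available for oracle-free
machines, usually with `H = 0`. -/
theorem OracleFree.bPath (hM : M.OracleFree) {c c' : M.Cfg} {w t} (h : M.Path O c w t c') :
    M.BPath O H c w t c' := by
  induction h with
  | refl c => exact .refl c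
  | det hq hi _ ih => exact .det hq hi ih
  | guess b hq hi _ ih => exact .guess b hq hi ih
  | query hq hi _ ih => exact absurd hi (hM _ _)

end Machine

/-! ### A structured language that can simulate a machine -/

/-- Boolean registers of programs. -/
structure Reg where
  -- `r` holds the last popped symbol (`none` from an empty stack), `g` the last guess or a scratch
  -- bit, `m₁`, `m₂`, `m₃` the modes of a query, `b` the guessed kind of a path, `fl` the outcome of
  -- a test; `ov` records that the simulated machine ran out of choices.
  r : Option Bool
  g : Bool
  m₁ : Bool
  m₂ : Bool
  m₃ : Bool
  b : Bool
  fl : Bool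
  ov : Bool

instance : Finite Reg :=
  Finite.of_injective (fun ρ : Reg => (ρ.r, ρ.g, ρ.m₁, ρ.m₂, ρ.m₃, ρ.b, ρ.fl, ρ.ov))
    (by rintro ⟨⟩ ⟨⟩ h; simpa using h)

/-- The initial contents of the registers. -/
def Reg.start : Reg := ⟨none, false, false, false, false, false, false, false⟩

/-- Auxiliary Boolean stacks of programs. -/
inductive Aux
  -- `T` is the buffer of `scan`; `A`, `L`, `J` hold the factor a, the logarithm and their product;
  -- `R` holds the choices and `Z` the threshold; `Y`, `C` keep the simulated query, `I` the index
  -- of a binary digit; `U`, `V` are scratch.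
  | T | A | J | L | U | V | R | Z | Y | C | I
  deriving DecidableEq

/-- The Boolean stacks of a program: its own ports, the ports of the simulated machine, and
the auxiliary stacks. -/
inductive Stk
  | io (p : Port)
  | sim (p : Port)
  | ex (x : Aux)
  deriving DecidableEq

instance : Finite Port :=
  Finite.of_injective (β := Fin 5)
    (fun | .input => 0 | .param => 1 | .queryInput => 2 | .queryParam => 3 | .answer => 4)
    (by intro a b; cases a <;> cases b <;> simp)

instance : Finite Aux :=
  Finite.of_injective (β := Fin 11)
    (fun
      | .T => 0 | .A => 1 | .J => 2 | .L => 3 | .U => 4 | .V => 5 | .R => 6 | .Z => 7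
      | .Y => 8 | .C => 9 | .I => 10)
    (by intro a b; cases a <;> cases b <;> simp)

/-- Control states of a program which simulates `M`: the current label and internal state of the
simulated machine, and the registers. -/
abbrev Ctl (M : Machine) := Option M.Λ × M.σ × Reg

/-- States of a program which simulates `M`. -/
@[ext] structure State (M : Machine) where
  ctl : Ctl M
  st : Stk → List Bool
  wk : ∀ k, List (M.Γ k)

variable {M : Machine} {O : ParamFun} {H : ℕ}

namespace State

/-- The configuration of the simulated machine. -/
def mc (s : State M) : M.Cfg where
  l := s.ctl.1
  var := s.ctl.2.1
  stk
    | .inl p => s.st (.sim p)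
    | .inr k => s.wk k

/-- Replace the configuration of the simulated machine. -/
def withMc (s : State M) (c : M.Cfg) : State M where
  ctl := (c.l, c.var, s.ctl.2.2)
  st
    | .sim p => c.stk (.inl p)
    | n => s.st n
  wk k := c.stk (.inr k)

/-- Replace the contents of one stack. -/
def set (s : State M) (n : Stk) (l : List Bool) : State M :=
  { s with st := Function.update s.st n l }

/-- The registers. -/
def reg (s : State M) : Reg := s.ctl.2.2

/-- Replace the registers. -/
def setReg (s : State M) (ρ : Reg) : State M := { s with ctl := (s.ctl.1, s.ctl.2.1, ρ) }

/-- Replace the control state. -/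
def setCtl (s : State M) (v : Ctl M) : State M := { s with ctl := v }

/-- Replace the contents of the register `r`. -/
def setR (s : State M) (r : Option Bool) : State M := s.setReg { s.reg with r := r }

/-- One step of the simulated machine, which takes its nondeterministic choices from the stack
`R`; if that stack is empty, the register `ov` is set instead. -/
def mstep (s : State M) : State M :=
  match s.ctl.1 with
  | none => s
  | some q =>
    match M.instr q with
    | .det p => s.withMc (TM2.stepAux p s.mc.var s.mc.stk)
    | .guess p₀ p₁ =>
      match s.st (.ex .R) with
      | [] => s.setReg { s.reg with r := none, ov := true }
      | b :: l => ((s.setR (some b)).set (.ex .R) l).withMc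
          (TM2.stepAux (cond b p₁ p₀) s.mc.var s.mc.stk)
    | .query _ => s

/-- Ask the oracle the query on the query ports. -/
def ask (s : State M) (O : ParamFun) : State M :=
  { s with
    st := fun n => match n with
      | .io .queryInput => []
      | .io .queryParam => []
      | .io .answer => (O (s.st (.io .queryInput), (s.st (.io .queryParam)).length)).bits
      | n => s.st n }

end State

/-- Structured programs. -/
inductive Prog (M : Machine)
  | load (f : Ctl M → Ctl M)
  | push (n : Stk) (f : Reg → Bool)
  | pop (n : Stk)
  | mstep
  | guess
  | query
  | seq (p q : Prog M)
  | ite (c : Ctl M → Bool) (p q : Prog M)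
  | loop (c : Ctl M → Bool) (p : Prog M)

/-- Big-step semantics: `Run O H p s w t s'` says that `p` leads from `s` to `s'` in `t` steps with
nondeterministic choices `w`, and all its queries have parameter at most `H`. -/
inductive Run (O : ParamFun) (H : ℕ) : Prog M → State M → List Bool → ℕ → State M → Prop
  | load (f s) : Run O H (.load f) s [] 1 (s.setCtl (f s.ctl))
  | push (n f s) : Run O H (.push n f) s [] 1 (s.set n (f s.reg :: s.st n))
  | pop (n s) : Run O H (.pop n) s [] 1 ((s.set n (s.st n).tail).setR (s.st n).head?)
  | mstep (s) : Run O H .mstep s [] 1 s.mstep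
  | guess (b s) : Run O H .guess s [b] 1 (s.setReg { s.reg with g := b })
  | query (s) (h : (s.st (.io .queryParam)).length ≤ H) : Run O H .query s [] 1 (s.ask O)
  | seq {p q s s' s'' w w' t t'} (h : Run O H p s w t s') (h' : Run O H q s' w' t' s'') :
      Run O H (.seq p q) s (w ++ w') (t + t') s''
  | iteTrue {c p q s s' w t} (hc : c s.ctl = true) (h : Run O H p s w t s') :
      Run O H (.ite c p q) s w (t + 1) s'
  | iteFalse {c p q s s' w t} (hc : c s.ctl = false) (h : Run O H q s w t s') :
      Run O H (.ite c p q) s w (t + 1) s'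
  | whileTrue {c p s s' s'' w w' t t'} (hc : c s.ctl = true) (h : Run O H p s w t s')
      (h' : Run O H (.loop c p) s' w' t' s'') :
      Run O H (.loop c p) s (w ++ w') (t + t' + 1) s''
  | whileFalse {c p s} (hc : c s.ctl = false) : Run O H (.loop c p) s [] 1 s

/-! ### Compilation -/

/-- Stack indices of compiled programs, except for the ports. -/
abbrev SimK (M : Machine) := Aux ⊕ (Port ⊕ M.K)

/-- Stack alphabets of compiled programs. -/
abbrev SimΓ (M : Machine) : SimK M → Type
  | .inl _ => Bool
  | .inr i => Alph M.Γ i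

/-- Statements of compiled programs. -/
abbrev SStmt (M : Machine) (Λ : Type) := TM2.Stmt (Alph (SimΓ M)) Λ (Ctl M)

/-- The machine stacks that represent the stacks of a program. -/
def stks (st : Stk → List Bool) (wk : ∀ k, List (M.Γ k)) :
    ∀ i : Port ⊕ SimK M, List (Alph (SimΓ M) i)
  | .inl p => st (.io p)
  | .inr (.inl x) => st (.ex x)
  | .inr (.inr (.inl p)) => st (.sim p)
  | .inr (.inr (.inr k)) => wk k

section

variable {Λ : Type}

/-- Push on a Boolean stack. -/
def pushStmt (n : Stk) (f : Ctl M → Bool) (q : SStmt M Λ) : SStmt M Λ :=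
  match n with
  | .io p => .push (.inl p) f q
  | .ex x => .push (.inr (.inl x)) f q
  | .sim p => .push (.inr (.inr (.inl p))) f q

/-- Pop from a Boolean stack. -/
def popStmt (n : Stk) (f : Ctl M → Option Bool → Ctl M) (q : SStmt M Λ) : SStmt M Λ :=
  match n with
  | .io p => .pop (.inl p) f q
  | .ex x => .pop (.inr (.inl x)) f q
  | .sim p => .pop (.inr (.inr (.inl p))) f q

theorem stks_update (st : Stk → List Bool) (wk : ∀ k, List (M.Γ k)) (n : Stk) (l : List Bool) :
    stks (Function.update st n l) wk = match n with
      | .io p => Function.update (stks st wk) (.inl p) l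
      | .ex x => Function.update (stks st wk) (.inr (.inl x)) l
      | .sim p => Function.update (stks st wk) (.inr (.inr (.inl p))) l := by
  funext i
  rcases n with p | p | x <;> rcases i with p' | x' | p' | k <;>
    simp only [stks, Function.update_apply, reduceCtorEq,
      Stk.io.injEq, Stk.ex.injEq, Stk.sim.injEq, if_false] <;>
    first | rfl | (split_ifs with h <;> [(subst h; simp); (simp [Function.update_of_ne, h, stks])])

theorem stepAux_pushStmt (n : Stk) (f : Ctl M → Bool) (q : SStmt M Λ) (v st wk) :
    TM2.stepAux (pushStmt n f q) v (stks st wk) =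
      TM2.stepAux q v (stks (Function.update st n (f v :: st n)) wk) := by
  rw [stks_update]
  rcases n with p | p | x <;> rfl

theorem stepAux_popStmt (n : Stk) (f : Ctl M → Option Bool → Ctl M) (q : SStmt M Λ) (v st wk) :
    TM2.stepAux (popStmt n f q) v (stks st wk) =
      TM2.stepAux q (f v (st n).head?) (stks (Function.update st n (st n).tail) wk) := by
  rw [stks_update]
  rcases n with p | p | x <;> rfl

/-- A statement that selects its continuation by a finite key. -/
noncomputable def dispatchList {α : Type} (key : Ctl M → α) (F : α → SStmt M Λ) :
    List α → SStmt M Λ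
  | [] => .halt
  | a :: l => open Classical in .branch (fun v => decide (key v = a)) (F a) (dispatchList key F l)

theorem stepAux_dispatchList {α : Type} (key : Ctl M → α) (F : α → SStmt M Λ) (l : List α) (v S)
    (h : key v ∈ l) : TM2.stepAux (dispatchList key F l) v S = TM2.stepAux (F (key v)) v S := by
  induction l with
  | nil => simp at h
  | cons a l ih =>
    by_cases h' : key v = a
    · simp [dispatchList, TM2.stepAux, h']
    · simp [dispatchList, TM2.stepAux, h', ih (by simpa [h'] using h)]

/-- A statement that selects its continuation by a finite key. -/
noncomputable def dispatch {α : Type} [Finite α] (key : Ctl M → α) (F : α → SStmt M Λ) :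
    SStmt M Λ :=
  haveI := Fintype.ofFinite α
  dispatchList key F Finset.univ.toList

/-- The simulated label is data in the control state, whereas the code at a label is one fixed
statement. A chain of branches over the finitely many labels bridges this within a single step. -/
theorem stepAux_dispatch {α : Type} [Finite α] (key : Ctl M → α) (F : α → SStmt M Λ) (v S) :
    TM2.stepAux (dispatch key F) v S = TM2.stepAux (F (key v)) v S :=
  stepAux_dispatchList _ _ _ _ _ (by simp)

/-- A statement of the simulated machine, followed by a jump to `e`. -/
def embStmt (e : Λ) : TM2.Stmt (Alph M.Γ) M.Λ M.σ → SStmt M Λ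
  | .push k f q => .push (.inr (.inr k)) (fun v => f v.2.1) (embStmt e q)
  | .peek k f q => .peek (.inr (.inr k)) (fun v a => (v.1, f v.2.1 a, v.2.2)) (embStmt e q)
  | .pop k f q => .pop (.inr (.inr k)) (fun v a => (v.1, f v.2.1 a, v.2.2)) (embStmt e q)
  | .load f q => .load (fun v => (v.1, f v.2.1, v.2.2)) (embStmt e q)
  | .branch f q₁ q₂ => .branch (fun v => f v.2.1) (embStmt e q₁) (embStmt e q₂)
  | .goto f => .load (fun v => (some (f v.2.1), v.2)) (.goto fun _ => e)
  | .halt => .load (fun v => (none, v.2)) (.goto fun _ => e)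

/-- The stacks of a program, given those of the simulated machine. -/
def simStks (st : Stk → List Bool) (S : ∀ i, List (Alph M.Γ i)) :
    ∀ i : Port ⊕ SimK M, List (Alph (SimΓ M) i)
  | .inl p => st (.io p)
  | .inr (.inl x) => st (.ex x)
  | .inr (.inr i) => S i

theorem simStks_update (st : Stk → List Bool) (S : ∀ i, List (Alph M.Γ i)) (i) (l) :
    simStks st (Function.update S i l) =
      Function.update (simStks st S) (.inr (.inr i)) l := by
  funext j
  rcases j with p | x | j
  · rfl
  · rfl
  · by_cases h : j = i
    · subst h; simp [simStks]
    · simp [simStks, h]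

theorem stks_eq_simStks (s : State M) : stks s.st s.wk = simStks s.st s.mc.stk := by
  funext j
  rcases j with p | x | p | j <;> rfl

theorem stks_withMc (s : State M) (c : M.Cfg) :
    stks (s.withMc c).st (s.withMc c).wk = simStks s.st c.stk := by
  funext j
  rcases j with p | x | p | j <;> rfl

/-- Jumps and halts of the simulated machine are only recorded in the control state, and real
control always passes to `e`; everything else is executed literally on the simulated stacks. -/
theorem stepAux_embStmt (e : Λ) (q : TM2.Stmt (Alph M.Γ) M.Λ M.σ) (l v ρ st) (S) :
    TM2.stepAux (embStmt e q) (l, v, ρ) (simStks st S) =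
      ⟨some e, ((TM2.stepAux q v S).l, (TM2.stepAux q v S).var, ρ),
        simStks st (TM2.stepAux q v S).stk⟩ := by
  induction q generalizing l v S with
  | push k f q ih =>
    simp only [embStmt, TM2.stepAux]
    rw [← ih, simStks_update]; rfl
  | peek k f q ih => simp only [embStmt, TM2.stepAux]; rw [← ih]; rfl
  | pop k f q ih =>
    simp only [embStmt, TM2.stepAux]
    rw [← ih, simStks_update]; rfl
  | load f q ih => simp only [embStmt, TM2.stepAux]; rw [← ih]
  | branch f q₁ q₂ ih₁ ih₂ =>
    simp only [embStmt, TM2.stepAux]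
    cases f v
    · simp only [cond_false]; exact ih₂ ..
    · simp only [cond_true]; exact ih₁ ..
  | goto f => rfl
  | halt => rfl

/-- The statement for one step of the simulated machine at the label `l`. -/
def mstepStmt (e : Λ) (l : Option M.Λ) : SStmt M Λ :=
  match l with
  | none => .goto fun _ => e
  | some q =>
    match M.instr q with
    | .det p => embStmt e p
    | .guess p₀ p₁ =>
      popStmt (.ex .R) (fun v a => (v.1, v.2.1, { v.2.2 with r := a }))
        (.branch (fun v => v.2.2.r.isNone)
          (.load (fun v => (v.1, v.2.1, { v.2.2 with ov := true })) (.goto fun _ => e))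
          (.branch (fun v => v.2.2.r == some true) (embStmt e p₁) (embStmt e p₀)))
    | .query _ => .goto fun _ => e

theorem stepAux_mstepStmt (e : Λ) (s : State M) :
    TM2.stepAux (mstepStmt e s.ctl.1) s.ctl (stks s.st s.wk) =
      ⟨some e, s.mstep.ctl, stks s.mstep.st s.mstep.wk⟩ := by
  unfold mstepStmt State.mstep
  split
  · rfl
  · split
    · rw [stks_withMc, stks_eq_simStks]; exact stepAux_embStmt ..
    · rw [stepAux_popStmt]
      split
      · next h =>
        simp only [h, TM2.stepAux]
        -- Popping an empty stack changes nothing, so running out of choices leaves the simulated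
        -- configuration at its guess.
        rw [show Function.update s.st (.ex .R) [].tail = s.st by
          rw [← h]; simp [h]]
        rfl
      · next b l h =>
        have : stks (Function.update s.st (.ex .R) (s.st (.ex .R)).tail) s.wk =
          simStks ((s.setR (some b)).set (.ex .R) l).st s.mc.stk := by
          rw [h]; exact stks_eq_simStks ((s.setR (some b)).set (.ex .R) l)
        rw [stks_withMc, this]
        simp only [h, TM2.stepAux]
        cases b
        · exact stepAux_embStmt ..
        · exact stepAux_embStmt ..
    · rfl

end

/-- The labels of a compiled program. -/
def Prog.Lab : Prog M → Type
  | .seq p q => p.Lab ⊕ q.Lab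
  | .ite _ p q => Option (p.Lab ⊕ q.Lab)
  | .loop _ p => Option p.Lab
  | _ => Unit

instance Prog.finiteLab : (p : Prog M) → Finite p.Lab
  | .seq p q => haveI := p.finiteLab; haveI := q.finiteLab
      inferInstanceAs (Finite (p.Lab ⊕ q.Lab))
  | .ite _ p q => haveI := p.finiteLab; haveI := q.finiteLab
      inferInstanceAs (Finite (Option (p.Lab ⊕ q.Lab)))
  | .loop _ p => haveI := p.finiteLab
      inferInstanceAs (Finite (Option p.Lab))
  | .load _ | .push _ _ | .pop _ | .mstep | .guess | .query => inferInstanceAs (Finite Unit)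

/-- The entry label of a compiled program. -/
def Prog.entry : (p : Prog M) → p.Lab
  | .seq p _ => .inl p.entry
  | .ite _ _ _ => none
  | .loop _ _ => none
  | .load _ | .push _ _ | .pop _ | .mstep | .guess | .query => ()

/-- The code of a compiled program with exit label `e`, whose labels are embedded by `i`. -/
noncomputable def Prog.code {Λ : Type} :
    (p : Prog M) → (e : Λ) → (i : p.Lab → Λ) → p.Lab → Instr (SimΓ M) Λ (Ctl M)
  | .load f, e, _, _ => .det (.load f (.goto fun _ => e))
  | .push n f, e, _, _ => .det (pushStmt n (fun v => f v.2.2) (.goto fun _ => e))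
  | .pop n, e, _, _ =>
      .det (popStmt n (fun v a => (v.1, v.2.1, { v.2.2 with r := a })) (.goto fun _ => e))
  | .mstep, e, _, _ => .det (dispatch Prod.fst (mstepStmt e))
  | .guess, e, _, _ => .guess
      (.load (fun v => (v.1, v.2.1, { v.2.2 with g := false })) (.goto fun _ => e))
      (.load (fun v => (v.1, v.2.1, { v.2.2 with g := true })) (.goto fun _ => e))
  | .query, e, _, _ => .query e
  | .seq p q, _, i, .inl l => p.code (i (.inr q.entry)) (fun l => i (.inl l)) l
  | .seq _ q, e, i, .inr l => q.code e (fun l => i (.inr l)) l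
  | .ite c p q, _, i, none => .det (.branch c (.goto fun _ => i (some (.inl p.entry)))
      (.goto fun _ => i (some (.inr q.entry))))
  | .ite _ p _, e, i, some (.inl l) => p.code e (fun l => i (some (.inl l))) l
  | .ite _ _ q, e, i, some (.inr l) => q.code e (fun l => i (some (.inr l))) l
  | .loop c p, e, i, none =>
      .det (.branch c (.goto fun _ => i (some p.entry)) (.goto fun _ => e))
  | .loop _ p, _, i, some l => p.code (i none) (fun l => i (some l)) l

/-- The machine that runs the program `p`. -/
noncomputable def Prog.compile (p : Prog M) (acc : Ctl M → Bool) : Machine where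
  K := SimK M
  Γ := SimΓ M
  finΓ
    | .inl _ => inferInstanceAs (Finite Bool)
    | .inr (.inl _) => inferInstanceAs (Finite Bool)
    | .inr (.inr k) => M.finΓ k
  Λ := Option p.Lab
  σ := Ctl M
  instr
    | none => .det .halt
    | some l => p.code none some l
  main := some p.entry
  start := (none, M.start, .start)
  accept := acc

/-- The initial state of a program. -/
def State.init (M : Machine) (x : List Bool) (k : ℕ) : State M where
  ctl := (none, M.start, .start)
  st
    | .io .input => x
    | .io .param => List.replicate k true
    | _ => []
  wk _ := []

/-- The machine configuration that represents a program state. -/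
def State.cfg (p : Prog M) (acc : Ctl M → Bool) (l : Option (Option p.Lab)) (s : State M) :
    (p.compile acc).Cfg := ⟨l, s.ctl, stks s.st s.wk⟩

theorem State.cfg_init (p : Prog M) (acc : Ctl M → Bool) (x k) :
    (State.init M x k).cfg p acc (some (some p.entry)) = (p.compile acc).init x k := by
  unfold State.cfg Machine.init
  congr 1
  funext i
  rcases i with p | x | p | j
  · cases p <;> rfl
  all_goals rfl

/-- The hypothesis `hi` says that the code of the subprogram `p` sits inside that of `P`, via `i`
and with exit `e`. The exit must be general in the induction: the first half of a sequence exits to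
the entry of the second, and a loop body to the loop head. -/
theorem Run.bPath_aux {O : ParamFun} {H : ℕ} {P : Prog M} {acc : Ctl M → Bool}
    {p : Prog M} {s w t s'} (h : Run O H p s w t s')
    (e : Option P.Lab) (i : p.Lab → Option P.Lab)
    (hi : ∀ l, (P.compile acc).instr (i l) = p.code e i l) :
    (P.compile acc).BPath O H (s.cfg P acc (some (i p.entry))) w t (s'.cfg P acc (some e)) := by
  induction h generalizing e with
  | load f s => exact .det rfl (hi ()) (.refl _)
  | push n f s =>
    refine .det rfl (hi ()) ?_
    erw [stepAux_pushStmt]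
    exact .refl _
  | pop n s =>
    refine .det rfl (hi ()) ?_
    erw [stepAux_popStmt]
    exact .refl _
  | mstep s =>
    refine .det rfl (hi ()) ?_
    erw [stepAux_dispatch, stepAux_mstepStmt]
    exact .refl _
  | guess b s =>
    refine .guess b rfl (hi ()) ?_
    cases b <;> exact .refl _
  | query s h =>
    refine .query rfl (hi ()) h ?_
    have : (P.compile acc).answered O (s.cfg P acc (some (i ()))).stk =
        stks (s.ask O).st (s.ask O).wk := by
      funext j
      rcases j with p | x | p | j
      · cases p <;> rfl
      all_goals rfl
    erw [this]
    exact .refl _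
  | seq h h' ih ih' =>
    exact (ih _ _ fun l => hi (.inl l)).trans (ih' _ _ fun l => hi (.inr l))
  | iteTrue hc h ih =>
    refine .det rfl (hi none) ?_
    simp only [TM2.stepAux, State.cfg, hc]
    exact ih _ _ fun l => hi (some (.inl l))
  | iteFalse hc h ih =>
    refine .det rfl (hi none) ?_
    simp only [TM2.stepAux, State.cfg, hc]
    exact ih _ _ fun l => hi (some (.inr l))
  | whileTrue hc h h' ih ih' =>
    refine .det rfl (hi none) ?_
    simp only [TM2.stepAux, State.cfg, hc]
    exact (ih _ _ fun l => hi (some l)).trans (ih' _ _ hi)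
  | whileFalse hc =>
    refine .det rfl (hi none) ?_
    simp only [TM2.stepAux, State.cfg, hc]
    exact .refl _

theorem Run.bPath {O : ParamFun} {H : ℕ} {p : Prog M} {acc : Ctl M → Bool} {x k w t s'}
    (h : Run O H p (State.init M x k) w t s') :
    ∃ c, (p.compile acc).BPath O H ((p.compile acc).init x k) w (t + 1) c ∧ c.l = none ∧
      c.var = s'.ctl := by
  have h1 := h.bPath_aux (P := p) (acc := acc) none some (fun _ => rfl)
  rw [State.cfg_init] at h1
  -- The additional step executes the halting statement at the common exit label `none`.
  have h2 := h1.trans (.det rfl rfl (.refl _))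
  rw [List.append_nil] at h2
  exact ⟨_, h2, rfl, rfl⟩

/-- The program makes no nondeterministic moves. -/
def Prog.NoGuess : Prog M → Prop
  | .guess => False
  | .seq p q => p.NoGuess ∧ q.NoGuess
  | .ite _ p q => p.NoGuess ∧ q.NoGuess
  | .loop _ p => p.NoGuess
  | _ => True

/-- The program makes no queries. -/
def Prog.NoQuery : Prog M → Prop
  | .query => False
  | .seq p q => p.NoQuery ∧ q.NoQuery
  | .ite _ p q => p.NoQuery ∧ q.NoQuery
  | .loop _ p => p.NoQuery
  | _ => True

theorem Prog.NoGuess.code {Λ : Type} {p : Prog M} (h : p.NoGuess) (e : Λ) (i : p.Lab → Λ) (l) :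
    ∀ s₀ s₁, p.code e i l ≠ .guess s₀ s₁ := by
  induction p generalizing e with
  | guess => exact h.elim
  | seq p q ihp ihq =>
    rcases l with l | l
    · exact ihp h.1 _ _ _
    · exact ihq h.2 _ _ _
  | ite c p q ihp ihq =>
    rcases l with _ | l | l
    · intro s₀ s₁; simp [Prog.code]
    · exact ihp h.1 _ _ _
    · exact ihq h.2 _ _ _
  | loop c p ih =>
    rcases l with _ | l
    · intro s₀ s₁; simp [Prog.code]
    · exact ih h _ _ _
  | _ => intro s₀ s₁; simp [Prog.code]

theorem Prog.NoQuery.code {Λ : Type} {p : Prog M} (h : p.NoQuery) (e : Λ) (i : p.Lab → Λ) (l) :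
    ∀ q, p.code e i l ≠ .query q := by
  induction p generalizing e with
  | query => exact h.elim
  | seq p q ihp ihq =>
    rcases l with l | l
    · exact ihp h.1 _ _ _
    · exact ihq h.2 _ _ _
  | ite c p q ihp ihq =>
    rcases l with _ | l | l
    · intro s₀; simp [Prog.code]
    · exact ihp h.1 _ _ _
    · exact ihq h.2 _ _ _
  | loop c p ih =>
    rcases l with _ | l
    · intro s₀; simp [Prog.code]
    · exact ih h _ _ _
  | _ => intro s₀; simp [Prog.code]

theorem Prog.NoGuess.deterministic {p : Prog M} (h : p.NoGuess) (acc : Ctl M → Bool) :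
    (p.compile acc).Deterministic := by
  rintro (_ | l) s₀ s₁
  · intro h; cases h
  · exact h.code none some l s₀ s₁

theorem Prog.NoQuery.oracleFree {p : Prog M} (h : p.NoQuery) (acc : Ctl M → Bool) :
    (p.compile acc).OracleFree := by
  rintro (_ | l) s₀
  · intro h; cases h
  · exact h.code none some l s₀

/-! ### Total correctness triples -/

/-- From the state `s`, the program `p` with the choices `w` reaches within `T` steps a final state
that satisfies `Q`. -/
def Tri (O : ParamFun) (H : ℕ) (p : Prog M) (s : State M) (w : List Bool) (T : ℕ)
    (Q : State M → Prop) : Prop :=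
  ∃ t s', t ≤ T ∧ Run O H p s w t s' ∧ Q s'

namespace Tri

variable {p q : Prog M} {s s₁ : State M} {w w' : List Bool} {T T' : ℕ} {P Q : State M → Prop}
  {c : Ctl M → Bool}

theorem mono (h : Tri O H p s w T P) (hT : T ≤ T') (hQ : ∀ s', P s' → Q s') :
    Tri O H p s w T' Q := by
  obtain ⟨t, s', ht, h, hP⟩ := h
  exact ⟨t, s', ht.trans hT, h, hQ _ hP⟩

theorem time (h : Tri O H p s w T P) (hT : T ≤ T') : Tri O H p s w T' P := h.mono hT fun _ => id

theorem seqW (h : Tri O H p s w T P) (h' : ∀ s', P s' → Tri O H q s' w' T' Q) :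
    Tri O H (.seq p q) s (w ++ w') (T + T') Q := by
  obtain ⟨t, s', ht, h, hP⟩ := h
  obtain ⟨t', s'', ht', h', hQ⟩ := h' _ hP
  exact ⟨_, _, Nat.add_le_add ht ht', h.seq h', hQ⟩

theorem seq (h : Tri O H p s [] T P) (h' : ∀ s', P s' → Tri O H q s' [] T' Q) :
    Tri O H (.seq p q) s [] (T + T') Q := h.seqW h'

theorem seqW_nil (h : Tri O H p s w T P) (h' : ∀ s', P s' → Tri O H q s' [] T' Q) :
    Tri O H (.seq p q) s w (T + T') Q := by simpa using h.seqW h'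

theorem seq_eq (h : Tri O H p s [] T (· = s₁)) (h' : Tri O H q s₁ w T' Q) :
    Tri O H (.seq p q) s w (T + T') Q :=
  h.seqW fun _ h => h ▸ h'

theorem seqW_eq (h : Tri O H p s w T (· = s₁)) (h' : Tri O H q s₁ w' T' Q) :
    Tri O H (.seq p q) s (w ++ w') (T + T') Q :=
  h.seqW fun _ h => h ▸ h'

theorem load (f : Ctl M → Ctl M) : Tri O H (.load f) s [] 1 (· = s.setCtl (f s.ctl)) :=
  ⟨_, _, le_rfl, .load .., rfl⟩

theorem push (n : Stk) (f : Reg → Bool) :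
    Tri O H (.push n f) s [] 1 (· = s.set n (f s.reg :: s.st n)) :=
  ⟨_, _, le_rfl, .push .., rfl⟩

theorem pop (n : Stk) :
    Tri O H (.pop n) s [] 1 (· = (s.set n (s.st n).tail).setR (s.st n).head?) :=
  ⟨_, _, le_rfl, .pop .., rfl⟩

theorem guess (b : Bool) : Tri O H .guess s [b] 1 (· = s.setReg { s.reg with g := b }) :=
  ⟨_, _, le_rfl, .guess .., rfl⟩

theorem mstep : Tri O H .mstep s [] 1 (· = s.mstep) :=
  ⟨_, _, le_rfl, .mstep .., rfl⟩

theorem query (h : (s.st (.io .queryParam)).length ≤ H) : Tri O H .query s [] 1 (· = s.ask O) :=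
  ⟨_, _, le_rfl, .query _ h, rfl⟩

theorem iteTrue (hc : c s.ctl = true) (h : Tri O H p s w T Q) :
    Tri O H (.ite c p q) s w (T + 1) Q := by
  obtain ⟨t, s', ht, h, hP⟩ := h
  exact ⟨_, _, by omega, .iteTrue hc h, hP⟩

theorem iteFalse (hc : c s.ctl = false) (h : Tri O H q s w T Q) :
    Tri O H (.ite c p q) s w (T + 1) Q := by
  obtain ⟨t, s', ht, h, hP⟩ := h
  exact ⟨_, _, by omega, .iteFalse hc h, hP⟩

theorem whileTrueW (hc : c s.ctl = true) (h : Tri O H p s w T P)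
    (h' : ∀ s', P s' → Tri O H (.loop c p) s' w' T' Q) :
    Tri O H (.loop c p) s (w ++ w') (T + T' + 1) Q := by
  obtain ⟨t, s', ht, h, hP⟩ := h
  obtain ⟨t', s'', ht', h', hQ⟩ := h' _ hP
  exact ⟨_, _, by omega, .whileTrue hc h h', hQ⟩

theorem whileTrue (hc : c s.ctl = true) (h : Tri O H p s [] T P)
    (h' : ∀ s', P s' → Tri O H (.loop c p) s' [] T' Q) :
    Tri O H (.loop c p) s [] (T + T' + 1) Q := whileTrueW hc h h'

theorem whileFalse (hc : c s.ctl = false) : Tri O H (.loop c p) s [] 1 (· = s) :=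
  ⟨_, _, le_rfl, .whileFalse hc, rfl⟩

end Tri

/-! ### Loops over stacks -/

theorem State.setR_setR (s : State M) (r r' : Option Bool) : (s.setR r).setR r' = s.setR r' := rfl

theorem State.set_self (s : State M) (n : Stk) : s.set n (s.st n) = s := by
  simp [State.set]

/-- What a symbol `b` contributes to the stack `m` when it is distributed by `ps`. -/
def contrib (ps : List (Stk × (Bool → Bool))) (m : Stk) (b : Bool) : List Bool :=
  match ps with
  | [] => []
  | (n, f) :: ps => contrib ps m b ++ if n = m then [f b] else []

theorem contrib_eq_nil {ps : List (Stk × (Bool → Bool))} {m : Stk} (h : m ∉ ps.map Prod.fst)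
    (b : Bool) : contrib ps m b = [] := by
  induction ps with
  | nil => rfl
  | cons p ps ih =>
    simp only [List.map_cons, List.mem_cons, not_or] at h
    simp [contrib, ih h.2, Ne.symm h.1]

/-- Distribute the symbols of `l` over the stacks; the first symbol of `l` ends up on top. -/
def State.spill (s : State M) (l : List Bool) (ps : List (Stk × (Bool → Bool))) : State M :=
  { s with st := fun m => l.flatMap (contrib ps m) ++ s.st m }

namespace Prog

/-- Push constants, or copies of the last symbol popped, on stacks. -/
def pushes : List (Stk × (Bool → Bool)) → Prog M
  | [] => .load id
  | (n, f) :: ps => .seq (.push n fun ρ => f (ρ.r.getD false)) (pushes ps)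

/-- Pop all symbols of a stack, and run `p` after each pop. -/
def each (n : Stk) (p : Prog M) : Prog M :=
  .seq (.pop n) (.loop (fun v => v.2.2.r.isSome) (.seq p (.pop n)))

/-- Distribute the symbols of a stack without changing that stack. -/
def scan (n : Stk) (ps : List (Stk × (Bool → Bool))) : Prog M :=
  .seq (each n (pushes ((.ex .T, id) :: ps))) (each (.ex .T) (pushes [(n, id)]))

/-- Empty a stack. -/
def clear (n : Stk) : Prog M := each n (pushes [])

end Prog

theorem Tri.pushes (ps : List (Stk × (Bool → Bool))) (s : State M) :
    Tri O H (.pushes ps) s [] (ps.length + 1) (· = s.spill [s.reg.r.getD false] ps) := by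
  induction ps generalizing s with
  | nil => exact (Tri.load id).mono (by simp) fun s' h => by simp [h, State.spill, contrib]; rfl
  | cons p ps ih =>
    obtain ⟨n, f⟩ := p
    refine ((Tri.push n _).seq_eq (ih _)).mono (by simp; omega) ?_
    rintro _ rfl
    simp only [State.spill, State.set, State.reg, contrib, State.mk.injEq, true_and, and_true,
      List.flatMap_cons, List.flatMap_nil, List.append_nil]
    funext m
    by_cases h : n = m
    · subst h; simp
    · simp [h, Function.update_of_ne (Ne.symm h)]

/-- The invariant `P l` describes the state before a pop, when `l` is still on the stack. The body
`p` sees the popped symbol in `r` and must establish the invariant for the tail. The final pop, from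
the empty stack, leaves `r = none`. -/
theorem Tri.each {n : Stk} {p : Prog M} {T : ℕ} {P : List Bool → State M → Prop}
    (hst : ∀ l s, P l s → s.st n = l)
    (hp : ∀ b l s, P (b :: l) s → Tri O H p ((s.set n l).setR (some b)) [] T (P l))
    {l : List Bool} {s : State M} (h : P l s) :
    Tri O H (.each n p) s [] ((T + 2) * l.length + 2)
      (fun s' => ∃ s₀, P [] s₀ ∧ s' = s₀.setR none) := by
  suffices hw : ∀ l s, P l s →
      Tri O H (.loop (fun v => v.2.2.r.isSome) (.seq p (.pop n)))
        ((s.set n (s.st n).tail).setR (s.st n).head?) []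
        ((T + 2) * l.length + 1) (fun s' => ∃ s₀, P [] s₀ ∧ s' = s₀.setR none) from
    ((Tri.pop n).seq_eq (hw l s h)).time (by omega)
  clear h s l
  intro l
  induction l with
  | nil =>
    intro s h
    have h0 := hst _ _ h
    refine (Tri.whileFalse (by simp [h0, State.setR, State.setReg])).mono (by simp) ?_
    rintro _ rfl
    exact ⟨s, h, by rw [h0, List.tail_nil, ← h0, State.set_self, h0]; rfl⟩
  | cons b l ih =>
    intro s h
    have h0 := hst _ _ h
    have hb := (hp b l s h).seq (q := .pop n) fun s' hs' => (Tri.pop n).mono le_rfl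
      (Q := fun s'' => ∃ s', P l s' ∧ s'' = (s'.set n (s'.st n).tail).setR (s'.st n).head?)
      (by rintro _ rfl; exact ⟨s', hs', rfl⟩)
    rw [h0]
    refine (Tri.whileTrue (by simp [State.setR, State.setReg]) hb ?_).time
      (T := T + 1 + ((T + 2) * l.length + 1) + 1) (by simp only [List.length_cons]; ring_nf; omega)
    rintro _ ⟨s', hs', rfl⟩
    exact ih s' hs'

theorem Tri.each_pushes {n : Stk} {ps : List (Stk × (Bool → Bool))} (hn : n ∉ ps.map Prod.fst)
    (s : State M) :
    Tri O H (.each n (.pushes ps)) s [] ((ps.length + 3) * (s.st n).length + 2)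
      (· = ((s.set n []).spill (s.st n).reverse ps).setR none) := by
  refine (Tri.each (n := n) (T := ps.length + 1)
    -- Here `l'` lists the symbols popped so far, the latest first, as they lie on the target
    -- stacks.
    (P := fun l s' => ∃ l' r, l'.reverse ++ l = s.st n ∧ s' = ((s.set n l).spill l' ps).setR r)
    ?_ ?_ (l := s.st n) (s := s) ⟨[], s.reg.r, rfl, ?_⟩).mono le_rfl ?_
  · rintro l _ ⟨l', r, -, rfl⟩
    simp [State.spill, State.setR, State.setReg, State.set, contrib_eq_nil hn]
  · rintro b l _ ⟨l', r, hl, rfl⟩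
    refine (Tri.pushes ps _).mono le_rfl ?_
    rintro _ rfl
    refine ⟨b :: l', some b, by simpa using hl, ?_⟩
    simp only [State.spill, State.setR, State.setReg, State.set, State.reg, State.mk.injEq,
      true_and, and_true, List.flatMap_cons, List.flatMap_nil, List.append_nil, Option.getD_some]
    funext m
    by_cases h : m = n
    · subst h; simp [contrib_eq_nil hn]
    · simp [h]
  · rw [State.set_self]
    simp [State.spill, State.setR, State.setReg, State.reg]
  · rintro _ ⟨_, ⟨l', r, hl, rfl⟩, rfl⟩
    rw [State.setR_setR, ← hl]
    simp

theorem Tri.clear (n : Stk) (s : State M) :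
    Tri O H (.clear n) s [] (3 * (s.st n).length + 2) (· = (s.set n []).setR none) := by
  refine (Tri.each_pushes (by simp) s).mono (by simp) ?_
  rintro _ rfl
  simp [State.spill, contrib, List.flatMap]

/-- Emptying `n` into the buffer `T` reverses it, and the way back restores the order, so the stack
can be read any number of times. -/
theorem Tri.scan {n : Stk} {ps : List (Stk × (Bool → Bool))} (hn : n ∉ ps.map Prod.fst)
    (hT : .ex .T ∉ ps.map Prod.fst) (hnT : n ≠ .ex .T) (s : State M) (hs : s.st (.ex .T) = []) :
    Tri O H (.scan n ps) s [] ((ps.length + 8) * (s.st n).length + 4)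
      (· = (s.spill (s.st n).reverse ps).setR none) := by
  have h1 := Tri.each_pushes (O := O) (H := H) (n := n) (ps := (.ex .T, id) :: ps)
    (by simpa [hnT] using hn) s
  refine (h1.seq_eq (Tri.each_pushes (by simpa using hnT.symm) _)).mono ?_ ?_
  · simp [State.spill, State.setR, State.setReg, State.set, contrib, contrib_eq_nil hT, hs,
      Function.update_of_ne hnT.symm]
    ring_nf; omega
  · rintro _ rfl
    have e : ∀ l : List Bool, l.flatMap (fun b => [b]) = l := fun l => by simp
    have e0 : ∀ l : List Bool, l.flatMap (fun _ => ([] : List Bool)) = [] := fun l => by simp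
    have hn' : contrib ps n = fun _ => [] := funext (contrib_eq_nil hn)
    have hT' : contrib ps (.ex .T) = fun _ => [] := funext (contrib_eq_nil hT)
    simp only [State.spill, State.setR, State.setReg, State.set, State.reg, State.mk.injEq,
      true_and, and_true, contrib]
    funext m
    by_cases h : m = n
    · subst h; simp [hn', hT', hnT, hnT.symm, hs, e, e0]
    · by_cases h' : m = .ex .T
      · subst h'; simp [hT', hs, Ne.symm hnT, hnT, e0]
      · simp [h, h', Ne.symm h, Ne.symm h', e0]

theorem State.set_set (s : State M) (n : Stk) (l l' : List Bool) :
    (s.set n l).set n l' = s.set n l' := by simp [State.set]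

theorem State.set_comm (s : State M) {n m : Stk} (h : n ≠ m) (l l' : List Bool) :
    (s.set n l).set m l' = (s.set m l').set n l := by
  simp [State.set, Function.update_comm h]

@[simp] theorem State.set_st_self (s : State M) (n : Stk) (l : List Bool) :
    (s.set n l).st n = l := by simp [State.set]

theorem State.set_st_of_ne (s : State M) {n m : Stk} (h : m ≠ n) (l : List Bool) :
    (s.set n l).st m = s.st m := by simp [State.set, h]

/-- Replace the registers by a program. -/
def Prog.loadR (f : Reg → Reg) : Prog M := .load fun v => (v.1, v.2.1, f v.2.2)

theorem Tri.loadR {s : State M} (f : Reg → Reg) :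
    Tri O H (.loadR f) s [] 1 (· = s.setReg (f s.reg)) := Tri.load _

/-! ### Comparison of binary numbers -/

/-- The number with the given binary digits, the least significant one first. -/
def val : List Bool → ℕ
  | [] => 0
  | b :: l => b.toNat + 2 * val l

/-- Compare two numbers; `fl` is the result in case of equality. -/
def geDigits (fl : Bool) : List Bool → List Bool → Bool
  | [], z => fl && z.all not
  | a :: l, z =>
    geDigits (if a = z.head?.getD false then fl else a) l z.tail

theorem val_eq_zero (z : List Bool) : z.all not = decide (val z = 0) := by
  induction z with
  | nil => rfl
  | cons b z ih => cases b <;> simp [val, ih]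

/-- Digits arrive least significant first, so a later difference overrides the verdict so far, and
equal digits keep it. An exhausted `z` is read as zeros; digits of `z` beyond `a` must all be zero.
-/
theorem geDigits_eq (fl : Bool) (a z : List Bool) :
    geDigits fl a z = (decide (val z < val a) || (fl && decide (val z = val a))) := by
  induction a generalizing fl z with
  | nil => simp only [geDigits, val_eq_zero, val]; simp; rfl
  | cons b a ih =>
    rw [geDigits, ih]
    rcases z with _ | ⟨c, z⟩
    · cases b <;> cases fl <;> simp [val] <;> grind
    · cases b <;> cases c <;> cases fl <;> simp [val] <;> grind

/-- Set the register `fl` to the truth value of `val z ≤ val a`, and empty both stacks. -/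
def Prog.compare (a z : Stk) : Prog M :=
  .seq (.loadR fun ρ => { ρ with fl := true }) <|
  .seq (.each a <|
    .seq (.loadR fun ρ => { ρ with g := ρ.r.getD false }) <|
    .seq (.pop z) <|
    .loadR fun ρ => { ρ with fl := if ρ.g = ρ.r.getD false then ρ.fl else ρ.g }) <|
  .each z (.loadR fun ρ => { ρ with fl := ρ.fl && !(ρ.r.getD false) })

theorem Tri.compare {a z : Stk} (haz : a ≠ z) (s : State M) :
    Tri O H (.compare a z) s [] (5 * (s.st a).length + 3 * (s.st z).length + 5)
      (fun s' => ∃ g, s' = ((s.set a []).set z []).setReg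
        { s.reg with r := none, g := g, fl := decide (val (s.st z) ≤ val (s.st a)) }) := by
  let F : List Bool → List Bool → Bool → Bool → Option Bool → State M := fun l z' fl g r =>
    ((s.set a l).set z z').setReg { s.reg with r := r, g := g, fl := fl }
  have h1 : Tri O H (.each a <|
      .seq (.loadR fun ρ => { ρ with g := ρ.r.getD false }) <|
      .seq (.pop z) <|
      .loadR fun ρ => { ρ with fl := if ρ.g = ρ.r.getD false then ρ.fl else ρ.g })
      (s.setReg { s.reg with fl := true }) []
      (5 * (s.st a).length + 2) (fun s' => ∃ z' fl g,
        (fl && z'.all not) = geDigits true (s.st a) (s.st z) ∧ z'.length ≤ (s.st z).length ∧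
        s' = F [] z' fl g none) := by
    -- The value of `geDigits` on the digits that remain, with the current verdict, is invariant.
    refine (Tri.each (T := 3) (l := s.st a)
      (P := fun l s' => ∃ z' fl g r, geDigits fl l z' = geDigits true (s.st a) (s.st z) ∧
        z'.length ≤ (s.st z).length ∧ s' = F l z' fl g r) ?_ ?_ ?_).mono le_rfl ?_
    · rintro l _ ⟨z', fl, g, r, -, -, rfl⟩
      simp [F, State.setReg, State.set_st_of_ne _ haz]
    · rintro b l _ ⟨z', fl, g, r, h, hl, rfl⟩
      refine ((Tri.loadR _).seq_eq ((Tri.pop _).seq_eq (Tri.loadR _))).mono le_rfl ?_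
      rintro _ rfl
      refine ⟨z'.tail, if b = z'.head?.getD false then fl else b, b, z'.head?, h, by
        simp; omega, ?_⟩
      have e1 : ((s.set a (b :: l)).set z z').set a l = (s.set a l).set z z' := by
        rw [State.set_comm _ haz.symm, State.set_set]
      have e2 : (((s.set a (b :: l)).set z z').set a l).set z z'.tail =
          (s.set a l).set z z'.tail := by rw [e1, State.set_set]
      have e3 : (Function.update (Function.update s.st a (b :: l)) z z') z = z' := by simp
      simp only [F, State.setReg, State.setR, State.set, State.reg, State.mk.injEq] at e1 e2 ⊢
      simp [e2, haz.symm]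
    · exact ⟨s.st z, true, s.reg.g, s.reg.r, rfl, le_rfl, by
        simp [F, State.setReg, State.set, State.reg]⟩
    · rintro _ ⟨_, ⟨z', fl, g, r, h, hl, rfl⟩, rfl⟩
      exact ⟨z', fl, g, h, hl, rfl⟩
  refine ((Tri.loadR _).seq_eq (h1.seq (T' := 3 * (s.st z).length + 2) ?_)).time (by omega)
  rintro _ ⟨z', fl, g, h, hl, rfl⟩
  -- The initial verdict `true` turns the strict comparison into a weak one.
  have h2 : decide (val (s.st z) ≤ val (s.st a)) = geDigits true (s.st a) (s.st z) := by
    rw [geDigits_eq]; simp [le_iff_lt_or_eq]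
  rw [h2]
  refine (Tri.each (T := 1) (l := z')
      (P := fun l s' => ∃ fl r, (fl && l.all not) = geDigits true (s.st a) (s.st z) ∧
        s' = F [] l fl g r) ?_ ?_ ⟨fl, none, h, rfl⟩).mono (by omega) ?_
  · rintro l _ ⟨fl, r, -, rfl⟩
    simp [F, State.setReg]
  · rintro b l _ ⟨fl, r, h, rfl⟩
    refine (Tri.loadR _).mono le_rfl ?_
    rintro _ rfl
    refine ⟨fl && !b, some b, by rw [← h]; simp [Bool.and_assoc], ?_⟩
    simp [F, State.setReg, State.setR, State.set, State.reg]
  · rintro _ ⟨_, ⟨fl, r, h, rfl⟩, rfl⟩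
    refine ⟨g, ?_⟩
    rw [← h]
    simp [F, State.setReg, State.setR, State.reg]

/-! ### Simulation with given nondeterministic choices -/

namespace Machine

/-- The next step from `c` is nondeterministic. -/
def AtGuess (c : M.Cfg) : Prop := ∃ q s₀ s₁, c.l = some q ∧ M.instr q = .guess s₀ s₁

theorem AtGuess.path {c₀ c : M.Cfg} {w t} (hc : AtGuess c) (h : M.Path O c₀ w t c) (b : Bool) :
    ∃ c', M.Path O c₀ (w ++ [b]) (t + 1) c' := by
  obtain ⟨q, s₀, s₁, hq, hi⟩ := hc
  exact ⟨_, h.trans (.guess b hq hi (.refl _))⟩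

/-- Acceptance of the choices `u` by the computation of `M` on `(x, k)`: if `m₂` holds, then `u` is
accepted if more choices are needed. Otherwise `u` is accepted if an initial segment of `u` is an
accepting path and, in case that `m₃` holds, all choices after it are zero. -/
def Accepts (M : Machine) (x : List Bool) (k : ℕ) (m₂ m₃ : Bool) (u : List Bool) : Prop :=
  match m₂ with
  | true => ∃ t c, M.FreePath (M.init x k) u t c ∧ AtGuess c
  | false => ∃ w r t c, u = w ++ r ∧ M.FreePath (M.init x k) w t c ∧ c.l = none ∧
      M.accept c.var = true ∧ (m₃ = true → ∀ b ∈ r, b = false)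

variable {x : List Bool} {k : ℕ}

theorem OracleFree.not_atGuess (hM : M.OracleFree) {c₀ c c' : M.Cfg} {w r t t'}
    (h : M.FreePath c₀ w t c) (hc : c.l = none) (h' : M.FreePath c₀ (w ++ r) t' c') :
    ¬ AtGuess c' := by
  intro hg
  obtain ⟨c'', h''⟩ := hg.path h' false
  have := ((hM.bPath (H := 0) h).compat hc h'' (.inr (by simp))).2.1.length_le
  simp at this

/-- The choice words of halting paths form a prefix-free set: at most one initial segment of a given
word is a complete path. Both counting lemmas below depend on this. -/
theorem OracleFree.halt_unique (hM : M.OracleFree) {c₀ c c' : M.Cfg} {w r w' r' t t'}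
    (h : M.FreePath c₀ w t c) (hc : c.l = none) (h' : M.FreePath c₀ w' t' c') (hc' : c'.l = none)
    (he : w ++ r = w' ++ r') : w = w' ∧ r = r' ∧ c = c' := by
  have h1 := ((hM.bPath (H := 0) h).compat hc h'
    (List.prefix_or_prefix_of_prefix (List.prefix_append w' r') (he ▸ List.prefix_append w r)))
  obtain ⟨rfl, rfl⟩ := h1.2.2.1 hc'
  exact ⟨rfl, by simpa using he, rfl⟩

theorem OracleFree.accepts_halt (hM : M.OracleFree) {c : M.Cfg} {w r t m₂ m₃}
    (h : M.FreePath (M.init x k) w t c) (hc : c.l = none) :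
    M.Accepts x k m₂ m₃ (w ++ r) ↔
      m₂ = false ∧ M.accept c.var = true ∧ (m₃ = true → ∀ b ∈ r, b = false) := by
  cases m₂ with
  | true =>
    simp only [Accepts, Bool.true_eq_false, false_and, iff_false]
    rintro ⟨t', c', h', hg⟩
    exact hM.not_atGuess h hc h' hg
  | false =>
    constructor
    · rintro ⟨w', r', t', c', he, h', hc', ha, hr⟩
      obtain ⟨rfl, rfl, rfl⟩ := hM.halt_unique h hc h' hc' he
      exact ⟨rfl, ha, hr⟩
    · rintro ⟨-, ha, hr⟩
      exact ⟨w, r, t, c, rfl, h, hc, ha, hr⟩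

theorem OracleFree.accepts_atGuess (hM : M.OracleFree) {c : M.Cfg} {u t m₂ m₃}
    (h : M.FreePath (M.init x k) u t c) (hc : AtGuess c) :
    M.Accepts x k m₂ m₃ u ↔ m₂ = true := by
  cases m₂ with
  | true => simp only [Accepts, iff_true]; exact ⟨t, c, h, hc⟩
  | false =>
    simp only [Bool.false_eq_true, iff_false]
    rintro ⟨w', r', t', c', rfl, h', hc', ha, hr⟩
    exact hM.not_atGuess h' hc' h hc

end Machine

/-- Simulate the machine until it halts or runs out of choices on the stack `R`. -/
def Prog.simulate : Prog M := .loop (fun v => v.1.isSome && !v.2.2.ov) .mstep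

theorem State.withMc_mc (s : State M) (c : M.Cfg) : (s.withMc c).mc = c := by
  obtain ⟨l, v, S⟩ := c
  simp only [State.withMc, State.mc, TM2.Cfg.mk.injEq, true_and]
  funext i
  rcases i with p | k <;> rfl

/-- Induction on the bound `T` of path lengths: a path after the next step extends to one that is
longer by one, so `T` drops with each simulated step. The two exits are a halt with the unused
choices left on `R`, and an exhausted `R` in front of a further guess. -/
theorem Tri.simulate (hM : M.OracleFree) {T : ℕ} {s : State M} (hov : s.reg.ov = false)
    (hT : ∀ w t c, M.FreePath s.mc w t c → t ≤ T) :
    Tri O H .simulate s [] (2 * T + 3) (fun s' => ∃ w t,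
      s.st (.ex .R) = w ++ s'.st (.ex .R) ∧ M.FreePath s.mc w t s'.mc ∧
      (s'.mc.l = none ∧ s'.reg.ov = false ∨
        s'.st (.ex .R) = [] ∧ s'.reg.ov = true ∧ Machine.AtGuess s'.mc) ∧
      s'.reg.m₁ = s.reg.m₁ ∧ s'.reg.m₂ = s.reg.m₂ ∧ s'.reg.m₃ = s.reg.m₃ ∧
      s'.reg.b = s.reg.b) := by
  induction T using Nat.strong_induction_on generalizing s with
  | _ T ih =>
  rcases hl : s.ctl.1 with _ | q
  · refine (Tri.whileFalse (by simp [hl])).mono (by omega) ?_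
    rintro _ rfl
    exact ⟨[], 0, rfl, .refl _, .inl ⟨hl, hov⟩, rfl, rfl, rfl, rfl⟩
  · have hc : (fun v : Ctl M => v.1.isSome && !v.2.2.ov) s.ctl = true := by
      have : s.ctl.2.2.ov = false := hov
      simp [hl, this]
    refine (Tri.whileTrue hc Tri.mstep (T' := 2 * T + 1) ?_).time (by omega)
    rintro _ rfl
    rcases hi : M.instr q with p | ⟨p₀, p₁⟩ | q'
    · have hT1 := hT _ _ _ (.det hl hi (.refl _))
      have e : s.mstep = s.withMc (TM2.stepAux p s.mc.var s.mc.stk) := by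
        simp [State.mstep, hl, hi]
      have e' : s.mstep.mc = TM2.stepAux p s.mc.var s.mc.stk := by rw [e, State.withMc_mc]
      refine (ih (T - 1) (by omega) (s := s.mstep) (by rw [e]; exact hov) ?_).mono (by omega) ?_
      · intro w t c h
        have := hT _ _ _ (.det hl hi (e' ▸ h))
        omega
      · rintro s' ⟨w, t, h1, h2, h3, h4, h5, h6, h7⟩
        rw [e] at h1 h4 h5 h6 h7
        exact ⟨w, t + 1, h1, .det hl hi (e' ▸ h2), h3, h4, h5, h6, h7⟩
    · have hT1 := hT _ _ _ (.guess false hl hi (.refl _))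
      rcases hR : s.st (.ex .R) with _ | ⟨b, l⟩
      · have e : s.mstep = s.setReg { s.reg with r := none, ov := true } := by
          simp [State.mstep, hl, hi, hR]
        rw [e]
        refine (Tri.whileFalse (by simp [State.setReg])).mono (by omega) ?_
        rintro _ rfl
        exact ⟨[], 0, hR.symm, .refl _, .inr ⟨hR, rfl, q, p₀, p₁, hl, hi⟩, rfl, rfl, rfl, rfl⟩
      · have e : s.mstep = ((s.setR (some b)).set (.ex .R) l).withMc
            (TM2.stepAux (cond b p₁ p₀) s.mc.var s.mc.stk) := by
          simp [State.mstep, hl, hi, hR]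
        have e' : s.mstep.mc = TM2.stepAux (cond b p₁ p₀) s.mc.var s.mc.stk := by
          rw [e, State.withMc_mc]
        have e'' : s.mstep.st (.ex .R) = l := by
          rw [e]; simp [State.withMc]
        refine (ih (T - 1) (by omega) (s := s.mstep) (by rw [e]; exact hov) ?_).mono (by omega) ?_
        · intro w t c h
          have := hT _ _ _ (.guess b hl hi (e' ▸ h))
          omega
        · rintro s' ⟨w, t, h1, h2, h3, h4, h5, h6, h7⟩
          rw [e''] at h1
          rw [e] at h4 h5 h6 h7
          exact ⟨b :: w, t + 1, by simp [h1], .guess b hl hi (e' ▸ h2), h3, h4, h5, h6, h7⟩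
    · exact absurd hi (hM _ _)

/-! ### Counting words -/

theorem ncard_words (j : ℕ) : {u : List Bool | u.length = j}.ncard = 2 ^ j := by
  rw [← Nat.card_coe_set_eq]
  have : Nat.card (List.Vector Bool j) = 2 ^ j := by simp
  exact this

theorem val_lt (u : List Bool) : val u < 2 ^ u.length := by
  induction u with
  | nil => simp [val]
  | cons b u ih => cases b <;> simp [val, pow_succ] <;> omega

theorem val_inj {u v : List Bool} (hl : u.length = v.length) (h : val u = val v) : u = v := by
  induction u generalizing v with
  | nil => simpa using hl.symm
  | cons b u ih =>
    rcases v with _ | ⟨c, v⟩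
    · simp at hl
    · have := @ih v (by simpa using hl)
      cases b <;> cases c <;> simp_all [val] <;> omega

theorem exists_val_eq {j n : ℕ} (h : n < 2 ^ j) : ∃ u : List Bool, u.length = j ∧ val u = n := by
  induction j generalizing n with
  | zero => exact ⟨[], rfl, by simp at h; simp [val, h]⟩
  | succ j ih =>
    obtain ⟨u, hu, hv⟩ := ih (n := n / 2) (by rw [pow_succ] at h; omega)
    refine ⟨decide (n % 2 = 1) :: u, by simp [hu], ?_⟩
    rcases Nat.mod_two_eq_zero_or_one n with h | h <;> simp [val, h, hv] <;> omega

/-- `val` maps the words of length `j` bijectively onto the numbers below `2 ^ j`. For `z ≥ 2 ^ j`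
the truncated subtraction gives the right value 0. -/
theorem ncard_val_ge (j z : ℕ) :
    {u : List Bool | u.length = j ∧ z ≤ val u}.ncard = 2 ^ j - z := by
  have h1 : val '' {u : List Bool | u.length = j ∧ z ≤ val u} = Set.Ico z (2 ^ j) := by
    ext n
    constructor
    · rintro ⟨u, ⟨rfl, hu⟩, rfl⟩
      exact ⟨hu, val_lt u⟩
    · rintro ⟨h1, h2⟩
      obtain ⟨u, hu, rfl⟩ := exists_val_eq h2
      exact ⟨u, ⟨hu, h1⟩, rfl⟩
  have h2 : Set.InjOn val {u : List Bool | u.length = j ∧ z ≤ val u} :=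
    fun u hu v hv h => val_inj (hu.1.trans hv.1.symm) h
  rw [← h2.ncard_image, h1, Set.ncard_eq_toFinset_card']
  simp

/-- Words of length `j + 1` are counted by their first letter and the reverse of the rest. -/
theorem ncard_cons_reverse (j : ℕ) (P : Bool → List Bool → Prop) :
    {w : List Bool | ∃ b u, w = b :: u.reverse ∧ u.length = j ∧ P b u}.ncard =
      {u : List Bool | u.length = j ∧ P false u}.ncard +
        {u : List Bool | u.length = j ∧ P true u}.ncard := by
  have hfin (b : Bool) : {u : List Bool | u.length = j ∧ P b u}.Finite :=
    (List.finite_length_eq Bool j).subset fun u hu => hu.1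
  have hinj (b : Bool) : Function.Injective fun u : List Bool => b :: u.reverse := by
    intro u v h; simpa using h
  rw [← Set.ncard_image_of_injective {u | u.length = j ∧ P false u} (hinj false),
    ← Set.ncard_image_of_injective {u | u.length = j ∧ P true u} (hinj true),
    ← Set.ncard_union_eq ?_ ((hfin _).image _) ((hfin _).image _)]
  · congr 1
    ext w
    constructor
    · rintro ⟨b | b, u, rfl, h⟩
      · exact .inl ⟨u, h, rfl⟩
      · exact .inr ⟨u, h, rfl⟩
    · rintro (⟨u, h, rfl⟩ | ⟨u, h, rfl⟩)
      · exact ⟨_, u, rfl, h⟩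
      · exact ⟨_, u, rfl, h⟩
  · rw [Set.disjoint_left]
    rintro _ ⟨u, -, rfl⟩ ⟨v, -, h⟩
    simp at h

/-! ### Accepted words of fixed length, accepting paths and acceptance probability -/

namespace Machine

variable {x : List Bool} {k j : ℕ}

/-- The number of words of length `j` that are accepted in the sense of `Machine.Accepts`. -/
noncomputable def count (M : Machine) (x : List Bool) (k : ℕ) (m₂ m₃ : Bool) (j : ℕ) : ℕ :=
  {u : List Bool | u.length = j ∧ M.Accepts x k m₂ m₃ u}.ncard

theorem finite_words (j : ℕ) (P : List Bool → Prop) :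
    {u : List Bool | u.length = j ∧ P u}.Finite :=
  (List.finite_length_eq Bool j).subset fun _ hu => hu.1

theorem count_le (m₂ m₃ : Bool) : M.count x k m₂ m₃ j ≤ 2 ^ j := by
  rw [← ncard_words]
  exact Set.ncard_le_ncard (fun u hu => hu.1) (List.finite_length_eq Bool j)

theorem exists_path_of_count_ne_zero {m₃ : Bool} (h : M.count x k true m₃ j ≠ 0) :
    ∃ w t c, M.FreePath (M.init x k) w t c ∧ w.length = j + 1 := by
  obtain ⟨u, hu, t, c, h, hg⟩ := Set.nonempty_of_ncard_ne_zero h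
  obtain ⟨c', h'⟩ := hg.path h true
  exact ⟨_, _, _, h', by simp [hu]⟩

theorem Path.exists_atGuess {O : ParamFun} {c c' : M.Cfg} {w t} (h : M.Path O c w t c') {n : ℕ}
    (hn : n < w.length) : ∃ t₁ c₁, M.Path O c (w.take n) t₁ c₁ ∧ AtGuess c₁ := by
  induction h generalizing n with
  | refl c => simp at hn
  | det hq hi _ ih =>
    obtain ⟨t₁, c₁, h₁, h₂⟩ := ih hn
    exact ⟨_, c₁, .det hq hi h₁, h₂⟩
  | guess b hq hi _ ih =>
    rcases n with _ | n
    · exact ⟨0, _, .refl _, _, _, _, hq, hi⟩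
    · obtain ⟨t₁, c₁, h₁, h₂⟩ := ih (n := n) (by simpa using hn)
      exact ⟨_, c₁, .guess b hq hi h₁, h₂⟩
  | query hq hi _ ih =>
    obtain ⟨t₁, c₁, h₁, h₂⟩ := ih hn
    exact ⟨_, c₁, .query hq hi h₁, h₂⟩

/-- A path with more than `j` choices stands in front of a guess after its first `j` choices, and
these would be counted. So a zero count certifies that `j` choices are enough. -/
theorem length_le_of_count_eq_zero {m₃ : Bool} (h : M.count x k true m₃ j = 0) {w t c}
    (hp : M.FreePath (M.init x k) w t c) : w.length ≤ j := by
  by_contra! hj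
  obtain ⟨t₁, c₁, h₁, h₂⟩ := hp.exists_atGuess hj
  have := (Set.ncard_eq_zero (finite_words _ _)).1 h
  exact Set.notMem_empty (w.take j) (this ▸ ⟨by simp; omega, t₁, c₁, h₁, h₂⟩)

/-- Padding with zeros to length `j` is a bijection from accepting paths to counted words; it is
injective since paths are prefix-free. -/
theorem count_numAcc (hM : M.OracleFree)
    (h : ∀ w t c, M.FreePath (M.init x k) w t c → w.length ≤ j) :
    M.count x k false true j = M.numAcc x k := by
  have hinj : Set.InjOn (fun w : List Bool => w ++ List.replicate (j - w.length) false)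
      (M.accPaths x k) := by
    rintro w ⟨t, c, hw, hc, -⟩ w' ⟨t', c', hw', hc', -⟩ he
    exact (hM.halt_unique hw hc hw' hc' he).1
  rw [numAcc, ← hinj.ncard_image, count]
  congr 1
  ext u
  constructor
  · rintro ⟨rfl, w, r, t, c, rfl, hw, hc, ha, hr⟩
    refine ⟨w, ⟨t, c, hw, hc, ha⟩, ?_⟩
    simp only [List.append_cancel_left_eq]
    exact (List.eq_replicate_iff.2 ⟨by simp, hr rfl⟩).symm
  · rintro ⟨w, ⟨t, c, hw, hc, ha⟩, rfl⟩
    have := h _ _ _ hw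
    exact ⟨by simp; omega, w, _, t, c, rfl, hw, hc, ha, fun _ b hb => List.eq_of_mem_replicate hb⟩

theorem finite_accPaths (h : ∀ w t c, M.FreePath (M.init x k) w t c → w.length ≤ j) :
    (M.accPaths x k).Finite :=
  (List.finite_length_le Bool j).subset fun w ⟨t, c, hw, _⟩ => h w t c hw

/-- The counted words are partitioned by the accepting path `w` that they extend. Each class has `2
^ (j - |w|)` elements, which is `2 ^ j` times the probability of `w`. -/
theorem count_acceptProb (hM : M.OracleFree)
    (h : ∀ w t c, M.FreePath (M.init x k) w t c → w.length ≤ j) :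
    (M.count x k false false j : ℝ) = 2 ^ j * M.acceptProb x k := by
  classical
  have hfin := finite_accPaths h
  have h1 : M.acceptProb x k = ∑ w ∈ hfin.toFinset, (1 / 2 : ℝ) ^ w.length := by
    rw [acceptProb, ← Finset.tsum_subtype hfin.toFinset (fun w => (1 / 2 : ℝ) ^ w.length)]
    have : (hfin.toFinset : Set (List Bool)) = M.accPaths x k := by simp
    exact (congrArg (fun s : Set (List Bool) => ∑' w : s, (1 / 2 : ℝ) ^ w.1.length) this).symm
  have h2 : {u : List Bool | u.length = j ∧ M.Accepts x k false false u} =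
      ↑(hfin.toFinset.biUnion fun w =>
        (List.finite_length_eq Bool (j - w.length)).toFinset.image fun r => w ++ r) := by
    ext u
    simp only [Set.mem_ofPred_eq, Finset.coe_biUnion, Finset.mem_coe, Set.Finite.mem_toFinset,
      Finset.coe_image, Set.mem_iUnion, Set.mem_image, exists_prop]
    constructor
    · rintro ⟨rfl, w, r, t, c, rfl, hw, hc, ha, -⟩
      exact ⟨w, ⟨t, c, hw, hc, ha⟩, r, by simp, rfl⟩
    · rintro ⟨w, ⟨t, c, hw, hc, ha⟩, r, hr, rfl⟩
      have := h _ _ _ hw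
      exact ⟨by simp [hr]; omega, w, r, t, c, rfl, hw, hc, ha, by simp⟩
  rw [count, h2, Set.ncard_coe_finset, Finset.card_biUnion, h1, Finset.mul_sum, Nat.cast_sum]
  · refine Finset.sum_congr rfl fun w hw => ?_
    obtain ⟨t, c, hw, -⟩ := hfin.mem_toFinset.1 hw
    have hj := h _ _ _ hw
    rw [Finset.card_image_of_injective _ (List.append_right_injective w),
      ← Set.ncard_eq_toFinset_card _ (List.finite_length_eq Bool (j - w.length)), ncard_words]
    obtain ⟨d, rfl⟩ := Nat.exists_eq_add_of_le hj
    simp only [Nat.add_sub_cancel_left, pow_add]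
    push_cast
    rw [one_div, inv_pow]
    field_simp
  · intro w hw w' hw' hne
    obtain ⟨t, c, hw, hc, -⟩ := hfin.mem_toFinset.1 hw
    obtain ⟨t', c', hw', hc', -⟩ := hfin.mem_toFinset.1 hw'
    rw [Function.onFun, Finset.disjoint_left]
    rintro u hu hu'
    obtain ⟨r, -, rfl⟩ := Finset.mem_image.1 hu
    obtain ⟨r', -, he⟩ := Finset.mem_image.1 hu'
    exact hne (hM.halt_unique hw hc hw' hc' he.symm).1

theorem acceptProb_of_length (h : ∀ w ∈ M.accPaths x k, w.length = j) :
    M.acceptProb x k = M.numAcc x k / 2 ^ j := by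
  rw [acceptProb, tsum_congr (g := fun _ => (1 / 2 : ℝ) ^ j) fun w => by rw [h w.1 w.2],
    tsum_const, numAcc, ← Nat.card_coe_set_eq, nsmul_eq_mul, one_div, inv_pow]
  rfl

/-- The accepting paths of a machine that halts on all choices of a certain length. -/
theorem OracleFree.accPaths_eq (hM : M.OracleFree) {P : List Bool → Prop}
    (h : ∀ w : List Bool, w.length = j →
      ∃ t c, M.FreePath (M.init x k) w t c ∧ c.l = none ∧ (M.accept c.var = true ↔ P w)) :
    M.accPaths x k = {w | w.length = j ∧ P w} := by
  ext w
  constructor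
  · rintro ⟨t, c, hw, hc, ha⟩
    -- This word has length `j` and is comparable with `w`, whether `w` is shorter or longer; as
    -- both paths halt, they coincide.
    obtain ⟨t', c', hw', hc', hP⟩ := h ((w ++ List.replicate j false).take j) (by simp)
    obtain ⟨e, rfl⟩ := ((hM.bPath (H := 0) hw).compat hc hw'
      (List.prefix_or_prefix_of_prefix (List.take_prefix _ _) (List.prefix_append _ _))).2.2.1 hc'
    rw [e] at hP
    refine ⟨by rw [← e]; simp, hP.1 ha⟩
  · rintro ⟨hw, hP⟩
    obtain ⟨t, c, hp, hc, ha⟩ := h w hw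
    exact ⟨t, c, hp, hc, ha.2 hP⟩

/-- It is enough to run the machine on words of length exactly `j`: every path, also an incomplete
one, is an initial segment of such a run. -/
theorem OracleFree.path_bound (hM : M.OracleFree) {T : ℕ}
    (h : ∀ w : List Bool, w.length = j →
      ∃ t c, M.FreePath (M.init x k) w t c ∧ c.l = none ∧ t ≤ T) {w t c}
    (hp : M.FreePath (M.init x k) w t c) : t ≤ T ∧ w.length ≤ j := by
  obtain ⟨t', c', hw', hc', hT⟩ := h ((w ++ List.replicate j false).take j) (by simp)
  obtain ⟨h1, h2, -⟩ := (hM.bPath (H := 0) hw').compat hc' hp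
    (List.prefix_or_prefix_of_prefix (List.prefix_append _ _) (List.take_prefix _ _))
  exact ⟨h1.trans hT, by simpa using h2.length_le⟩

end Machine

/-- The stack contents given by a list; all stacks which do not occur in it are empty. -/
def stOf (L : List (Stk × List Bool)) (m : Stk) : List Bool :=
  match L with
  | [] => []
  | (n, l) :: L => if m = n then l else stOf L m

theorem Tri.of_eq {p : Prog M} {s s' : State M} {w T Q} (h : s = s')
    (h' : Tri O H p s' w T Q) : Tri O H p s w T Q := h ▸ h'

theorem flatMap_const {α β : Type*} (l : List α) (b : β) :
    l.flatMap (fun _ => [b]) = List.replicate l.length b := by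
  induction l with
  | nil => rfl
  | cons a l ih => simp [ih, List.replicate_succ]

theorem flatMap_nil {α β : Type*} (l : List α) : l.flatMap (fun _ => ([] : List β)) = [] := by
  simp

/-! ### The counting machine -/

namespace Prog

/-- Read three bits from the input to the registers `m₁`, `m₂`, `m₃`. -/
def readModes : Prog M :=
  .seq (.pop (.io .input)) <| .seq (.loadR fun ρ => { ρ with m₁ := ρ.r.getD false }) <|
  .seq (.pop (.io .input)) <| .seq (.loadR fun ρ => { ρ with m₂ := ρ.r.getD false }) <|
  .seq (.pop (.io .input)) <| .loadR fun ρ => { ρ with m₃ := ρ.r.getD false }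

/-- Read a number in unary from the input, and move as many symbols from the parameter to the
stack `A`. -/
def readUnary : Prog M :=
  .seq (.pop (.io .input)) <| .loop (fun v => v.2.2.r == some true) <|
    .seq (.pop (.io .param)) <|
    .seq (.ite (fun v => v.2.2.r.isSome) (.push (.ex .A) fun _ => true) (.load id)) <|
    .pop (.io .input)

/-- Read a string, each letter preceded by a bit `1`, from the input to the stack `Z`. -/
def readString : Prog M :=
  .seq (.pop (.io .input)) <| .loop (fun v => v.2.2.r == some true) <|
    .seq (.pop (.io .input)) <|
    .seq (.push (.ex .Z) fun ρ => ρ.r.getD false) <|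
    .pop (.io .input)

/-- Move the input and the parameter to the simulated machine, and store the length of the input
plus two on the stack `U`. -/
def loadInstance : Prog M :=
  .seq (.each (.io .input) (.pushes [(.ex .V, id), (.ex .U, fun _ => true)])) <|
  .seq (.each (.ex .V) (.pushes [(.sim .input, id)])) <|
  .seq (.each (.io .param) (.pushes [(.sim .param, fun _ => true)])) <|
  .pushes [(.ex .U, fun _ => true), (.ex .U, fun _ => true)]

/-- Halve the number on the stack `U` and store the result on the stack `V`. -/
def halve : Prog M :=
  .seq (.loadR fun ρ => { ρ with g := false }) <|
  .each (.ex .U) <|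
    .seq (.ite (fun v => v.2.2.g) (.push (.ex .V) fun _ => true) (.load id)) <|
    .loadR fun ρ => { ρ with g := !ρ.g }

/-- Compute the binary logarithm of the number on the stack `U` on the stack `L`. -/
def logarithm : Prog M :=
  .seq (.loadR fun ρ => { ρ with fl := true }) <| .loop (fun v => v.2.2.fl) <|
    .seq halve <| .seq (.pop (.ex .V)) <|
    .ite (fun v => v.2.2.r.isSome)
      (.seq (.pushes [(.ex .V, fun _ => true), (.ex .L, fun _ => true)]) <|
        .each (.ex .V) (.pushes [(.ex .U, fun _ => true)]))
      (.loadR fun ρ => { ρ with fl := false })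

/-- Multiply the numbers on the stacks `A` and `L`. -/
def multiply : Prog M := .each (.ex .A) (.scan (.ex .L) [(.ex .J, fun _ => true)])

end Prog

/-- The leading ones of a string, and the rest of the string after the next letter. -/
def splitOnes : List Bool → ℕ × List Bool
  | [] => (0, [])
  | false :: l => (0, l)
  | true :: l => ((splitOnes l).1 + 1, (splitOnes l).2)

theorem splitOnes_length (l : List Bool) : (splitOnes l).2.length ≤ l.length := by
  induction l with
  | nil => simp [splitOnes]
  | cons b l ih => cases b <;> grind [splitOnes]

/-- A string whose letters are preceded by ones, in reverse, and the rest of the string. -/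
def splitString (z : List Bool) : List Bool → List Bool × List Bool
  | [] => (z, [])
  | false :: l => (z, l)
  | [true] => (false :: z, [])
  | true :: b :: l => splitString (b :: z) l

theorem splitString_length (z l : List Bool) :
    (splitString z l).2.length ≤ l.length ∧
      (splitString z l).1.length ≤ z.length + l.length := by
  fun_induction splitString z l <;> grind

/-! ### Correctness and running time of the reading and arithmetic routines -/

section

variable {c₁ : Option M.Λ} {c₂ : M.σ} {ρ : Reg} {wk : ∀ k, List (M.Γ k)}

theorem Tri.readModes (x p : List Bool) :
    Tri O H (.readModes (M := M)) ⟨(c₁, c₂, ρ), stOf [(.io .input, x), (.io .param, p)], wk⟩ [] 6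
      (fun s' => ∃ r, s' = ⟨(c₁, c₂, { ρ with
          r := r
          m₁ := x.head?.getD false
          m₂ := x.tail.head?.getD false
          m₃ := x.tail.tail.head?.getD false }),
        stOf [(.io .input, x.tail.tail.tail), (.io .param, p)], wk⟩) := by
  refine ((Tri.pop _).seq_eq ((Tri.loadR _).seq_eq ((Tri.pop _).seq_eq ((Tri.loadR _).seq_eq
    ((Tri.pop _).seq_eq (Tri.loadR _)))))).mono le_rfl ?_
  rintro _ rfl
  refine ⟨x.tail.tail.head?, ?_⟩
  simp [State.setR, State.setReg, State.reg, State.set, stOf]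
  funext m
  simp only [Function.update_apply]
  split_ifs <;> rfl

/-- The minimum and the `drop` cover malformed inputs, whose unary number exceeds the parameter; the
restriction on nondeterminism must hold for these as well. -/
theorem Tri.readUnary (l p : List Bool) :
    Tri O H (.readUnary (M := M)) ⟨(c₁, c₂, ρ), stOf [(.io .input, l), (.io .param, p)], wk⟩ []
      (6 * l.length + 2)
      (fun s' => ∃ r, s' = ⟨(c₁, c₂, { ρ with r := r }),
        stOf [(.io .input, (splitOnes l).2), (.io .param, p.drop (splitOnes l).1),
          (.ex .A, List.replicate (min (splitOnes l).1 p.length) true)], wk⟩) := by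
  suffices h : ∀ l p a, Tri O H (.loop (fun v => v.2.2.r == some true) <|
      .seq (.pop (.io .param)) <|
      .seq (.ite (fun v => v.2.2.r.isSome) (.push (.ex .A) fun _ => true) (.load id)) <|
      .pop (.io .input)) ⟨(c₁, c₂, { ρ with r := l.head? }),
        stOf [(.io .input, l.tail), (.io .param, p), (.ex .A, List.replicate a true)], wk⟩ []
      (6 * l.length + 1)
      (fun s' => ∃ r, s' = ⟨(c₁, c₂, { ρ with r := r }),
        stOf [(.io .input, (splitOnes l).2), (.io .param, p.drop (splitOnes l).1),
          (.ex .A, List.replicate (a + min (splitOnes l).1 p.length) true)], wk⟩) by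
    refine (Tri.seq_eq ((Tri.pop _).mono le_rfl ?_) ((h l p 0).mono le_rfl ?_)).time (by omega)
    · rintro _ rfl
      refine State.ext (by simp [State.setR, State.setReg, State.reg, State.set, stOf])
        (funext fun m => ?_) rfl
      simp only [State.setR, State.setReg, State.set, stOf, Function.update_apply]
      split_ifs <;> rfl
    · rintro _ ⟨r, rfl⟩
      exact ⟨r, by simp⟩
  intro l
  induction l with
  | nil =>
    intro p a
    refine (Tri.whileFalse rfl).mono (by simp) ?_
    rintro _ rfl
    exact ⟨none, by simp [splitOnes]⟩
  | cons b l ih =>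
    intro p a
    rcases b with _ | _
    · refine (Tri.whileFalse rfl).mono (by simp) ?_
      rintro _ rfl
      exact ⟨some false, by simp [splitOnes]⟩
    · rcases p with _ | ⟨b', p⟩
      · refine (Tri.whileTrue rfl ((Tri.pop _).seq_eq ((Tri.iteFalse ?_ (Tri.load id)).seq_eq
          (Tri.pop _))) ?_).time (T := 4 + (6 * l.length + 1) + 1) (by simp; omega)
        · simp [State.setR, State.setReg, State.reg, State.set, stOf]
        rintro _ rfl
        refine .of_eq ?_ ((ih [] a).mono le_rfl ?_)
        rotate_left
        · rintro _ ⟨r, rfl⟩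
          refine ⟨r, ?_⟩
          simp [splitOnes]
        · simp [State.setR, State.setReg, State.reg, State.set, State.setCtl, stOf]
          funext m
          simp only [Function.update_apply]
          split_ifs <;> simp_all
      · refine (Tri.whileTrue rfl ((Tri.pop _).seq_eq ((Tri.iteTrue ?_ (Tri.push _ _)).seq_eq
          (Tri.pop _))) ?_).time (T := 4 + (6 * l.length + 1) + 1) (by simp; omega)
        · simp [State.setR, State.setReg, State.reg, State.set, stOf]
        rintro _ rfl
        refine .of_eq ?_ ((ih p (a + 1)).mono le_rfl ?_)
        rotate_left
        · rintro _ ⟨r, rfl⟩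
          refine ⟨r, ?_⟩
          simp [splitOnes]
          rw [show a + (min (splitOnes l).1 p.length + 1) =
            a + 1 + min (splitOnes l).1 p.length by omega]
        · simp [State.setR, State.setReg, State.reg, State.set, stOf]
          funext m
          simp only [Function.update_apply]
          split_ifs <;> simp_all [List.replicate_succ]

theorem Tri.readString (l p a : List Bool) :
    Tri O H (.readString (M := M))
      ⟨(c₁, c₂, ρ), stOf [(.io .input, l), (.io .param, p), (.ex .A, a)], wk⟩ []
      (4 * l.length + 2)
      (fun s' => ∃ r, s' = ⟨(c₁, c₂, { ρ with r := r }),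
        stOf [(.io .input, (splitString [] l).2), (.io .param, p), (.ex .A, a),
          (.ex .Z, (splitString [] l).1)], wk⟩) := by
  suffices h : ∀ z l, Tri O H (.loop (fun v => v.2.2.r == some true) <|
      .seq (.pop (.io .input)) <|
      .seq (.push (.ex .Z) fun ρ => ρ.r.getD false) <|
      .pop (.io .input)) ⟨(c₁, c₂, { ρ with r := l.head? }),
        stOf [(.io .input, l.tail), (.io .param, p), (.ex .A, a), (.ex .Z, z)], wk⟩ []
      (4 * l.length + 1)
      (fun s' => ∃ r, s' = ⟨(c₁, c₂, { ρ with r := r }),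
        stOf [(.io .input, (splitString z l).2), (.io .param, p), (.ex .A, a),
          (.ex .Z, (splitString z l).1)], wk⟩) by
    refine (Tri.seq_eq ((Tri.pop _).mono le_rfl ?_) (h [] l)).time (by omega)
    rintro _ rfl
    refine State.ext (by simp [State.setR, State.setReg, State.reg, State.set, stOf])
      (funext fun m => ?_) rfl
    simp only [State.setR, State.setReg, State.set, stOf, Function.update_apply]
    split_ifs <;> rfl
  intro z l
  fun_induction splitString z l with
  | case1 z =>
    refine (Tri.whileFalse rfl).mono (by simp) ?_
    rintro _ rfl
    exact ⟨none, by simp⟩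
  | case2 z l =>
    refine (Tri.whileFalse rfl).mono (by simp) ?_
    rintro _ rfl
    exact ⟨some false, by simp⟩
  | case3 z =>
    refine (Tri.whileTrue rfl ((Tri.pop _).seq_eq ((Tri.push _ _).seq_eq
          (Tri.pop _))) ?_).time (T := 3 + 1 + 1) (by simp)
    rintro _ rfl
    refine (Tri.whileFalse ?_).mono (by simp) ?_
    · simp [State.setR, State.setReg, State.reg, State.set, stOf]
    rintro _ rfl
    refine ⟨none, State.ext (by simp [State.setR, State.setReg, State.reg, State.set, stOf])
      (funext fun m => ?_) rfl⟩
    simp [State.setR, State.setReg, State.reg, State.set, stOf, Function.update_apply]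
    split_ifs <;> simp_all
  | case4 z b l ih =>
    refine (Tri.whileTrue rfl ((Tri.pop _).seq_eq ((Tri.push _ _).seq_eq
          (Tri.pop _))) ?_).time (T := 3 + (4 * l.length + 1) + 1) (by simp; omega)
    rintro _ rfl
    refine .of_eq ?_ ih
    refine State.ext (by simp [State.setR, State.setReg, State.reg, State.set, stOf])
      (funext fun m => ?_) rfl
    simp [State.setR, State.setReg, State.reg, State.set, stOf, Function.update_apply]
    split_ifs <;> simp_all

theorem Tri.loadInstance (x p a z : List Bool) :
    Tri O H (.loadInstance (M := M)) ⟨(c₁, c₂, ρ),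
        stOf [(.io .input, x), (.io .param, p), (.ex .A, a), (.ex .Z, z)], wk⟩ []
      (9 * x.length + 4 * p.length + 9)
      (fun s' => ∃ r, s' = ⟨(c₁, c₂, { ρ with r := r }),
        stOf [(.ex .U, List.replicate (x.length + 2) true), (.sim .input, x),
          (.sim .param, List.replicate p.length true), (.ex .A, a), (.ex .Z, z)], wk⟩) := by
  refine (Tri.seq_eq (Tri.each_pushes (by simp) _) <| Tri.seq_eq (Tri.each_pushes (by simp) _) <|
    Tri.seq_eq (Tri.each_pushes (by simp) _) <| Tri.pushes _ _).mono ?_ ?_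
  · simp [State.setR, State.setReg, State.set, State.spill, contrib, stOf]
    omega
  · rintro _ rfl
    refine ⟨none, State.ext rfl (funext fun m => ?_) rfl⟩
    rcases m with p | p | p <;> cases p <;>
      simp [State.setR, State.setReg, State.set, State.spill, contrib, stOf, flatMap_const,
        flatMap_nil, List.replicate_succ, Function.update_apply]

theorem Tri.halve (n : ℕ) (X : List (Stk × List Bool)) :
    Tri O H (.halve (M := M)) ⟨(c₁, c₂, ρ),
        stOf ((.ex .U, List.replicate n true) :: (.ex .V, []) :: X), wk⟩ [] (5 * n + 3)
      (fun s' => ∃ g, s' = ⟨(c₁, c₂, { ρ with r := none, g := g }),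
        stOf ((.ex .U, []) :: (.ex .V, List.replicate (n / 2) true) :: X), wk⟩) := by
  refine (Tri.seq_eq (Tri.loadR _) (Tri.each (T := 3) (l := List.replicate n true)
    -- The register `g` is the parity of the number of symbols already removed; every second one is
    -- copied to `V`.
    (P := fun l s' => l.length ≤ n ∧ ∃ r, s' = ⟨(c₁, c₂, { ρ with
        r := r, g := decide ((n - l.length) % 2 = 1) }),
      stOf ((.ex .U, l) :: (.ex .V, List.replicate ((n - l.length) / 2) true) :: X), wk⟩)
    ?_ ?_ ?_)).mono (by simp; omega) ?_
  · rintro l _ ⟨-, r, rfl⟩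
    simp [stOf]
  · rintro b l _ ⟨hl, r, rfl⟩
    simp only [List.length_cons] at hl
    by_cases hg : (n - (l.length + 1)) % 2 = 1
    · refine (Tri.seq_eq (Tri.iteTrue ?_ (Tri.push _ _)) (Tri.loadR _)).mono le_rfl ?_
      · simp [State.setR, State.setReg, State.set, State.reg, hg]
      rintro _ rfl
      refine ⟨by omega, some b, State.ext ?_ (funext fun m => ?_) rfl⟩
      · have : ((n - l.length) % 2 = 1) ↔ ¬ ((n - (l.length + 1)) % 2 = 1) := by omega
        simp [State.setR, State.setReg, State.set, State.reg, this, hg]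
      · have : (n - l.length) / 2 = (n - (l.length + 1)) / 2 + 1 := by omega
        simp [State.setR, State.setReg, State.set, State.reg, stOf, Function.update_apply, this]
        split_ifs <;> simp_all [List.replicate_succ]
    · refine (Tri.seq_eq (Tri.iteFalse ?_ (Tri.load id)) (Tri.loadR _)).mono le_rfl ?_
      · simp [State.setR, State.setReg, State.set, State.reg] at hg ⊢
        omega
      rintro _ rfl
      refine ⟨by omega, some b, State.ext ?_ (funext fun m => ?_) rfl⟩
      · have : ((n - l.length) % 2 = 1) ↔ ¬ ((n - (l.length + 1)) % 2 = 1) := by omega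
        simp [State.setR, State.setReg, State.set, State.reg, State.setCtl, this,
          Nat.mod_two_ne_one.1 hg]
      · have : (n - l.length) / 2 = (n - (l.length + 1)) / 2 := by omega
        simp [State.setR, State.setReg, State.set, State.reg, State.setCtl, stOf,
          Function.update_apply, this]
        split_ifs <;> simp_all
  · refine ⟨by simp, ρ.r, ?_⟩
    simp [State.setReg, State.reg]
  · rintro _ ⟨_, ⟨-, r, rfl⟩, rfl⟩
    exact ⟨_, rfl⟩

/-- The logarithm is the number of halvings with nonzero result. The costs of the rounds form a
geometric series, so the total time is linear. -/
theorem Tri.logarithm (n : ℕ) (hn : n ≠ 0) (X : List (Stk × List Bool)) :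
    Tri O H (.logarithm (M := M)) ⟨(c₁, c₂, ρ),
        stOf ((.ex .U, List.replicate n true) :: (.ex .V, []) :: (.ex .L, []) :: X), wk⟩ []
      (40 * n + 1)
      (fun s' => ∃ g, s' = ⟨(c₁, c₂, { ρ with r := none, g := g, fl := false }),
        stOf ((.ex .U, []) :: (.ex .V, []) :: (.ex .L, List.replicate (Nat.log 2 n) true) :: X),
        wk⟩) := by
  suffices h : ∀ n l r g, n ≠ 0 → Tri O H (.loop (fun v => v.2.2.fl) <|
    .seq .halve <| .seq (.pop (.ex .V)) <|
    .ite (fun v => v.2.2.r.isSome)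
      (.seq (.pushes [(.ex .V, fun _ => true), (.ex .L, fun _ => true)]) <|
        .each (.ex .V) (.pushes [(.ex .U, fun _ => true)]))
      (.loadR fun ρ => { ρ with fl := false })) ⟨(c₁, c₂, { ρ with r := r, g := g, fl := true }),
        stOf ((.ex .U, List.replicate n true) :: (.ex .V, []) ::
          (.ex .L, List.replicate l true) :: X), wk⟩ []
      (40 * n)
      (fun s' => ∃ g, s' = ⟨(c₁, c₂, { ρ with r := none, g := g, fl := false }),
        stOf ((.ex .U, []) :: (.ex .V, []) ::
          (.ex .L, List.replicate (l + Nat.log 2 n) true) :: X), wk⟩) by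
    refine (Tri.seq_eq (Tri.loadR _) ((h n 0 ρ.r ρ.g hn).mono le_rfl ?_)).time (by omega)
    rintro _ ⟨g, rfl⟩
    exact ⟨g, by simp⟩
  intro n
  induction n using Nat.strong_induction_on with
  | _ n ih =>
  intro l r g hn
  rcases Nat.lt_or_ge n 2 with h2 | h2
  · have e0 : n / 2 = 0 := by omega
    let Q : State M → Prop := fun s' => ∃ g, s' =
        ⟨(c₁, c₂, { ρ with r := none, g := g, fl := false }), stOf ((.ex .U, []) :: (.ex .V, []) ::
          (.ex .L, List.replicate (l + Nat.log 2 n) true) :: X), wk⟩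
    refine (Tri.whileTrue (P := Q) rfl ((Tri.halve n _).seq (T' := 3) ?_) (T' := 1) ?_).time
      (by omega)
    · rintro _ ⟨g, rfl⟩
      refine (Tri.seq_eq (Tri.pop _) (Tri.iteFalse ?_ (Tri.loadR _))).mono le_rfl ?_
      · simp [State.setR, State.setReg, State.set, State.reg, stOf, e0]
      rintro _ rfl
      refine ⟨g, State.ext ?_ (funext fun m => ?_) rfl⟩
      · simp [State.setR, State.setReg, State.set, State.reg, stOf, e0]
      · simp [State.setR, State.setReg, State.set, State.reg, stOf, Function.update_apply, e0,
          Nat.log_of_lt h2]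
        split_ifs <;> simp_all
    · rintro s' ⟨g, rfl⟩
      refine (Tri.whileFalse rfl).mono le_rfl ?_
      rintro _ rfl
      exact ⟨g, rfl⟩
  · let Q : State M → Prop := fun s' => ∃ g, s' =
        ⟨(c₁, c₂, { ρ with r := none, g := g, fl := true }),
          stOf ((.ex .U, List.replicate (n / 2) true) :: (.ex .V, []) ::
          (.ex .L, List.replicate (l + 1) true) :: X), wk⟩
    refine (Tri.whileTrue (P := Q) rfl ((Tri.halve n _).seq (T' := 4 * (n / 2) + 8) ?_) ?_).time
      (T := 5 * n + 3 + (4 * (n / 2) + 8) + 40 * (n / 2) + 1) (by omega)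
    · rintro _ ⟨g, rfl⟩
      obtain ⟨m, hm⟩ : ∃ m, n / 2 = m + 1 := ⟨n / 2 - 1, by omega⟩
      refine (Tri.seq_eq (Tri.pop _) (Tri.iteTrue ?_ (Tri.seq_eq (Tri.pushes _ _)
        (Tri.each_pushes (by simp) _)))).mono ?_ ?_
      · simp [State.setR, State.setReg, State.set, State.reg, stOf, hm, List.replicate_succ]
      · simp [State.setR, State.setReg, State.set, State.reg, State.spill, stOf, hm, contrib]
        omega
      rintro _ rfl
      refine ⟨g, State.ext ?_ (funext fun n => ?_) rfl⟩
      · simp [State.setR, State.setReg, State.set, State.reg, State.spill]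
      · rw [hm]
        by_cases h1 : n = .ex .U
        · subst h1
          simp [State.setR, State.setReg, State.set, State.spill, contrib, stOf, flatMap_const]
          exact List.replicate_succ'.symm
        by_cases h2 : n = .ex .V
        · subst h2
          simp [State.setR, State.setReg, State.set, State.spill, contrib, stOf, flatMap_nil]
        by_cases h3 : n = .ex .L
        · subst h3
          simp [State.setR, State.setReg, State.set, State.spill, contrib, stOf, flatMap_nil,
            List.replicate_succ]
        · simp [State.setR, State.setReg, State.set, State.spill, contrib, stOf, flatMap_nil, h1,
            h2, h3, Ne.symm h1, Ne.symm h2, Ne.symm h3]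
    · rintro _ ⟨g, rfl⟩
      refine (ih (n / 2) (by omega) (l + 1) none g (by omega)).mono le_rfl ?_
      rintro _ ⟨g, rfl⟩
      refine ⟨g, ?_⟩
      rw [Nat.log_of_one_lt_of_le (by norm_num) h2, add_assoc, add_comm 1]

theorem Tri.multiply (a m : ℕ) (X : List (Stk × List Bool)) :
    Tri O H (.multiply (M := M)) ⟨(c₁, c₂, ρ),
        stOf ((.ex .A, List.replicate a true) :: (.ex .L, List.replicate m true) ::
          (.ex .J, []) :: (.ex .T, []) :: X), wk⟩ []
      ((9 * m + 6) * a + 2)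
      (fun s' => s' = ⟨(c₁, c₂, { ρ with r := none }),
        stOf ((.ex .A, []) :: (.ex .L, List.replicate m true) ::
          (.ex .J, List.replicate (a * m) true) :: (.ex .T, []) :: X), wk⟩) := by
  refine (Tri.each (T := 9 * m + 4) (l := List.replicate a true)
    (P := fun l s' => l.length ≤ a ∧ ∃ r, s' = ⟨(c₁, c₂, { ρ with r := r }),
      stOf ((.ex .A, l) :: (.ex .L, List.replicate m true) ::
        (.ex .J, List.replicate ((a - l.length) * m) true) :: (.ex .T, []) :: X), wk⟩)
    ?_ ?_ ?_).mono (by simp) ?_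
  · rintro l _ ⟨-, r, rfl⟩
    simp [stOf]
  · rintro b l _ ⟨hl, r, rfl⟩
    simp only [List.length_cons] at hl
    refine (Tri.scan (by simp) (by simp) (by simp) _ ?_).mono ?_ ?_
    · simp [State.setR, State.setReg, State.set, stOf]
    · simp [State.setR, State.setReg, State.set, stOf]
    rintro _ rfl
    refine ⟨by omega, none, State.ext ?_ (funext fun n => ?_) rfl⟩
    · simp [State.setR, State.setReg, State.set, State.reg, State.spill]
    · have : a - l.length = (a - (l.length + 1)) + 1 := by omega
      rw [List.length_cons, this, Nat.succ_mul, Nat.add_comm _ m, List.replicate_add]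
      simp [State.setR, State.setReg, State.set, State.spill, contrib, stOf,
          Function.update_apply]
      split_ifs <;> simp_all [flatMap_const, flatMap_nil]
  · refine ⟨by simp, ρ.r, ?_⟩
    simp
  · rintro _ ⟨_, ⟨-, r, rfl⟩, rfl⟩
    simp [State.setR, State.setReg, State.reg]

end

/-! ### Guessing a word and evaluating it -/

namespace Prog

/-- Guess a bit, store it in the register `b`, and guess as many bits as the stack `J` has symbols
on the stack `R`. -/
def guessBits : Prog M :=
  .seq .guess <| .seq (.loadR fun ρ => { ρ with b := ρ.g }) <|
  .each (.ex .J) (.seq .guess (.push (.ex .R) fun ρ => ρ.g))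

/-- Set the register `fl` to whether all symbols of a stack are `0`, and empty the stack. -/
def allZero (n : Stk) : Prog M :=
  .seq (.loadR fun ρ => { ρ with fl := true }) <|
  .each n (.loadR fun ρ => { ρ with fl := ρ.fl && !(ρ.r.getD false) })

/-- Evaluate the guessed bits. -/
def evaluate : Prog M :=
  .ite (fun v => v.2.2.b) (compare (.ex .R) (.ex .Z)) <|
  .seq (.load fun v => (some M.main, M.start, { v.2.2 with ov := false })) <|
  .seq simulate (allZero (.ex .R))

/-- The program of the counting machine. -/
def counter : Prog M :=
  .seq readModes <| .seq readUnary <| .seq readString <| .seq loadInstance <|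
  .seq logarithm <| .seq multiply <| .seq guessBits evaluate

end Prog

section

variable {c₁ : Option M.Λ} {c₂ : M.σ} {ρ : Reg} {wk : ∀ k, List (M.Γ k)}

theorem Tri.guessBits (b : Bool) (l u : List Bool) (hu : u.length = l.length)
    (X : List (Stk × List Bool)) :
    Tri O H (.guessBits (M := M)) ⟨(c₁, c₂, ρ), stOf ((.ex .J, l) :: (.ex .R, []) :: X), wk⟩
      -- Pushing reverses the order of the guesses: for `u` to lie on `R` with its first letter on
      -- top, the guesses must be `u.reverse`.
      (b :: u.reverse) (4 * l.length + 4)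
      (fun s' => ∃ r g, s' = ⟨(c₁, c₂, { ρ with r := r, g := g, b := b }),
        stOf ((.ex .J, []) :: (.ex .R, u) :: X), wk⟩) := by
  suffices h : ∀ (w l v : List Bool) g, w.length = l.length → Tri O H (.loop (fun v => v.2.2.r.isSome)
      (.seq (.seq .guess (.push (.ex .R) fun ρ => ρ.g)) (.pop (.ex .J))))
      ⟨(c₁, c₂, { ρ with r := l.head?, g := g, b := b }),
        stOf ((.ex .J, l.tail) :: (.ex .R, v) :: X), wk⟩ w (4 * l.length + 1)
      (fun s' => ∃ r g, s' = ⟨(c₁, c₂, { ρ with r := r, g := g, b := b }),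
        stOf ((.ex .J, []) :: (.ex .R, w.reverse ++ v) :: X), wk⟩) by
    refine ((Tri.guess b).seqW_eq ((Tri.loadR _).seq_eq (.seq_eq (.pop (.ex .J))
      (.of_eq ?_ (h u.reverse l [] b (by simpa using hu)))))).mono (by omega) ?_
    · refine State.ext (by simp [State.setR, State.setReg, State.reg, State.set, stOf])
        (funext fun m => ?_) rfl
      simp [State.setR, State.setReg, State.set, stOf, Function.update_apply]
      split_ifs <;> simp_all
    · rintro _ ⟨r, g, rfl⟩
      exact ⟨r, g, by simp⟩
  intro w
  induction w with
  | nil =>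
    intro l v g h
    obtain rfl := List.length_eq_zero_iff.1 h.symm
    refine (Tri.whileFalse rfl).mono (by simp) ?_
    rintro _ rfl
    exact ⟨none, g, by simp⟩
  | cons a w ih =>
    intro l v g h
    rcases l with _ | ⟨c, l⟩
    · simp at h
    refine (Tri.whileTrueW (w := [a]) rfl (((Tri.guess a).seqW_eq (Tri.push _ _)).seqW_eq
      (Tri.pop _)) ?_).time
      (T := 3 + (4 * l.length + 1) + 1) (by simp; omega)
    rintro _ rfl
    refine .of_eq ?_ ((ih l (a :: v) a (by simpa using h)).mono le_rfl ?_)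
    · refine State.ext (by simp [State.setR, State.setReg, State.reg, State.set, stOf])
        (funext fun m => ?_) rfl
      simp [State.setR, State.setReg, State.reg, State.set, stOf, Function.update_apply]
      split_ifs <;> simp_all
    · rintro _ ⟨r, g, rfl⟩
      exact ⟨r, g, by simp⟩

theorem Tri.allZero (n : Stk) (s : State M) :
    Tri O H (.allZero n) s [] (3 * (s.st n).length + 3)
      (fun s' => s' = (s.set n []).setReg { s.reg with r := none, fl := (s.st n).all not }) := by
  refine (Tri.seq_eq (Tri.loadR _) (Tri.each (T := 1) (l := s.st n)
      (P := fun l s' => ∃ fl r, (fl && l.all not) = (s.st n).all not ∧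
        s' = (s.set n l).setReg { s.reg with r := r, fl := fl })
      ?_ ?_ ⟨true, s.reg.r, by simp, ?_⟩)).mono (by omega) ?_
  · rintro l _ ⟨fl, r, -, rfl⟩
    simp [State.setReg]
  · rintro b l _ ⟨fl, r, h, rfl⟩
    refine (Tri.loadR _).mono le_rfl ?_
    rintro _ rfl
    refine ⟨fl && !b, some b, by rw [← h]; simp [Bool.and_assoc], ?_⟩
    simp [State.setReg, State.setR, State.set, State.reg]
  · simp [State.setReg, State.set, State.reg]
  · rintro _ ⟨_, ⟨fl, r, h, rfl⟩, rfl⟩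
    rw [← h]
    simp [State.setReg, State.setR, State.reg]

end

/-- Acceptance of the counting machine. -/
def counterAccept (M : Machine) (v : Ctl M) : Bool :=
  let ρ := v.2.2
  if ρ.b then ρ.m₁ && ρ.fl
  else if ρ.m₂ then ρ.ov else !ρ.ov && M.accept v.2.1 && (!ρ.m₃ || ρ.fl)

/-- The choices that the counting machine accepts. -/
def Machine.Counted (M : Machine) (m₁ m₂ m₃ : Bool) (z x : List Bool) (k : ℕ) (b : Bool)
    (u : List Bool) : Prop :=
  match b with
  | true => m₁ = true ∧ val z ≤ val u
  | false => M.Accepts x k m₂ m₃ u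

theorem Tri.evaluate (hM : M.OracleFree) {T k : ℕ} {x z u : List Bool} {ρ : Reg}
    {X : List (Stk × List Bool)} (hX : ∀ p, stOf X (.sim p) = [])
    (hT : ∀ w t c, M.FreePath (M.init x k) w t c → t ≤ T) :
    Tri O H (.evaluate (M := M)) ⟨(none, M.start, ρ),
        stOf ((.ex .R, u) :: (.ex .Z, z) :: (.sim .input, x) ::
          (.sim .param, List.replicate k true) :: X), fun _ => []⟩ []
      (5 * u.length + 3 * z.length + 2 * T + 8)
      (fun s' => counterAccept M s'.ctl = true ↔
        M.Counted ρ.m₁ ρ.m₂ ρ.m₃ z x k ρ.b u) := by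
  cases hb : ρ.b with
  | true =>
    refine (Tri.iteTrue hb (Tri.compare (by simp) _)).mono (by simp [stOf]; omega) ?_
    rintro _ ⟨g, rfl⟩
    simp [State.setReg, State.set, State.reg, stOf, counterAccept, hb, Machine.Counted]
  | false =>
    set s₁ : State M := ⟨(some M.main, M.start, { ρ with ov := false }),
        stOf ((.ex .R, u) :: (.ex .Z, z) :: (.sim .input, x) ::
          (.sim .param, List.replicate k true) :: X), fun _ => []⟩ with hs₁
    -- By `hX` the remaining simulated ports are empty, so the simulation starts from a genuine
    -- initial configuration.
    have hmc : s₁.mc = M.init x k := by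
      simp only [State.mc, Machine.init, hs₁, TM2.Cfg.mk.injEq, true_and]
      funext i
      rcases i with p | i
      · cases p <;> simp [stOf, hX]
      · rfl
    have hR : s₁.st (.ex .R) = u := by simp [hs₁, stOf]
    refine (Tri.iteFalse hb (Tri.seq_eq (Tri.load _) (Tri.seq
      (Tri.simulate hM (s := s₁) rfl (T := T) (hmc ▸ hT)) (T' := 3 * u.length + 3)
      ?_))).time (by omega)
    rintro s ⟨w, t, h1, h2, h3, h4, h5, h6, h7⟩
    rw [hR] at h1
    rw [hmc] at h2
    refine (Tri.allZero _ s).mono (by rw [h1]; simp) ?_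
    rintro _ rfl
    change s.ctl.2.2.m₁ = ρ.m₁ at h4
    change s.ctl.2.2.m₂ = ρ.m₂ at h5
    change s.ctl.2.2.m₃ = ρ.m₃ at h6
    change s.ctl.2.2.b = ρ.b at h7
    simp only [State.setReg, State.set, State.reg, counterAccept, h5, h6, h7, hb,
      Machine.Counted, Bool.false_eq_true, if_false]
    rcases h3 with ⟨hl, ho⟩ | ⟨hr, ho, hg⟩
    · change s.ctl.2.2.ov = false at ho
      rw [h1, hM.accepts_halt h2 hl, ho]
      change _ ↔ _ ∧ M.accept s.ctl.2.1 = true ∧ _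
      cases ρ.m₂ <;> cases ρ.m₃ <;> simp
    · change s.ctl.2.2.ov = true at ho
      rw [hr, List.append_nil] at h1
      rw [h1, hM.accepts_atGuess h2 hg, ho]
      cases ρ.m₂ <;> simp

/-! ### Parameterized bounds -/

/-- A monotone bound of a function. -/
def majorant (f : ℕ → ℕ) (n : ℕ) : ℕ :=
  Nat.rec (f 0) (fun m s => s + f (m + 1)) n

theorem majorant_computable {f : ℕ → ℕ} (hf : Computable f) : Computable (majorant f) := by
  refine Computable.nat_rec (f := fun n => n) (g := fun _ => f 0)
    (h := fun _ p => p.2 + f (p.1 + 1)) Computable.id (.const _) ?_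
  have h1 : Computable fun p : ℕ × ℕ × ℕ => p.2.2 := Computable.snd.comp .snd
  have h2 : Computable fun p : ℕ × ℕ × ℕ => f (p.2.1 + 1) :=
    hf.comp (Primrec.succ.to_comp.comp (Computable.fst.comp .snd))
  exact Primrec.nat_add.to_comp.comp h1 h2

theorem majorant_mono (f : ℕ → ℕ) : Monotone (majorant f) :=
  monotone_nat_of_le_succ fun _ => Nat.le_add_right _ _

theorem le_majorant (f : ℕ → ℕ) (n : ℕ) : f n ≤ majorant f n := by
  cases n with
  | zero => exact le_rfl
  | succ n => exact Nat.le_add_left _ _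

/-- A function of the parameter and the input length is bounded by a computable function of the
parameter times a polynomial in the input length. -/
def IsFpt (B : ℕ → ℕ → ℕ) : Prop :=
  ∃ g d, Computable g ∧ Monotone g ∧ ∀ k n, B k n ≤ g k * (n + 1) ^ d

namespace IsFpt

variable {B C : ℕ → ℕ → ℕ}

theorem param {f : ℕ → ℕ} (hf : Computable f) : IsFpt fun k _ => f k :=
  ⟨majorant f, 0, majorant_computable hf, majorant_mono f, fun k n => by
    simpa using le_majorant f k⟩

theorem const (c : ℕ) : IsFpt fun _ _ => c := param (.const c)

theorem length : IsFpt fun _ n => n :=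
  ⟨fun _ => 1, 1, .const 1, monotone_const, fun k n => by simp⟩

theorem add (hB : IsFpt B) (hC : IsFpt C) : IsFpt fun k n => B k n + C k n := by
  obtain ⟨g, d, hg, hm, hB⟩ := hB
  obtain ⟨g', d', hg', hm', hC⟩ := hC
  refine ⟨fun k => g k + g' k, d + d', Primrec.nat_add.to_comp.comp hg hg', hm.add hm',
    fun k n => ?_⟩
  rw [add_mul]
  refine Nat.add_le_add ((hB k n).trans ?_) ((hC k n).trans ?_)
  · exact Nat.mul_le_mul_left _ (Nat.pow_le_pow_right (by omega) (by omega))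
  · exact Nat.mul_le_mul_left _ (Nat.pow_le_pow_right (by omega) (by omega))

theorem mul (hB : IsFpt B) (hC : IsFpt C) : IsFpt fun k n => B k n * C k n := by
  obtain ⟨g, d, hg, hm, hB⟩ := hB
  obtain ⟨g', d', hg', hm', hC⟩ := hC
  refine ⟨fun k => g k * g' k, d + d', Primrec.nat_mul.to_comp.comp hg hg', hm.mul' hm',
    fun k n => ?_⟩
  rw [pow_add, mul_mul_mul_comm]
  exact Nat.mul_le_mul (hB k n) (hC k n)

theorem eval (p : Polynomial ℕ) : IsFpt fun _ n => p.eval n := by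
  induction p using Polynomial.induction_on' with
  | add p q hp hq => simpa using hp.add hq
  | monomial d a =>
    refine ⟨fun _ => a, d, .const a, monotone_const, fun k n => ?_⟩
    simp only [Polynomial.eval_monomial]
    exact Nat.mul_le_mul_left _ (Nat.pow_le_pow_left (by omega) _)

theorem exists_poly (hB : IsFpt B) :
    ∃ (g : ℕ → ℕ) (p : Polynomial ℕ), Computable g ∧ ∀ k n, B k n ≤ g k * p.eval n := by
  obtain ⟨g, d, hg, -, hB⟩ := hB
  exact ⟨g, (Polynomial.X + 1) ^ d, hg, by simpa using hB⟩

theorem comp {h : ℕ → ℕ} (hB : IsFpt B) (hh : Computable h) (hC : IsFpt C) :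
    ∃ D, IsFpt D ∧ ∀ k n k' n', k' ≤ h k → n' ≤ C k n → B k' n' ≤ D k n := by
  obtain ⟨g, d, hg, hm, hB⟩ := hB
  -- A fixed power of an fpt bound is again one; monotonicity of `g` then allows `k'` to be replaced
  -- by its bound `h k`.
  have h1 : ∀ d, IsFpt fun k n => (C k n + 1) ^ d := by
    intro d
    induction d with
    | zero => simpa using const 1
    | succ d ih => simpa only [pow_succ] using ih.mul (hC.add (const 1))
  refine ⟨fun k n => g (h k) * (C k n + 1) ^ d, (param (hg.comp hh)).mul (h1 d),
    fun k n k' n' hk hn => (hB k' n').trans ?_⟩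
  exact Nat.mul_le_mul (hm hk) (Nat.pow_le_pow_left (by omega) _)

end IsFpt

/-! ### Properties of the counting machine -/

/-- The counting machine of `M`. -/
noncomputable def countingMachine (M : Machine) : Machine :=
  Prog.counter.compile (counterAccept M)

/-- The encoding of a string by `splitString`. -/
def encString (z : List Bool) : List Bool := z.reverse.flatMap (fun b => [true, b]) ++ [false]

theorem splitString_encString (z x : List Bool) :
    splitString [] (encString z ++ x) = (z, x) := by
  suffices h : ∀ l v : List Bool, splitString v (l.flatMap (fun b => [true, b]) ++ false :: x) =
      (l.reverse ++ v, x) by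
    simpa [encString] using h z.reverse []
  intro l
  induction l with
  | nil => intro v; simp [splitString]
  | cons b l ih => intro v; simp [splitString, ih]

theorem splitOnes_append (a : ℕ) (x : List Bool) :
    splitOnes (List.replicate a true ++ false :: x) = (a, x) := by
  induction a with
  | zero => rfl
  | succ a ih => simp [List.replicate_succ, splitOnes, ih]

/-- This is stated for an arbitrary input `y`, with whatever its decoding yields, because
k-restrictedness concerns malformed inputs too. Missing mode bits count as 0, and the factor in `j`
is cut off at `K`. -/
theorem counter_tri (hM : M.OracleFree) {H K a j T : ℕ} {y l z x : List Bool} {m₁ m₂ m₃ b : Bool}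
    (hm₁ : y.head?.getD false = m₁) (hm₂ : y.tail.head?.getD false = m₂)
    (hm₃ : y.tail.tail.head?.getD false = m₃) (ha : splitOnes y.tail.tail.tail = (a, l))
    (hz : splitString [] l = (z, x)) (hj : j = min a K * Nat.log 2 (x.length + 2))
    (hT : ∀ w t c, M.FreePath (M.init x (K - a)) w t c → t ≤ T)
    {u : List Bool} (hu : u.length = j) :
    Tri 0 H .counter (State.init M y K) (b :: u.reverse) (150 * (K + 1) * (y.length + 1) + 2 * T)
      (fun s' => counterAccept M s'.ctl = true ↔ M.Counted m₁ m₂ m₃ z x (K - a) b u) := by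
  have hl : l.length ≤ y.length := by
    have := splitOnes_length y.tail.tail.tail
    rw [ha] at this
    simp at this
    omega
  have hzx : x.length ≤ y.length ∧ z.length ≤ y.length := by
    have := splitString_length [] l
    rw [hz] at this
    simp at this
    omega
  have hlog : Nat.log 2 (x.length + 2) ≤ y.length + 1 := by
    have := Nat.log_lt_self 2 (x := x.length + 2) (by omega)
    omega
  have e0 : State.init M y K = ⟨(none, M.start, .start),
      stOf [(.io .input, y), (.io .param, List.replicate K true)], fun _ => []⟩ := by
    refine State.ext rfl (funext fun m => ?_) rfl
    rcases m with p | p | p <;> cases p <;> simp [State.init, stOf]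
  have hj' : j ≤ K * (y.length + 1) := hj ▸ Nat.mul_le_mul (min_le_right _ _) hlog
  have hmul : (9 * Nat.log 2 (x.length + 2) + 6) * min a K ≤ 15 * (K * (y.length + 1)) := by
    calc _ ≤ (15 * (y.length + 1)) * K := Nat.mul_le_mul (by omega) (min_le_right _ _)
      _ = _ := by ring
  rw [e0]
  refine Tri.time (T := 6 + ((6 * y.length + 2) + ((4 * y.length + 2) +
    ((9 * y.length + 4 * K + 9) + ((40 * (y.length + 2) + 1) +
    (15 * (K * (y.length + 1)) + 2 +
    ((4 * j + 4) + (5 * j + 3 * y.length + 2 * T + 8)))))))) ?_ (by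
      have h1 : 150 * (K + 1) * (y.length + 1) =
        150 * (K * (y.length + 1)) + 150 * (y.length + 1) := by ring
      have h2 : K ≤ K * (y.length + 1) := Nat.le_mul_of_pos_right _ (by omega)
      omega)
  refine (Tri.readModes _ _).seqW (w := []) fun s hs => ?_
  obtain ⟨r, rfl⟩ := hs
  refine ((Tri.readUnary _ _).time (T' := 6 * y.length + 2) (by simp; omega)).seqW (w := [])
    fun s hs => ?_
  obtain ⟨r, rfl⟩ := hs
  rw [ha]
  refine ((Tri.readString _ _ _).time (T' := 4 * y.length + 2) (by simp; omega)).seqW (w := [])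
    fun s hs => ?_
  obtain ⟨r, rfl⟩ := hs
  rw [hz]
  refine ((Tri.loadInstance _ _ _ _).time (T' := 9 * y.length + 4 * K + 9)
    (by simp; omega)).seqW (w := []) fun s hs => ?_
  obtain ⟨r, rfl⟩ := hs
  -- This and the similar identities below reorder the list of stacks and add or drop empty ones, to
  -- match the form that the next routine expects.
  have e1 : ∀ U A X Y Z, stOf [(.ex .U, U), (.sim .input, X), (.sim .param, Y), (.ex .A, A),
      (.ex .Z, Z)] = stOf [(.ex .U, U), (.ex .V, []), (.ex .L, []), (.sim .input, X),
        (.sim .param, Y), (.ex .A, A), (.ex .Z, Z)] := by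
    intro U A X Y Z
    funext m
    rcases m with p | p | p <;> cases p <;> simp [stOf]
  simp only [e1]
  refine ((Tri.logarithm _ (by omega) _).time (T' := 40 * (y.length + 2) + 1)
    (by omega)).seqW (w := []) fun s hs => ?_
  obtain ⟨g, rfl⟩ := hs
  have e2 : ∀ L A X Y Z, stOf [(.ex .U, []), (.ex .V, []), (.ex .L, L), (.sim .input, X),
        (.sim .param, Y), (.ex .A, A), (.ex .Z, Z)] =
      stOf [(.ex .A, A), (.ex .L, L), (.ex .J, []), (.ex .T, []), (.sim .input, X),
        (.sim .param, Y), (.ex .Z, Z)] := by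
    intro L A X Y Z
    funext m
    rcases m with p | p | p <;> cases p <;> simp [stOf]
  rw [List.length_replicate, e2]
  refine ((Tri.multiply _ _ _).time (T' := 15 * (K * (y.length + 1)) + 2) (by omega)).seqW
    (w := []) fun s hs => ?_
  subst hs
  have e3 : ∀ J L X Y Z, stOf [(.ex .A, []), (.ex .L, L), (.ex .J, J), (.ex .T, []),
        (.sim .input, X), (.sim .param, Y), (.ex .Z, Z)] =
      stOf [(.ex .J, J), (.ex .R, []), (.ex .Z, Z), (.sim .input, X), (.sim .param, Y),
        (.ex .L, L)] := by
    intro J L X Y Z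
    funext m
    rcases m with p | p | p <;> cases p <;> simp [stOf]
  rw [e3, ← hj]
  refine ((Tri.guessBits b _ u (by simpa using hu) _).time (T' := 4 * j + 4) (by simp)).seqW_nil
    fun s hs => ?_
  obtain ⟨r, g, rfl⟩ := hs
  have e4 : ∀ J L X Y Z, stOf [(.ex .J, []), (.ex .R, J), (.ex .Z, Z), (.sim .input, X),
        (.sim .param, Y), (.ex .L, L)] =
      stOf [(.ex .R, J), (.ex .Z, Z), (.sim .input, X), (.sim .param, Y), (.ex .L, L)] := by
    intro J L X Y Z
    funext m
    rcases m with p | p | p <;> cases p <;> simp [stOf]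
  rw [e4]
  have e5 : (List.drop a (List.replicate K true)).length = K - a := by simp
  rw [e5]
  refine (Tri.evaluate hM (by simp [stOf]) hT).mono (by omega) ?_
  intro s' h
  rw [h]
  simp only [hm₁, hm₂, hm₃]

theorem counter_path (hM : M.OracleFree) {K a j T : ℕ} {y l z x : List Bool} {m₁ m₂ m₃ : Bool}
    (hm₁ : y.head?.getD false = m₁) (hm₂ : y.tail.head?.getD false = m₂)
    (hm₃ : y.tail.tail.head?.getD false = m₃) (ha : splitOnes y.tail.tail.tail = (a, l))
    (hz : splitString [] l = (z, x)) (hj : j = min a K * Nat.log 2 (x.length + 2))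
    (hT : ∀ w t c, M.FreePath (M.init x (K - a)) w t c → t ≤ T)
    (w : List Bool) (hw : w.length = j + 1) :
    ∃ t c, (countingMachine M).FreePath ((countingMachine M).init y K) w t c ∧ c.l = none ∧
      t ≤ 150 * (K + 1) * (y.length + 1) + 2 * T + 1 ∧
      ((countingMachine M).accept c.var = true ↔
        ∃ b u, w = b :: u.reverse ∧ u.length = j ∧ M.Counted m₁ m₂ m₃ z x (K - a) b u) := by
  rcases w with _ | ⟨b, w⟩
  · simp at hw
  obtain ⟨t, s', ht, h, hQ⟩ := counter_tri (H := 0) hM hm₁ hm₂ hm₃ ha hz hj hT (b := b)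
    (u := w.reverse) (by simpa using hw)
  rw [List.reverse_reverse] at h
  obtain ⟨c, hc, hl, hv⟩ := h.bPath (acc := counterAccept M)
  refine ⟨t + 1, c, hc.path, hl, by omega, ?_⟩
  change counterAccept M c.var = true ↔ _
  rw [hv, hQ]
  constructor
  · intro h
    exact ⟨b, w.reverse, by simp, by simpa using hw, h⟩
  · rintro ⟨b', u, he, -, hcnt⟩
    obtain ⟨rfl, rfl⟩ := List.cons.inj he
    simpa using hcnt

theorem countingMachine_oracleFree (M : Machine) : (countingMachine M).OracleFree :=
  Prog.NoQuery.oracleFree (by repeat' constructor) _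

/-- The word guessed has length at most K · log, because the factor is taken out of the parameter K.
The bit `b` adds one more choice, absorbed by K + 1 since log(n + 2) ≥ 1. -/
theorem countingMachine_kRestricted (hM : M.KRestricted) : (countingMachine M).KRestricted := by
  obtain ⟨hM, f, g, p, hf, hg, h⟩ := hM
  refine ⟨countingMachine_oracleFree M, ?_⟩
  obtain ⟨D, hD, hDb⟩ := ((IsFpt.param hg).mul (IsFpt.eval p)).comp Computable.id IsFpt.length
  obtain ⟨g', p', hg', hb⟩ := ((((IsFpt.const 150).mul ((IsFpt.param Computable.id).add
    (IsFpt.const 1))).mul (IsFpt.length.add (IsFpt.const 1))).add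
    ((IsFpt.const 2).mul hD)).add (IsFpt.const 1) |>.exists_poly
  refine ⟨fun k => k + 1, g', p', Primrec.succ.to_comp, hg', fun y K w t c hp => ?_⟩
  rcases ha : splitOnes y.tail.tail.tail with ⟨a, l⟩
  rcases hz : splitString [] l with ⟨z, x⟩
  have hx : x.length ≤ y.length := by
    have h1 := splitOnes_length y.tail.tail.tail
    have h2 := splitString_length [] l
    rw [ha] at h1
    rw [hz] at h2
    simp at h1 h2
    omega
  have hlog : Nat.log 2 (x.length + 2) ≤ Nat.log 2 (y.length + 2) := Nat.log_mono_right (by omega)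
  have hlog' : 1 ≤ Nat.log 2 (y.length + 2) := Nat.log_pos (by norm_num) (by omega)
  obtain ⟨h1, h2⟩ := (countingMachine_oracleFree M).path_bound (fun w hw =>
    let ⟨t, c, h1, h2, h3, _⟩ := counter_path hM rfl rfl rfl ha hz rfl
      (fun w t c hp => ((h _ _ _ _ _ hp).1.trans (hDb K y.length _ _ (Nat.sub_le _ _) hx)))
      w hw
    ⟨t, c, h1, h2, h3⟩) hp
  refine ⟨h1.trans (hb K y.length), h2.trans ?_⟩
  have := Nat.mul_le_mul (min_le_right a K) hlog
  change min a K * _ + 1 ≤ (K + 1) * _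
  rw [Nat.succ_mul]
  omega

/-- Queries to the counting machine. -/
def queryString (m₁ m₂ m₃ : Bool) (a : ℕ) (z x : List Bool) : List Bool :=
  m₁ :: m₂ :: m₃ :: (List.replicate a true ++ false :: (encString z ++ x))

section

variable {m₁ m₂ m₃ : Bool} {a k : ℕ} {z x : List Bool}

/-- The common length of all accepting paths is what turns their number into a probability with the
fixed denominator `2 ^ (j + 1)`. -/
theorem countingMachine_accPaths (hM : M.KRestricted) :
    (countingMachine M).accPaths (queryString m₁ m₂ m₃ a z x) (k + a) =
      {w | w.length = a * Nat.log 2 (x.length + 2) + 1 ∧ ∃ b u, w = b :: u.reverse ∧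
        u.length = a * Nat.log 2 (x.length + 2) ∧ M.Counted m₁ m₂ m₃ z x k b u} := by
  obtain ⟨hM, f, g, p, hf, hg, h⟩ := hM
  refine (countingMachine_oracleFree M).accPaths_eq fun w hw => ?_
  obtain ⟨t, c, h1, h2, -, h3⟩ := counter_path hM (K := k + a) (a := a) (z := z) (x := x)
    (y := queryString m₁ m₂ m₃ a z x) (m₁ := m₁) (m₂ := m₂) (m₃ := m₃) rfl rfl rfl
    (splitOnes_append _ _) (splitString_encString _ _) (j := a * Nat.log 2 (x.length + 2))
    (by simp) (T := g k * p.eval x.length) (by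
      rw [Nat.add_sub_cancel]; exact fun w t c hp => (h _ _ _ _ _ hp).1) w hw
  rw [Nat.add_sub_cancel] at h3
  exact ⟨t, c, h1, h2, h3⟩

theorem countingMachine_numAcc (hM : M.KRestricted) :
    (countingMachine M).numAcc (queryString m₁ m₂ m₃ a z x) (k + a) =
      M.count x k m₂ m₃ (a * Nat.log 2 (x.length + 2)) +
        if m₁ = true then 2 ^ (a * Nat.log 2 (x.length + 2)) - val z else 0 := by
  rw [Machine.numAcc, countingMachine_accPaths hM]
  have := ncard_cons_reverse (a * Nat.log 2 (x.length + 2)) (M.Counted m₁ m₂ m₃ z x k)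
  rw [show ({w | w.length = a * Nat.log 2 (x.length + 2) + 1 ∧ ∃ b u, w = b :: u.reverse ∧
        u.length = a * Nat.log 2 (x.length + 2) ∧ M.Counted m₁ m₂ m₃ z x k b u} : Set (List Bool)) =
      {w | ∃ b u, w = b :: u.reverse ∧
        u.length = a * Nat.log 2 (x.length + 2) ∧ M.Counted m₁ m₂ m₃ z x k b u} from ?_, this]
  · congr 1
    cases m₁ with
    | true => simpa [Machine.Counted] using ncard_val_ge _ _
    | false => simp [Machine.Counted]
  · ext w
    constructor
    · exact fun h => h.2
    · rintro ⟨b, u, rfl, hu, h⟩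
      exact ⟨by simp [hu], b, u, rfl, hu, h⟩

/-- Probability above 1/2 means count + (2^j - z) > 2^j, that is, z < count. The bound count ≤ 2^j
makes this correct also when the subtraction is truncated. -/
theorem countingMachine_acceptProb (hM : M.KRestricted) :
    1 / 2 < (countingMachine M).acceptProb (queryString true m₂ m₃ a z x) (k + a) ↔
      val z < M.count x k m₂ m₃ (a * Nat.log 2 (x.length + 2)) := by
  rw [Machine.acceptProb_of_length (j := a * Nat.log 2 (x.length + 2) + 1), div_lt_div_iff₀
    (by norm_num) (by positivity), countingMachine_numAcc hM, pow_succ, if_pos rfl]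
  · have := Machine.count_le (M := M) (x := x) (k := k) (j := a * Nat.log 2 (x.length + 2)) m₂ m₃
    rw [← mul_assoc, mul_lt_mul_iff_left₀ (by norm_num), one_mul]
    norm_cast
    omega
  · intro w hw
    rw [countingMachine_accPaths hM] at hw
    exact hw.1

end

/-! ### Growth of the stacks -/

/-- The number of push instructions in a statement. -/
def numPush {K : Type} {Γ : K → Type} {Λ σ : Type} : TM2.Stmt Γ Λ σ → ℕ
  | .push _ _ q => numPush q + 1
  | .peek _ _ q => numPush q
  | .pop _ _ q => numPush q
  | .load _ q => numPush q
  | .branch _ q₁ q₂ => numPush q₁ + numPush q₂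
  | .goto _ => 0
  | .halt => 0

theorem length_stepAux_le {K : Type} [DecidableEq K] {Γ : K → Type} {Λ σ : Type}
    (q : TM2.Stmt Γ Λ σ) (v : σ) (S : ∀ k, List (Γ k)) (i : K) :
    ((TM2.stepAux q v S).stk i).length ≤ (S i).length + numPush q := by
  induction q generalizing v S with
  | push k f q ih =>
    refine (ih _ _).trans ?_
    by_cases h : i = k
    · subst h; simp [numPush]; omega
    · simp [numPush, h]
  | peek k f q ih => exact ih _ _
  | pop k f q ih =>
    refine (ih _ _).trans ?_
    by_cases h : i = k
    · subst h; simp [numPush]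
    · simp [numPush, h]
  | load f q ih => exact ih _ _
  | branch f q₁ q₂ ih₁ ih₂ =>
    have h₁ := ih₁ v S
    have h₂ := ih₂ v S
    simp only [TM2.stepAux, numPush]
    cases f v
    · simp only [cond_false]; omega
    · simp only [cond_true]; omega
  | goto f => simp [TM2.stepAux]
  | halt => simp [TM2.stepAux]

namespace Machine

theorem exists_numPush_le (M : Machine) :
    ∃ C, ∀ q s, M.instr q = .det s → numPush s ≤ C := by
  let f : M.Λ → ℕ := fun q => match M.instr q with
    | .det s => numPush s
    | _ => 0
  obtain ⟨C, hC⟩ := (Set.finite_range f).bddAbove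
  refine ⟨C, fun q s h => ?_⟩
  have := hC ⟨q, rfl⟩
  simpa [f, h] using this

theorem Path.length_queryInput_le (hM : M.Deterministic) {C : ℕ}
    (hC : ∀ q s, M.instr q = .det s → numPush s ≤ C) {c c' : M.Cfg} {w t}
    (h : M.Path O c w t c') :
    (c'.stk (.inl .queryInput)).length ≤ (c.stk (.inl .queryInput)).length + C * t := by
  induction h with
  | refl c => simp
  | @det c c' q s w t hq hi h ih =>
    have h1 := length_stepAux_le s c.var c.stk (.inl .queryInput)
    have h2 := hC q s hi
    rw [Nat.mul_succ]
    omega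
  | guess b hq hi h ih => exact absurd hi (hM _ _ _)
  | @query c c' q q' w t hq hi h ih =>
    rw [Nat.mul_succ]
    simp only [answered, List.length_nil] at ih
    omega

/-- A query replaces the answer, so answer lengths do not add up: there is at most one answer, plus
what was pushed meanwhile. The prefix `h₀` from `c₀` is carried along because `hB` speaks only of
configurations reachable from `c₀` in time. -/
theorem Path.length_answer_le (hM : M.Deterministic) {C B N : ℕ}
    (hC : ∀ q s, M.instr q = .det s → numPush s ≤ C) {c₀ : M.Cfg}
    (hB : ∀ t c q q', M.Path O c₀ [] t c → t ≤ N → c.l = some q → M.instr q = .query q' →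
      (O (c.stk (.inl .queryInput), (c.stk (.inl .queryParam)).length)).bits.length ≤ B)
    {c c' : M.Cfg} {t t₀}
    (h : M.Path O c [] t c') (h₀ : M.Path O c₀ [] t₀ c) (ht : t₀ + t ≤ N)
    (hc : (c.stk (.inl .answer)).length ≤ B + C * t₀) :
    (c'.stk (.inl .answer)).length ≤ B + C * (t₀ + t) := by
  generalize hw : [] = w at h
  induction h generalizing t₀ with
  | refl c => simpa using hc
  | @det c c' q s w t hq hi h ih =>
    subst hw
    have h1 := length_stepAux_le s c.var c.stk (.inl .answer)
    have h2 := hC q s hi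
    have := ih (h₀.trans (.det hq hi (.refl _))) (by omega)
      (by simp only [Nat.mul_add]; omega) rfl
    rwa [show t₀ + (t + 1) = t₀ + (0 + 1) + t by ring]
  | guess b hq hi h ih => exact absurd hi (hM _ _ _)
  | @query c c' q q' w t hq hi h ih =>
    subst hw
    have h1 := hB _ _ _ _ h₀ (by omega) hq hi
    have := ih (h₀.trans (.query hq hi (.refl _))) (by omega)
      (by simp only [answered]; omega) rfl
    rwa [show t₀ + (t + 1) = t₀ + (0 + 1) + t by ring]

end Machine

/-! ### Simulation of an oracle machine -/

/-- The instruction at the label is a query. -/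
def isQuery (M : Machine) (l : Option M.Λ) : Bool :=
  match l with
  | none => false
  | some q => match M.instr q with
    | .query _ => true
    | _ => false

/-- The label after a query. -/
def afterQuery (M : Machine) (l : Option M.Λ) : Option M.Λ :=
  match l with
  | none => none
  | some q => match M.instr q with
    | .query q' => some q'
    | _ => none

namespace Prog

/-- Move the input and the parameter to the simulated machine and start it. -/
def startOracle : Prog M :=
  .seq (.each (.io .input) (.pushes [(.ex .V, id)])) <|
  .seq (.each (.ex .V) (.pushes [(.sim .input, id)])) <|
  .seq (.each (.io .param) (.pushes [(.sim .param, fun _ => true)])) <|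
  .load fun v => (some M.main, v.2)

/-- Simulate the oracle machine `M`, and run `p` in place of its queries. -/
def oracleLoop (p : Prog M) : Prog M :=
  .loop (fun v => v.1.isSome) <|
    .ite (fun v => isQuery M v.1) (.seq p (.load fun v => (afterQuery M v.1, v.2))) .mstep

/-- Simulate the oracle machine `M` on the input, and run `p` in place of its queries. -/
def simOracle (p : Prog M) : Prog M := .seq startOracle (oracleLoop p)

end Prog

/-- All stacks except for those of the simulated machine are empty. -/
def State.Clean (s : State M) : Prop := (∀ p, s.st (.io p) = []) ∧ ∀ x, s.st (.ex x) = []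

/-- The state after a simulated query with registers `ρ`. -/
def State.simAnswer (s : State M) (O : ParamFun) (ρ : Reg) : State M where
  ctl := (s.ctl.1, s.ctl.2.1, ρ)
  st
    | .sim .queryInput => []
    | .sim .queryParam => []
    | .sim .answer =>
        (O (s.st (.sim .queryInput), (s.st (.sim .queryParam)).length)).bits
    | n => s.st n
  wk := s.wk

/-- With the oracle `O'`, the program `p` answers queries to `O` of the simulated machine in
time `T`, where all queries have parameter at most `Hq`. -/
def Answers (O O' : ParamFun) (p : Prog M) (T : ℕ → ℕ → ℕ) (Hq : ℕ → ℕ) : Prop :=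
  ∀ (s : State M) (H : ℕ), s.Clean → Hq (s.st (.sim .queryParam)).length ≤ H →
    Tri O' H p s []
      (T (s.st (.sim .queryParam)).length (s.st (.sim .queryInput)).length +
        3 * (s.st (.sim .answer)).length)
      (fun s' => ∃ ρ, s' = s.simAnswer O ρ)

theorem Tri.startOracle (x : List Bool) (k : ℕ) :
    Tri O H (.startOracle (M := M)) (State.init M x k) [] (8 * x.length + 4 * k + 7)
      (fun s' => s'.mc = M.init x k ∧ s'.Clean) := by
  have e0 : State.init M x k = ⟨(none, M.start, .start),
      stOf [(.io .input, x), (.io .param, List.replicate k true)], fun _ => []⟩ := by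
    refine State.ext rfl (funext fun m => ?_) rfl
    rcases m with p | p | p <;> cases p <;> simp [State.init, stOf]
  rw [e0]
  refine (Tri.seq_eq (Tri.each_pushes (by simp) _) <| Tri.seq_eq (Tri.each_pushes (by simp) _) <|
    Tri.seq_eq (Tri.each_pushes (by simp) _) <| Tri.load _).mono ?_ ?_
  · simp [State.setR, State.setReg, State.set, State.spill, contrib, stOf]
    omega
  · rintro _ rfl
    refine ⟨?_, ⟨fun p => ?_, fun x => ?_⟩⟩
    · simp only [State.mc, Machine.init, TM2.Cfg.mk.injEq]
      refine ⟨rfl, rfl, funext fun i => ?_⟩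
      rcases i with p | i
      · cases p <;>
          simp [State.setCtl, State.setR, State.setReg, State.set, State.spill, contrib, stOf,
            flatMap_const, flatMap_nil]
      · rfl
    · cases p <;>
          simp [State.setCtl, State.setR, State.setReg, State.set, State.spill, contrib, stOf,
            flatMap_nil]
    · cases x <;>
          simp [State.setCtl, State.setR, State.setReg, State.set, State.spill, contrib, stOf,
            flatMap_nil]

/-- Induction on the path of the oracle machine. Each of its steps costs at most `W + 3`, where `W`
bounds the answering of one query uniformly over the configurations reached within `N` steps. -/
theorem Tri.oracleLoop {O' : ParamFun} (hM : M.Deterministic) {p : Prog M} {T : ℕ → ℕ → ℕ}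
    {Hq : ℕ → ℕ} (hp : Answers O O' p T Hq) {N W : ℕ} {c₀ : M.Cfg}
    (hW : ∀ t c q q', M.Path O c₀ [] t c → t ≤ N → c.l = some q → M.instr q = .query q' →
      T (c.stk (.inl .queryParam)).length (c.stk (.inl .queryInput)).length +
        3 * (c.stk (.inl .answer)).length ≤ W ∧ Hq (c.stk (.inl .queryParam)).length ≤ H)
    {c c' : M.Cfg} {t t₀} (h : M.Path O c [] t c') (hc' : c'.l = none) (h₀ : M.Path O c₀ [] t₀ c)
    (ht : t₀ + t ≤ N) (s : State M) (hs : s.mc = c) (hcl : s.Clean) :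
    Tri O' H (.oracleLoop p) s [] (t * (W + 3) + 1) (fun s' => s'.mc = c') := by
  generalize hw : [] = w at h
  induction h generalizing t₀ s with
  | refl c =>
    have : s.ctl.1 = none := by rw [← hc', ← hs]; rfl
    refine (Tri.whileFalse (by simp [this])).mono (by simp) ?_
    rintro _ rfl
    exact hs
  | @det c c' q i w t hq hi h ih =>
    subst hw
    subst hs
    have hl : s.ctl.1 = some q := hq
    have e : s.mstep = s.withMc (TM2.stepAux i s.mc.var s.mc.stk) := by
      simp [State.mstep, hl, hi]
    refine (Tri.whileTrue (by simp [hl]) (Tri.iteFalse (by simp [isQuery, hl, hi]) Tri.mstep)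
      (fun s' hs' => ih hc' (h₀.trans (.det hq hi (.refl _))) (by omega) s' ?_ ?_ rfl)).time
      (by rw [Nat.succ_mul]; omega)
    · rw [hs', e, State.withMc_mc]
    · rw [hs', e]
      exact hcl
  | guess b hq hi h ih => exact absurd hi (hM _ _ _)
  | @query c c' q q' w t hq hi h ih =>
    subst hw
    subst hs
    have hl : s.ctl.1 = some q := hq
    obtain ⟨hW1, hH⟩ := hW _ _ _ _ h₀ (by omega) hq hi
    refine (Tri.whileTrue (P := fun s' => ∃ ρ, s' = (s.simAnswer O ρ).setCtl
        (some q', s.ctl.2.1, ρ)) (by simp [hl]) (Tri.iteTrue (by simp [isQuery, hl, hi])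
      ((hp s H hcl hH).seq (T' := 1) ?_))
      (fun s' hs' => ih hc' (h₀.trans (.query hq hi (.refl _))) (by omega) s' ?_ ?_ rfl)).time
      ?_
    · rintro _ ⟨ρ, rfl⟩
      refine (Tri.load _).mono le_rfl ?_
      rintro _ rfl
      refine ⟨ρ, ?_⟩
      simp [State.simAnswer, State.setCtl, afterQuery, hl, hi]
    · obtain ⟨ρ, rfl⟩ := hs'
      simp only [State.mc, State.setCtl, TM2.Cfg.mk.injEq, true_and]
      refine funext fun i => ?_
      rcases i with p | i
      · cases p <;> rfl
      · rfl
    · obtain ⟨ρ, rfl⟩ := hs'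
      exact hcl
    · have := Nat.add_mul t 1 (W + 3)
      change T (s.st (.sim .queryParam)).length (s.st (.sim .queryInput)).length +
        3 * (s.st (.sim .answer)).length ≤ W at hW1
      omega

/-- An oracle all of whose queries can be answered by means of another oracle in fpt time. -/
theorem fptRel_subset {O O' : ParamFun} {B T : ℕ → ℕ → ℕ} {Hq : ℕ → ℕ} (hB : IsFpt B)
    (hO : ∀ y k, (O (y, k)).bits.length ≤ B k y.length) (hT : IsFpt T) (hHq : Computable Hq)
    (p : ∀ M : Machine, Prog M) (hg : ∀ M, (p M).NoGuess) (hp : ∀ M, Answers O O' (p M) T Hq) :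
    FPTRel O ⊆ FPTRel O' := by
  rintro L ⟨M, hM, g, h, P, hgc, hh, hL⟩
  obtain ⟨C, hC⟩ := M.exists_numPush_le
  have hN : IsFpt fun k n => g k * P.eval n := (IsFpt.param hgc).mul (IsFpt.eval P)
  have hCN := (IsFpt.const C).mul hN
  -- Simulated queries have parameter at most `h k` and length at most `C` times the running time,
  -- so composition makes the cost and the answer length of each fpt in the original instance.
  obtain ⟨D₁, hD₁, hT'⟩ := hT.comp hh hCN
  obtain ⟨D₂, hD₂, hB'⟩ := hB.comp hh hCN
  obtain ⟨G, Q, hG, hGQ⟩ := (((((IsFpt.const 8).mul IsFpt.length).add ((IsFpt.const 4).mul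
    (IsFpt.param Computable.id))).add (IsFpt.const 7)).add ((hN.mul ((hD₁.add
      ((IsFpt.const 3).mul (hD₂.add hCN))).add (IsFpt.const 3))).add (IsFpt.const 2))).exists_poly
  have hdet : ((Prog.simOracle (p M)).compile fun v => M.accept v.2.1).Deterministic := by
    refine Prog.NoGuess.deterministic (p := .simOracle (p M)) ⟨?_, ⟨hg M, trivial⟩, trivial⟩ _
    repeat' constructor
  refine ⟨_, hdet, G, fun k => majorant Hq (h k), Q, hG, (majorant_computable hHq).comp hh,
    fun x k => ?_⟩
  obtain ⟨⟨t, c, hpath, hc, ht, hacc⟩, hq⟩ := hL x k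
  have hqI : ∀ t' c', M.Path O (M.init x k) [] t' c' → t' ≤ g k * P.eval x.length →
      (c'.stk (.inl .queryInput)).length ≤ C * (g k * P.eval x.length) := by
    intro t' c' hp' ht'
    have := hp'.length_queryInput_le hM hC
    simp only [Machine.init, List.length_nil, zero_add] at this
    exact this.trans (Nat.mul_le_mul_left _ ht')
  have hBb : ∀ t' c' q q', M.Path O (M.init x k) [] t' c' → t' ≤ g k * P.eval x.length →
      c'.l = some q → M.instr q = .query q' →
      (O (c'.stk (.inl .queryInput), (c'.stk (.inl .queryParam)).length)).bits.length ≤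
        D₂ k x.length := fun t' c' q q' hp' ht' hl hi =>
    (hO _ _).trans (hB' _ _ _ _ (hq _ _ _ _ hp' hl hi) (hqI _ _ hp' ht'))
  have hrun : Tri O' (majorant Hq (h k)) (.simOracle (p M)) (State.init M x k) [] _ _ :=
    (Tri.startOracle x k).seq fun s hs => Tri.oracleLoop hM (hp M)
      (N := g k * P.eval x.length)
      (W := D₁ k x.length + 3 * (D₂ k x.length + C * (g k * P.eval x.length)))
      (fun t' c' q q' hp' ht' hl hi => by
        have hk := hq _ _ _ _ hp' hl hi
        have h1 := hT' _ _ _ _ hk (hqI _ _ hp' ht')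
        have h2 := hp'.length_answer_le hM hC hBb (.refl _) (by omega)
          (by simp [Machine.init])
        have h3 := Nat.mul_le_mul_left C ht'
        rw [zero_add] at h2
        exact ⟨by omega, (le_majorant _ _).trans (majorant_mono _ hk)⟩)
      hpath hc (.refl _) (by omega) s hs.1 hs.2
  obtain ⟨t', s', ht', hr, hs'⟩ := hrun
  obtain ⟨c', hb, hl', hv⟩ := hr.bPath (acc := fun v => M.accept v.2.1)
  refine ⟨⟨_, c', hb.path, hl', ?_, ?_⟩, fun t₁ c₁ q q' hp₁ hl₁ hi₁ =>
    -- The bound on query parameters is needed at every reachable configuration; determinism places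
    -- these on the one halting path, where it is built into `BPath`.
    (hb.compat hl' hp₁ (.inl List.prefix_rfl)).2.2.2 q q' hl₁ hi₁⟩
  · refine le_trans ?_ (hGQ k x.length)
    have := Nat.mul_le_mul_right
      (D₁ k x.length + 3 * (D₂ k x.length + C * (g k * P.eval x.length)) + 3) ht
    simp only [id]
    omega
  · rw [← hacc]
    change M.accept c'.var.2.1 = true ↔ _
    rw [hv, ← hs']
    rfl

/-! ### Queries to the counting machine -/

namespace Prog

/-- Ask the query for the string on `Y` (in reverse), the parameter on `C`, the factor on `A`, and
the threshold that consists of the ones on `I`, a zero, and the simulated answer. -/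
def askCounter (m₁ m₂ m₃ : Bool) : Prog M :=
  .seq (.scan (.ex .Y) [(.io .queryInput, id)]) <|
  .seq (.pushes [(.io .queryInput, fun _ => false)]) <|
  .seq (.scan (.ex .I) [(.io .queryInput, fun _ => true), (.io .queryInput, fun _ => true)]) <|
  .seq (.pushes [(.io .queryInput, fun _ => false), (.io .queryInput, fun _ => true)]) <|
  .seq (.scan (.sim .answer) [(.io .queryInput, id), (.io .queryInput, fun _ => true)]) <|
  .seq (.pushes [(.io .queryInput, fun _ => false)]) <|
  .seq (.scan (.ex .A) [(.io .queryInput, fun _ => true), (.io .queryParam, fun _ => true)]) <|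
  .seq (.scan (.ex .C) [(.io .queryParam, fun _ => true)]) <|
  .seq (.pushes [(.io .queryInput, fun _ => m₃), (.io .queryInput, fun _ => m₂),
    (.io .queryInput, fun _ => m₁)]) .query

/-- Ask a query and read the first symbol of the answer. -/
def testCounter (m₁ m₂ m₃ : Bool) : Prog M := .seq (askCounter m₁ m₂ m₃) (.pop (.io .answer))

/-- Increment the number on the stack `n` until the query is answered by zero. -/
def grow (n : Stk) (m₁ m₂ m₃ : Bool) : Prog M :=
  .seq (testCounter m₁ m₂ m₃) <| .loop (fun v => v.2.2.r.isSome) <|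
    .seq (.push n fun _ => true) <| .seq (.clear (.io .answer)) (testCounter m₁ m₂ m₃)

/-- Move the query of the simulated machine to auxiliary stacks. -/
def startAnswer : Prog M :=
  .seq (.each (.sim .queryInput) (.pushes [(.ex .Y, id)])) <|
  .seq (.each (.sim .queryParam) (.pushes [(.ex .C, fun _ => true)])) <|
  .clear (.sim .answer)

/-- Empty the auxiliary stacks. -/
def finishAnswer : Prog M :=
  .seq (.clear (.ex .Y)) <| .seq (.clear (.ex .C)) (.clear (.ex .A))

end Prog

/-- The threshold of a query. -/
def threshold (i : ℕ) (u : List Bool) : List Bool := List.replicate i true ++ false :: u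

/-- The query string is built from its end. Its ingredients are only scanned, so the same data can
be queried again with different modes, factor or threshold. -/
theorem Tri.askCounter {s : State M} {m₁ m₂ m₃ : Bool} {y u : List Bool} {k a i : ℕ}
    (hY : s.st (.ex .Y) = y.reverse) (hC : s.st (.ex .C) = List.replicate k true)
    (hA : s.st (.ex .A) = List.replicate a true) (hI : s.st (.ex .I) = List.replicate i true)
    (hu : s.st (.sim .answer) = u) (hT : s.st (.ex .T) = [])
    (hqI : s.st (.io .queryInput) = []) (hqP : s.st (.io .queryParam) = []) (hH : k + a ≤ H) :
    Tri O H (.askCounter m₁ m₂ m₃) s [] (10 * (y.length + k + a + i + u.length) + 32)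
      (· = (s.set (.io .answer)
        (O (queryString m₁ m₂ m₃ a (threshold i u) y, k + a)).bits).setR none) := by
  subst hu
  -- On the leading ones of the threshold, the marker bit and the letter are both 1, so constants
  -- may be pushed.
  have e1 : List.flatMap (fun _ => [true, true]) (List.replicate i true) =
      List.flatMap (fun b => [true, b]) (List.replicate i true) := by
    refine List.flatMap_congr fun b hb => ?_
    rw [List.eq_of_mem_replicate hb]
  refine (Tri.seq_eq (Tri.scan (by simp) (by simp) (by simp) _ hT) <|
    Tri.seq_eq (Tri.pushes _ _) <|
    Tri.seq_eq (Tri.scan (by simp) (by simp) (by simp) _ ?_) <|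
    Tri.seq_eq (Tri.pushes _ _) <|
    Tri.seq_eq (Tri.scan (by simp) (by simp) (by simp) _ ?_) <|
    Tri.seq_eq (Tri.pushes _ _) <|
    Tri.seq_eq (Tri.scan (by simp) (by simp) (by simp) _ ?_) <|
    Tri.seq_eq (Tri.scan (by simp) (by simp) (by simp) _ ?_) <|
    Tri.seq_eq (Tri.pushes _ _) <| Tri.query ?_).mono ?_ ?_
  · simp [State.setR, State.setReg, State.spill, contrib, hT, flatMap_nil]
  · simp [State.setR, State.setReg, State.spill, contrib, hT, flatMap_nil]
  · simp [State.setR, State.setReg, State.spill, contrib, hT, flatMap_nil]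
  · simp [State.setR, State.setReg, State.spill, contrib, hT, flatMap_nil]
  · simp [State.setR, State.setReg, State.spill, contrib, flatMap_nil, flatMap_const, hC, hA, hqP]
    omega
  · simp [State.setR, State.setReg, State.spill, contrib, flatMap_nil, hC, hA, hI, hY]
    omega
  rintro _ rfl
  refine State.ext rfl (funext fun m => ?_) rfl
  rcases m with p | p | p <;> cases p <;>
    simp [State.setR, State.setReg, State.set, State.spill, State.ask, contrib, flatMap_nil,
      flatMap_const, hC, hA, hI, hY, hqI, hqP, hT, queryString, threshold, encString,
      e1]

/-- The intermediate states of answering the simulated query of the state `s`. -/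
def State.Ready (s : State M) (a i : ℕ) (u : List Bool) (s' : State M) : Prop :=
  ∃ ρ, s' = {
    ctl := (s.ctl.1, s.ctl.2.1, ρ)
    st := fun
      | .sim .queryInput => []
      | .sim .queryParam => []
      | .sim .answer => u
      | .ex .Y => (s.st (.sim .queryInput)).reverse
      | .ex .C => List.replicate (s.st (.sim .queryParam)).length true
      | .ex .A => List.replicate a true
      | .ex .I => List.replicate i true
      | .sim p => s.st (.sim p)
      | _ => []
    wk := s.wk }

section

variable {s s' : State M} {a i : ℕ} {u : List Bool}

theorem State.Ready.setReg (h : s.Ready a i u s') (ρ : Reg) : s.Ready a i u (s'.setReg ρ) := by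
  obtain ⟨ρ', rfl⟩ := h
  exact ⟨ρ, rfl⟩

theorem State.Ready.setA (h : s.Ready a i u s') (b : ℕ) :
    s.Ready b i u (s'.set (.ex .A) (List.replicate b true)) := by
  obtain ⟨ρ', rfl⟩ := h
  refine ⟨ρ', State.ext rfl (funext fun m => ?_) rfl⟩
  rcases m with p | p | p <;> cases p <;> simp [State.set]

theorem State.Ready.setI (h : s.Ready a i u s') (j : ℕ) :
    s.Ready a j u (s'.set (.ex .I) (List.replicate j true)) := by
  obtain ⟨ρ', rfl⟩ := h
  refine ⟨ρ', State.ext rfl (funext fun m => ?_) rfl⟩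
  rcases m with p | p | p <;> cases p <;> simp [State.set]

theorem State.Ready.setAnswer (h : s.Ready a i u s') (v : List Bool) :
    s.Ready a i v (s'.set (.sim .answer) v) := by
  obtain ⟨ρ', rfl⟩ := h
  refine ⟨ρ', State.ext rfl (funext fun m => ?_) rfl⟩
  rcases m with p | p | p <;> cases p <;> simp [State.set]

theorem State.Ready.pushA (h : s.Ready a i u s') :
    s.Ready (a + 1) i u (s'.set (.ex .A) (true :: s'.st (.ex .A))) := by
  have := h.setA (a + 1)
  obtain ⟨ρ', rfl⟩ := h
  exact this

theorem State.Ready.pushI (h : s.Ready a i u s') :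
    s.Ready a (i + 1) u (s'.set (.ex .I) (true :: s'.st (.ex .I))) := by
  have := h.setI (i + 1)
  obtain ⟨ρ', rfl⟩ := h
  exact this

theorem State.Ready.answer (h : s.Ready a i u s') : s'.st (.io .answer) = [] := by
  obtain ⟨ρ', rfl⟩ := h
  rfl

/-- The query of the simulated machine. -/
def State.simQuery (s : State M) : List Bool × ℕ :=
  (s.st (.sim .queryInput), (s.st (.sim .queryParam)).length)

theorem Tri.startAnswer (hs : s.Clean) :
    Tri O H .startAnswer s [] (4 * s.simQuery.1.length + 4 * s.simQuery.2 +
      3 * (s.st (.sim .answer)).length + 6) (s.Ready 0 0 []) := by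
  refine (Tri.seq_eq (Tri.each_pushes (by simp) _) <| Tri.seq_eq (Tri.each_pushes (by simp) _) <|
    Tri.clear _ _).mono ?_ ?_
  · simp [State.setR, State.setReg, State.set, State.spill, contrib, State.simQuery, flatMap_nil]
    omega
  · rintro _ rfl
    refine ⟨_, State.ext rfl (funext fun m => ?_) rfl⟩
    rcases m with p | p | p <;> cases p <;>
      simp [State.setR, State.setReg, State.set, State.spill, contrib, flatMap_nil, flatMap_const,
        hs.1, hs.2]

theorem Tri.finishAnswer {O' : ParamFun} (h : s.Ready a 0 (O s.simQuery).bits s')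
    (hs : s.Clean) :
    Tri O' H .finishAnswer s' [] (3 * s.simQuery.1.length + 3 * s.simQuery.2 + 3 * a + 6)
      (fun s' => ∃ ρ, s' = s.simAnswer O ρ) := by
  obtain ⟨ρ', rfl⟩ := h
  refine (Tri.seq_eq (Tri.clear _ _) <| Tri.seq_eq (Tri.clear _ _) <| Tri.clear _ _).mono ?_ ?_
  · simp [State.setR, State.setReg, State.set, State.simQuery]
    omega
  · rintro _ rfl
    refine ⟨_, State.ext rfl (funext fun m => ?_) rfl⟩
    rcases m with p | p | p <;> cases p <;>
      simp [State.setR, State.setReg, State.set, State.simAnswer, State.simQuery, hs.1, hs.2]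

theorem Tri.askReady {m₁ m₂ m₃ : Bool} (h : s.Ready a i u s') (hH : s.simQuery.2 + a ≤ H) :
    Tri O H (.askCounter m₁ m₂ m₃) s' []
      (10 * (s.simQuery.1.length + s.simQuery.2 + a + i + u.length) + 32)
      (fun s'' => ∃ s₁, s.Ready a i u s₁ ∧ s'' = s₁.set (.io .answer)
        (O (queryString m₁ m₂ m₃ a (threshold i u) s.simQuery.1, s.simQuery.2 + a)).bits) := by
  have h' := h.setReg { s'.reg with r := none }
  obtain ⟨ρ', rfl⟩ := h
  refine (Tri.askCounter (y := s.simQuery.1) (k := s.simQuery.2) (a := a) (i := i) (u := u)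
    rfl rfl rfl rfl rfl rfl rfl rfl hH).mono le_rfl ?_
  rintro _ rfl
  exact ⟨_, h', rfl⟩

theorem Tri.testCounter {m₁ m₂ m₃ : Bool} (h : s.Ready a i u s') (hH : s.simQuery.2 + a ≤ H) :
    Tri O H (.testCounter m₁ m₂ m₃) s' []
      (10 * (s.simQuery.1.length + s.simQuery.2 + a + i + u.length) + 33)
      (fun s'' => ∃ s₁ l, s.Ready a i u s₁ ∧
        l = (O (queryString m₁ m₂ m₃ a (threshold i u) s.simQuery.1, s.simQuery.2 + a)).bits ∧
        s'' = (s₁.set (.io .answer) l.tail).setR l.head?) := by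
  refine ((Tri.askReady h hH).seq (T' := 1) fun s'' hs'' => ?_).time (by omega)
  obtain ⟨s₁, h₁, rfl⟩ := hs''
  refine (Tri.pop _).mono le_rfl ?_
  rintro _ rfl
  exact ⟨s₁, _, h₁, rfl, by rw [State.set_set]; simp⟩

theorem bits_eq_nil {n : ℕ} : n.bits = [] ↔ n = 0 := by
  rw [← List.length_eq_zero_iff, Nat.size_eq_bits_len, Nat.size_eq_zero]

/-- A linear search for a zero of `v`. Zero has the empty binary expansion, so popping one symbol of
the answer decides whether `v j = 0`. The bound `N` enters only the analysis; the program does not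
know it. -/
theorem Tri.grow {m₁ m₂ m₃ : Bool} {n : Stk} (hn : n ≠ .io .answer) {R : ℕ → State M → Prop}
    {v : ℕ → ℕ} {N W B : ℕ} (hreg : ∀ j s ρ, R j s → R j (s.setReg ρ))
    (hpush : ∀ j s, R j s → R (j + 1) (s.set n (true :: s.st n)))
    (hans : ∀ j s, R j s → s.st (.io .answer) = [])
    (htest : ∀ j s, j ≤ N → R j s → Tri O H (.testCounter m₁ m₂ m₃) s [] W (fun s'' =>
      ∃ s₁, R j s₁ ∧ s'' = (s₁.set (.io .answer) (v j).bits.tail).setR (v j).bits.head?))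
    (hB : ∀ j ≤ N, (v j).bits.length ≤ B) (hN : v N = 0) {s : State M} (hs : R 0 s) :
    Tri O H (.grow n m₁ m₂ m₃) s [] ((N + 1) * (W + 3 * B + 4) + 1)
      (fun s' => ∃ j ≤ N, v j = 0 ∧ R j s') := by
  suffices h : ∀ d j s, j + d = N → R j s → Tri O H (.loop (fun v => v.2.2.r.isSome) <|
      .seq (.push n fun _ => true) <| .seq (.clear (.io .answer)) (.testCounter m₁ m₂ m₃))
      ((s.set (.io .answer) (v j).bits.tail).setR (v j).bits.head?) []
      (d * (W + 3 * B + 4) + 1) (fun s' => ∃ j ≤ N, v j = 0 ∧ R j s') by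
    refine ((htest 0 s (Nat.zero_le _) hs).seq (T' := N * (W + 3 * B + 4) + 1) ?_).time
      (by rw [Nat.add_mul N 1]; omega)
    rintro _ ⟨s₁, h₁, rfl⟩
    exact h N 0 s₁ (by omega) h₁
  have hexit : ∀ j s, j ≤ N → R j s → v j = 0 →
      Tri O H (.loop (fun v => v.2.2.r.isSome) <|
      .seq (.push n fun _ => true) <| .seq (.clear (.io .answer)) (.testCounter m₁ m₂ m₃))
      ((s.set (.io .answer) (v j).bits.tail).setR (v j).bits.head?) [] 1
      (fun s' => ∃ j ≤ N, v j = 0 ∧ R j s') := by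
    intro j s hj hs hv
    have hb : (v j).bits = [] := bits_eq_nil.2 hv
    rw [hb]
    refine (Tri.whileFalse (by simp [State.setR, State.setReg])).mono le_rfl ?_
    rintro _ rfl
    refine ⟨j, hj, hv, hreg _ _ _ ?_⟩
    rw [List.tail_nil, ← hans j s hs, State.set_self]
    exact hs
  intro d
  induction d with
  | zero =>
    intro j s hj hs
    obtain rfl : j = N := by omega
    exact (hexit j s le_rfl hs hN).time (by omega)
  | succ d ih =>
    intro j s hj hs
    by_cases hv : v j = 0
    · exact (hexit j s (by omega) hs hv).time (by omega)
    · obtain ⟨b, l, hb⟩ := List.exists_cons_of_ne_nil (mt bits_eq_nil.1 hv)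
      have hl : l.length + 1 ≤ B := by simpa [hb] using hB j (by omega)
      have e := hans j s hs
      have e1 : ((((s.set (.io .answer) l).setR (some b)).set n (true :: s.st n)).set
          (.io .answer) []).setR none = (s.set n (true :: s.st n)).setReg { s.reg with r := none } := by
        refine State.ext rfl (funext fun m => ?_) rfl
        simp only [State.setR, State.setReg, State.set, Function.update_apply]
        split_ifs <;> simp_all
      have e2 : ((s.set (.io .answer) l).setR (some b)).st n = s.st n :=
        State.set_st_of_ne s hn l
      have h1 : Tri O H (.push n fun _ => true) ((s.set (.io .answer) l).setR (some b)) [] 1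
          (· = ((s.set (.io .answer) l).setR (some b)).set n (true :: s.st n)) := by
        have := Tri.push (O := O) (H := H) (s := (s.set (.io .answer) l).setR (some b)) n
          fun _ => true
        rwa [e2] at this
      have h2 : Tri O H (.clear (.io .answer))
          (((s.set (.io .answer) l).setR (some b)).set n (true :: s.st n)) [] (3 * l.length + 2)
          (· = (s.set n (true :: s.st n)).setReg { s.reg with r := none }) := by
        have := Tri.clear (O := O) (H := H) (.io .answer)
          (((s.set (.io .answer) l).setR (some b)).set n (true :: s.st n))
        rw [e1, State.set_st_of_ne _ hn.symm] at this
        simpa [State.setR, State.setReg] using this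
      have h3 := htest (j + 1) _ (by omega) (hreg _ _ { s.reg with r := none } (hpush j s hs))
      rw [hb]
      refine (Tri.whileTrue rfl (h1.seq_eq (h2.seq_eq h3))
        (T' := d * (W + 3 * B + 4) + 1) ?_).time (by rw [Nat.add_mul d 1]; omega)
      rintro _ ⟨s₁, h₁, rfl⟩
      exact ih (j + 1) s₁ (by omega) h₁

end

/-! ### Binary numbers -/

theorem val_bits (n : ℕ) : val n.bits = n := by
  induction n using Nat.binaryRec' with
  | zero => simp [val]
  | bit b n h ih => rw [Nat.bits_append_bit n b h, val, ih, Nat.bit_val]; ring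

theorem val_threshold (i : ℕ) (u : List Bool) :
    val (threshold i u) = 2 ^ i - 1 + 2 ^ (i + 1) * val u := by
  induction i with
  | zero => simp [threshold, val]
  | succ i ih =>
    have h : threshold (i + 1) u = true :: threshold i u := rfl
    have := Nat.one_le_two_pow (n := i)
    have h' : 2 ^ (i + 1) - 1 = 1 + 2 * (2 ^ i - 1) := by rw [pow_succ]; omega
    rw [h, val, ih, h', pow_succ 2 (i + 1), Bool.toNat_true]
    ring

theorem length_bits_le {n m : ℕ} (h : n < 2 ^ m) : n.bits.length ≤ m := by
  rw [Nat.size_eq_bits_len]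
  exact Nat.size_le.2 h

theorem bits_ite (p : Prop) [Decidable p] :
    (if p then 1 else 0 : ℕ).bits = if p then [true] else [] := by
  split_ifs <;> simp

theorem bits_two_mul (n : ℕ) : (2 * n).bits = if n = 0 then [] else false :: n.bits := by
  split_ifs with h
  · simp [h]
  · rw [← Nat.bit_false_apply, Nat.bits_append_bit n false (fun h' => absurd h' h)]

theorem bits_two_mul_add_one (n : ℕ) : (2 * n + 1).bits = true :: n.bits := by
  rw [← Nat.bit_true_apply, Nat.bits_append_bit n true (fun _ => rfl)]

/-- If the digits of `F` above position `i` are known, the threshold has these digits, a 0 at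
position `i` and ones below: it is the largest number with these high digits and digit 0 at `i`. So
`F` exceeds it exactly if its digit at `i` is 1. -/
theorem threshold_lt_iff (F i : ℕ) :
    val (threshold i (F / 2 ^ (i + 1)).bits) < F ↔ F / 2 ^ i = 2 * (F / 2 ^ (i + 1)) + 1 := by
  have h1 : F / 2 ^ (i + 1) = F / 2 ^ i / 2 := by rw [pow_succ, Nat.div_div_eq_div_mul]
  have h2 := Nat.div_add_mod F (2 ^ i)
  have h3 := Nat.mod_lt F (Nat.two_pow_pos i)
  have h4 : 2 ^ (i + 1) * (F / 2 ^ i / 2) = 2 ^ i * (2 * (F / 2 ^ i / 2)) := by ring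
  rw [val_threshold, val_bits, h1, h4]
  rcases Nat.mod_two_eq_zero_or_one (F / 2 ^ i) with h | h
  · have h5 : 2 * (F / 2 ^ i / 2) = F / 2 ^ i := by omega
    rw [h5]
    omega
  · have h5 : F / 2 ^ i = 2 * (F / 2 ^ i / 2) + 1 := by omega
    have h6 : 2 ^ i * (F / 2 ^ i) = 2 ^ i * (2 * (F / 2 ^ i / 2)) + 2 ^ i := by
      conv_lhs => rw [h5]
      ring
    omega

/-! ### Counting by means of majority queries -/

namespace Prog

/-- Compute the next bit of the number of accepting paths. -/
def nextBit : Prog M :=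
  .seq (testCounter true false true) <|
  .ite (fun v => v.2.2.r.isSome)
    (.seq (.push (.sim .answer) fun _ => true) (.clear (.io .answer))) <|
    .seq (.pop (.sim .answer)) <|
    .ite (fun v => v.2.2.r.isSome)
      (.seq (.push (.sim .answer) fun ρ => ρ.r.getD false) (.push (.sim .answer) fun _ => false))
      (.load id)

/-- Compute the number of accepting paths for the simulated query by majority queries. -/
def answerCount : Prog M :=
  .seq startAnswer <| .seq (grow (.ex .A) true true false) <|
  .seq (grow (.ex .I) true false true) <| .seq (.each (.ex .I) nextBit) finishAnswer

end Prog

section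

variable {s s' : State M} {a i : ℕ} {u : List Bool}

theorem Tri.nextBit {F : ℕ} (h : s.Ready a i (F / 2 ^ (i + 1)).bits s') (hH : s.simQuery.2 + a ≤ H)
    (hO : O (queryString true false true a (threshold i (F / 2 ^ (i + 1)).bits) s.simQuery.1,
        s.simQuery.2 + a) = if val (threshold i (F / 2 ^ (i + 1)).bits) < F then 1 else 0) :
    Tri O H .nextBit s' []
      (10 * (s.simQuery.1.length + s.simQuery.2 + a + i + (F / 2 ^ (i + 1)).bits.length) + 38)
      (s.Ready a i (F / 2 ^ i).bits) := by
  refine ((Tri.testCounter h hH).seq (T' := 5) fun s'' hs'' => ?_).time (by omega)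
  obtain ⟨s₁, l, h₁, rfl, rfl⟩ := hs''
  rw [hO, bits_ite]
  have h2 : F / 2 ^ i = 2 * (F / 2 ^ (i + 1)) ∨ F / 2 ^ i = 2 * (F / 2 ^ (i + 1)) + 1 := by
    rw [pow_succ, ← Nat.div_div_eq_div_mul]; omega
  simp only [threshold_lt_iff]
  split_ifs with hb
  · rw [hb, bits_two_mul_add_one]
    refine (Tri.iteTrue rfl (Tri.seq_eq (Tri.push _ _) (Tri.clear _ _))).mono ?_ ?_
    · simp [State.setR, State.setReg, State.set]
    · rintro _ rfl
      obtain ⟨ρ', rfl⟩ := h₁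
      refine ⟨_, State.ext rfl (funext fun m => ?_) rfl⟩
      rcases m with p | p | p <;> cases p <;> simp [State.setR, State.setReg, State.set]
  -- A digit 0 is appended only to a nonzero number, since `Nat.bits` has no leading zeros; the
  -- program pops a symbol to find out.
  · rw [h2.resolve_right hb, bits_two_mul]
    generalize F / 2 ^ (i + 1) = G at *
    obtain ⟨ρ', rfl⟩ := h₁
    split_ifs with hG
    · subst hG
      refine (Tri.iteFalse rfl (Tri.seq_eq (Tri.pop _) (Tri.iteFalse ?_ (Tri.load id)))).mono
        (by omega) ?_
      · simp [State.setR, State.setReg, State.set]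
      · rintro _ rfl
        refine ⟨_, State.ext rfl (funext fun m => ?_) rfl⟩
        rcases m with p | p | p <;> cases p <;>
          simp [State.setR, State.setReg, State.set, State.setCtl]
    · obtain ⟨b, l, hbl⟩ := List.exists_cons_of_ne_nil (mt bits_eq_nil.1 hG)
      rw [hbl]
      refine (Tri.iteFalse rfl (Tri.seq_eq (Tri.pop _) (Tri.iteTrue ?_
        (Tri.seq_eq (Tri.push _ _) (Tri.push _ _))))).mono (by omega) ?_
      · simp [State.setR, State.setReg, State.set]
      · rintro _ rfl
        refine ⟨_, State.ext rfl (funext fun m => ?_) rfl⟩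
        rcases m with p | p | p <;> cases p <;>
          simp [State.setR, State.setReg, State.set, State.reg]

end

theorem log_le_length (n : ℕ) : Nat.log 2 (n + 2) ≤ n + 1 := by
  have := Nat.log_lt_self 2 (x := n + 2) (by omega)
  omega

section

variable {M₀ : Machine} {f : ℕ → ℕ}

theorem Machine.count_eq_zero_of_bound {x : List Bool} {k : ℕ} {m₃ : Bool} {b : ℕ}
    (h : ∀ w t c, M₀.FreePath (M₀.init x k) w t c → w.length ≤ b) :
    M₀.count x k true m₃ b = 0 := by
  by_contra hc
  obtain ⟨w, t, c, hp, hw⟩ := Machine.exists_path_of_count_ne_zero hc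
  have := h w t c hp
  omega

/-- A bound of the time in which queries are answered. -/
def answerTime (f : ℕ → ℕ) (k n : ℕ) : ℕ :=
  (f k + 2 * (f k * (n + 1)) + 10) * (10 * (n + k + f k + 2 * (f k * (n + 1))) + 200)

theorem answerTime_isFpt (hf : Computable f) : IsFpt (answerTime f) := by
  have h1 : IsFpt fun k n => f k * (n + 1) := (IsFpt.param hf).mul (IsFpt.length.add (.const 1))
  have h2 : IsFpt fun k _ => k := IsFpt.param Computable.id
  exact (((IsFpt.param hf).add ((IsFpt.const 2).mul h1)).add (.const 10)).mul (((IsFpt.const 10).mul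
    (((IsFpt.length.add h2).add (IsFpt.param hf)).add ((IsFpt.const 2).mul h1))).add (.const 200))

/-- At most f(k) + 1 queries fix the factor `a`, at most S + 2 find an `i` with F < 2^i for the
value F sought, and one per position then determines the digits of F from the top. Here S = f(k)(n +
1) bounds the number of choices, n being the length of the queried string. -/
theorem answers_answerCount (hM : M₀.OracleFree)
    (hf : ∀ x k w t c, M₀.FreePath (M₀.init x k) w t c →
      w.length ≤ f k * Nat.log 2 (x.length + 2)) {O' : ParamFun}
    (hO' : ∀ m₂ m₃ a z x k, O' (queryString true m₂ m₃ a z x, k + a) =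
      if val z < M₀.count x k m₂ m₃ (a * Nat.log 2 (x.length + 2)) then 1 else 0)
    (hO : ∀ x k, O (x, k) = M₀.numAcc x k) :
    Answers O O' (.answerCount (M := M)) (answerTime f) (fun k => k + f k) := by
  intro s H hs hH
  change s.simQuery.2 + f s.simQuery.2 ≤ H at hH
  change Tri O' H _ s [] (answerTime f s.simQuery.2 s.simQuery.1.length + _) _
  have hq := hO s.simQuery.1 s.simQuery.2
  have hfin := @Tri.finishAnswer M O H s
  have hstart := Tri.startAnswer (O := O') (H := H) hs
  generalize hx : s.simQuery.1 = x at *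
  generalize hk : s.simQuery.2 = k at *
  have hlog := log_le_length x.length
  set S := f k * (x.length + 1) with hS
  set V := 10 * (x.length + k + f k + 2 * S) + 100 with hV
  have hlen : ∀ a ≤ f k, a * Nat.log 2 (x.length + 2) ≤ S := fun a ha => Nat.mul_le_mul ha hlog
  -- The threshold with `i = 0` and no further digits is 0, so this query asks whether some word
  -- runs out of choices.
  have hgrowA : ∀ s₀, s.Ready 0 0 [] s₀ → Tri O' H (.grow (.ex .A) true true false) s₀ []
      ((f k + 1) * (V + 3 * 1 + 4) + 1) (fun s' => ∃ a ≤ f k,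
        (if 0 < M₀.count x k true false (a * Nat.log 2 (x.length + 2)) then 1 else 0) = 0 ∧
        s.Ready a 0 [] s') := fun s₀ h₀ => by
    refine Tri.grow (by simp) (R := fun a => s.Ready a 0 [])
      (v := fun a => if 0 < M₀.count x k true false (a * Nat.log 2 (x.length + 2)) then 1 else 0)
      (N := f k) (W := V) (B := 1) (fun a s' ρ h => h.setReg ρ) (fun a s' h => h.pushA) (fun a s' h => h.answer)
      (fun a s' ha h => ?_) (fun a ha => ?_) ?_ h₀
    · refine (Tri.testCounter h (by omega)).mono ?_ ?_
      · simp only [hx, hk, List.length_nil]; omega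
      · rintro _ ⟨s₁, l, h₁, rfl, rfl⟩
        refine ⟨s₁, h₁, ?_⟩
        rw [hx, hk, hO', val_threshold]
        rfl
    · rw [bits_ite]; split_ifs <;> simp
    · rw [if_neg]
      rw [Machine.count_eq_zero_of_bound (hf x k)]
      exact lt_irrefl 0
  refine (hstart.seq fun s₀ h₀ => (hgrowA s₀ h₀).seq (T' :=
    ((S + 1 + 1) * (V + 3 * 1 + 4) + 1) + (((V + 2) * (S + 1) + 2) +
      (3 * x.length + 3 * k + 3 * f k + 6))) fun s₁ h₁ => ?_).time ?_
  · obtain ⟨a, ha, h0, h₁⟩ := h₁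
    have hc : M₀.count x k true false (a * Nat.log 2 (x.length + 2)) = 0 := by
      by_contra hne
      rw [if_pos (Nat.pos_of_ne_zero hne)] at h0
      exact one_ne_zero h0
    have hF := Machine.count_numAcc hM fun w t c hp => Machine.length_le_of_count_eq_zero hc hp
    rw [← hq] at hF
    have hFS : O (x, k) < 2 ^ (S + 1) := by
      rw [← hF]
      exact (Machine.count_le _ _).trans_lt (Nat.pow_lt_pow_right (by norm_num)
        (Nat.lt_succ_of_le (hlen a ha)))
    have hb : ∀ i, (O (x, k) / 2 ^ i).bits.length ≤ S + 1 := fun i =>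
      length_bits_le ((Nat.div_le_self _ _).trans_lt hFS)
    -- With no digits known, the threshold is 2^i - 1, and a negative answer means F < 2^i.
    have hgrowI : Tri O' H (.grow (.ex .I) true false true) s₁ []
        ((S + 1 + 1) * (V + 3 * 1 + 4) + 1) (fun s' => ∃ i ≤ S + 1,
          (if 2 ^ i - 1 < O (x, k) then 1 else 0) = 0 ∧ s.Ready a i [] s') := by
      refine Tri.grow (by simp) (R := fun i => s.Ready a i [])
        (v := fun i => if 2 ^ i - 1 < O (x, k) then 1 else 0)
        (N := S + 1) (W := V) (B := 1) (fun a s' ρ h => h.setReg ρ) (fun a s' h => h.pushI) (fun a s' h => h.answer)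
        (fun i s' hi h => ?_) (fun a ha => ?_) ?_ h₁
      · refine (Tri.testCounter h (by omega)).mono ?_ ?_
        · simp only [hx, hk, List.length_nil]; omega
        · rintro _ ⟨s₁, l, h₁, rfl, rfl⟩
          refine ⟨s₁, h₁, ?_⟩
          rw [hx, hk, hO', val_threshold, hF]
          rfl
      · rw [bits_ite]; split_ifs <;> simp
      · rw [if_neg (by omega)]
    refine hgrowI.seq fun s₂ h₂ => ?_
    obtain ⟨i, hi, h0, h₂⟩ := h₂
    have hFi : O (x, k) / 2 ^ i = 0 := by
      refine Nat.div_eq_of_lt ?_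
      by_contra hne
      have := Nat.one_le_two_pow (n := i)
      rw [if_pos (by omega)] at h0
      exact one_ne_zero h0
    have hloop : Tri O' H (.each (.ex .I) .nextBit) s₂ [] ((V + 2) * (S + 1) + 2)
        (s.Ready a 0 (O (x, k)).bits) := by
      -- When `l` remains on `I`, the simulated answer holds the digits of F from position
      -- `l.length` upwards.
      refine (Tri.each (T := V) (l := List.replicate i true) (P := fun l s' =>
        l = List.replicate l.length true ∧ l.length ≤ S + 1 ∧
          s.Ready a l.length (O (x, k) / 2 ^ l.length).bits s') ?_ ?_ ?_).mono ?_ ?_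
      · rintro l _ ⟨hl, -, ρ, rfl⟩
        exact hl.symm
      · rintro b l s' ⟨hl, hlS, hr⟩
        have hl' : l = List.replicate l.length true := (List.cons.inj hl).2
        have hr' := (hr.setI l.length).setReg { s'.reg with r := some b }
        rw [← hl'] at hr'
        rw [List.length_cons] at hr' hlS
        have := hb (l.length + 1)
        refine (Tri.nextBit hr' (by omega) ?_).mono ?_ ?_
        · rw [hx, hk, hO', hF]
        · rw [hx, hk]
          omega
        · exact fun s'' h => ⟨hl', by omega, h⟩
      · simpa [hFi] using ⟨hi, h₂⟩
      · rw [List.length_replicate]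
        exact Nat.add_le_add_right (Nat.mul_le_mul_left _ hi) _
      · rintro _ ⟨s₃, ⟨-, -, h₃⟩, rfl⟩
        simp only [List.length_nil, pow_zero, Nat.div_one] at h₃
        exact h₃.setReg { s₃.reg with r := none }
    refine hloop.seq fun s₃ h₃ => ?_
    rw [← show s.simQuery = (x, k) from Prod.ext hx hk] at h₃
    exact (hfin h₃ hs).time (by omega)
  · change _ ≤ (f k + 2 * S + 10) * (10 * (x.length + k + f k + 2 * S) + 200) + _
    rw [show 10 * (x.length + k + f k + 2 * S) + 200 = V + 100 by omega]
    have e : (f k + 2 * S + 10) * (V + 100) = (f k + 1) * (V + 3 * 1 + 4) +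
      (S + 1 + 1) * (V + 3 * 1 + 4) + (V + 2) * (S + 1) + 6 * V + 93 * f k + 191 * S + 977 := by
      ring
    omega

end

/-! ### Majority by means of counting queries -/

namespace Prog

/-- Compare twice the number of accepted words with the number of all words. -/
def decideMajority : Prog M :=
  .seq (askCounter false false false) <|
  .seq (.each (.io .answer) (.pushes [(.ex .U, id)])) <|
  .seq (.each (.ex .U) (.pushes [(.ex .Z, id)])) <|
  .seq (.push (.ex .Z) fun _ => false) <|
  .seq (askCounter true true false) <|
  .seq (compare (.io .answer) (.ex .Z)) <|
  .ite (fun v => v.2.2.fl) (.load id) (.push (.sim .answer) fun _ => true)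

/-- Decide by counting queries whether most paths are accepting for the simulated query. -/
def answerMajority : Prog M :=
  .seq startAnswer <| .seq (grow (.ex .A) false true false) <| .seq decideMajority finishAnswer

end Prog

section

variable {s s' : State M} {a : ℕ}

/-- The two moves through `U` keep the order of the digits of `c`, and the 0 pushed in front doubles
it. A tie `2 * c = j` gives the answer 0, in accordance with the strict majority. -/
theorem Tri.decideMajority {c j B : ℕ} (h : s.Ready a 0 [] s') (hH : s.simQuery.2 + a ≤ H)
    (hc : O (queryString false false false a (threshold 0 []) s.simQuery.1, s.simQuery.2 + a) = c)
    (hj : O (queryString true true false a (threshold 0 []) s.simQuery.1, s.simQuery.2 + a) = j)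
    (hcB : c.bits.length ≤ B) (hjB : j.bits.length ≤ B) :
    Tri O H .decideMajority s' []
      (20 * (s.simQuery.1.length + s.simQuery.2 + a) + 20 * B + 90)
      (s.Ready a 0 (if j < 2 * c then [true] else [])) := by
  refine ((Tri.askReady h hH).seq (T' := (4 * B + 2) + ((4 * B + 2) + (1 +
    ((10 * (s.simQuery.1.length + s.simQuery.2 + a) + 32) +
    ((5 * B + 3 * (B + 1) + 5) + 2))))) fun s'' hs'' => ?_).time (by simp; omega)
  obtain ⟨s₁, ⟨ρ, rfl⟩, rfl⟩ := hs''
  rw [hc]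
  refine Tri.seq_eq ((Tri.each_pushes (by simp) _).time ?_) <|
    Tri.seq_eq ((Tri.each_pushes (by simp) _).time ?_) <|
    Tri.seq_eq (Tri.push _ _) <|
    Tri.seq_eq ((Tri.askCounter (y := s.simQuery.1) (k := s.simQuery.2) (a := a) (i := 0)
      (u := []) ?_ ?_ ?_ ?_ ?_ ?_ ?_ ?_ hH).time (by simp)) <|
    Tri.seq (P := fun s'' => s.Ready a 0 [] s'' ∧ s''.reg.fl = decide (2 * c ≤ j))
      ((Tri.compare (by simp) _).mono ?_ ?_) ?_
  · simpa [State.set] using hcB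
  · simpa [State.set, State.spill, State.setR, State.setReg, contrib] using hcB
  iterate 8
    simp [State.set, State.spill, State.setR, State.setReg, contrib, flatMap_nil, State.simQuery]
  · rw [hj]
    simp [State.set, State.spill, State.setR, State.setReg, contrib]
    omega
  · rw [hj]
    rintro _ ⟨g, rfl⟩
    refine ⟨⟨_, State.ext rfl (funext fun m => ?_) rfl⟩, ?_⟩
    · rcases m with p | p | p <;> cases p <;>
        simp [State.set, State.spill, State.setR, State.setReg, contrib, flatMap_nil]
    · simp [State.set, State.spill, State.setR, State.setReg, State.reg, contrib, val, val_bits,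
        flatMap_nil]
  · rintro s₂ ⟨h₂, hfl⟩
    by_cases hlt : j < 2 * c
    · rw [if_pos hlt]
      refine (Tri.iteFalse (hfl.trans (by simpa using hlt)) (Tri.push _ _)).mono le_rfl ?_
      rintro _ rfl
      have := h₂.setAnswer [true]
      obtain ⟨ρ', rfl⟩ := h₂
      exact this
    · rw [if_neg hlt]
      refine (Tri.iteTrue (hfl.trans (by simpa using hlt)) (Tri.load id)).mono le_rfl ?_
      rintro _ rfl
      exact h₂

end

section

variable {M₀ : Machine} {f : ℕ → ℕ}

theorem answers_answerMajority (hM : M₀.OracleFree)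
    (hf : ∀ x k w t c, M₀.FreePath (M₀.init x k) w t c →
      w.length ≤ f k * Nat.log 2 (x.length + 2)) {O' : ParamFun}
    (hO' : ∀ m₁ m₂ m₃ a z x k, O' (queryString m₁ m₂ m₃ a z x, k + a) =
      M₀.count x k m₂ m₃ (a * Nat.log 2 (x.length + 2)) +
        if m₁ = true then 2 ^ (a * Nat.log 2 (x.length + 2)) - val z else 0)
    (hO : ∀ x k, (O (x, k)).bits = if 1 / 2 < M₀.acceptProb x k then [true] else []) :
    Answers O O' (.answerMajority (M := M)) (answerTime f) (fun k => k + f k) := by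
  intro s H hs hH
  change s.simQuery.2 + f s.simQuery.2 ≤ H at hH
  change Tri O' H _ s [] (answerTime f s.simQuery.2 s.simQuery.1.length + _) _
  have hq := hO s.simQuery.1 s.simQuery.2
  have hfin := @Tri.finishAnswer M O H s
  have hstart := Tri.startAnswer (O := O') (H := H) hs
  generalize hx : s.simQuery.1 = x at *
  generalize hk : s.simQuery.2 = k at *
  have hlog := log_le_length x.length
  set S := f k * (x.length + 1) with hS
  set V := 10 * (x.length + k + f k + 2 * S) + 100 with hV
  have hlen : ∀ a ≤ f k, a * Nat.log 2 (x.length + 2) ≤ S := fun a ha => Nat.mul_le_mul ha hlog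
  have hb : ∀ a ≤ f k, ∀ c ≤ 2 ^ (a * Nat.log 2 (x.length + 2)), c.bits.length ≤ S + 1 :=
    fun a ha c hc => length_bits_le (hc.trans_lt (Nat.pow_lt_pow_right (by norm_num)
      (Nat.lt_succ_of_le (hlen a ha))))
  have hgrow : ∀ s₀, s.Ready 0 0 [] s₀ → Tri O' H (.grow (.ex .A) false true false) s₀ []
      ((f k + 1) * (V + 3 * (S + 1) + 4) + 1) (fun s' => ∃ a ≤ f k,
        M₀.count x k true false (a * Nat.log 2 (x.length + 2)) = 0 ∧
        s.Ready a 0 [] s') := fun s₀ h₀ => by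
    refine Tri.grow (by simp) (R := fun a => s.Ready a 0 [])
      (v := fun a => M₀.count x k true false (a * Nat.log 2 (x.length + 2)))
      (N := f k) (W := V) (B := S + 1) (fun a s' ρ h => h.setReg ρ) (fun a s' h => h.pushA)
      (fun a s' h => h.answer) (fun a s' ha h => ?_) (fun a ha => hb a ha _ (Machine.count_le _ _))
      (Machine.count_eq_zero_of_bound (hf x k)) h₀
    refine (Tri.testCounter h (by omega)).mono ?_ ?_
    · simp only [hx, hk, List.length_nil]; omega
    · rintro _ ⟨s₁, l, h₁, rfl, rfl⟩
      refine ⟨s₁, h₁, ?_⟩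
      rw [hx, hk, hO']
      rfl
  refine (hstart.seq fun s₀ h₀ => (hgrow s₀ h₀).seq (T' := (20 * (x.length + k + f k) +
    20 * (S + 1) + 90) + (3 * x.length + 3 * k + 3 * f k + 6)) fun s₁ h₁ => ?_).time ?_
  · obtain ⟨a, ha, h0, h₁⟩ := h₁
    have hC := Machine.count_acceptProb hM fun w t c hp => Machine.length_le_of_count_eq_zero h0 hp
    -- The chosen `a` provides enough choices, so the count is exactly the acceptance probability
    -- times the number of words.
    have hiff : 2 ^ (a * Nat.log 2 (x.length + 2)) <
        2 * M₀.count x k false false (a * Nat.log 2 (x.length + 2)) ↔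
        1 / 2 < M₀.acceptProb x k := by
      rw [← Nat.cast_lt (α := ℝ)]
      push_cast
      rw [hC, div_lt_iff₀' (by norm_num), ← mul_assoc, mul_comm (2 : ℝ), mul_assoc]
      exact lt_mul_iff_one_lt_right (by positivity)
    have hdec := Tri.decideMajority (O := O') (H := H) (B := S + 1)
      (c := M₀.count x k false false (a * Nat.log 2 (x.length + 2)))
      (j := 2 ^ (a * Nat.log 2 (x.length + 2))) h₁ (by omega)
      -- In the second query the count with `m₂` set is zero and so is the threshold, so the answer
      -- is exactly the number of all words.
      (by rw [hx, hk, hO']; rfl) (by rw [hx, hk, hO', h0]; simp [threshold, val])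
      (hb a ha _ (Machine.count_le _ _)) (hb a ha _ le_rfl)
    simp only [hiff, ← hq] at hdec
    refine (hdec.seq (T' := 3 * x.length + 3 * k + 3 * f k + 6) fun s₂ h₂ => ?_).time ?_
    · rw [← show s.simQuery = (x, k) from Prod.ext hx hk] at h₂
      exact (hfin h₂ hs).time (by omega)
    · rw [hx, hk]
      omega
  · change _ ≤ (f k + 2 * S + 10) * (10 * (x.length + k + f k + 2 * S) + 200) + _
    rw [show 10 * (x.length + k + f k + 2 * S) + 200 = V + 100 by omega]
    have e₁ : (f k + 2 * S + 10) * (V + 100) =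
        f k * V + 2 * (S * V) + 10 * V + 100 * f k + 200 * S + 1000 := by ring
    have e₂ : (f k + 1) * (V + 3 * (S + 1) + 4) =
        f k * V + 3 * (S * f k) + V + 7 * f k + 3 * S + 7 := by ring
    have e₃ : S * (2 * f k) ≤ S * V := Nat.mul_le_mul_left _ (by omega)
    rw [Nat.mul_left_comm] at e₃
    omega

end

/-! ### The main theorem -/

theorem fptRelFuns_subset : FPTRelFuns SharpWP ⊆ FPTRelLangs WPPFPT := by
  rintro L ⟨O, ⟨M₀, hM, hO⟩, hL⟩
  have hMr := hM
  obtain ⟨hfree, f, g, p, hf, hg, h⟩ := hM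
  have hf' : ∀ x k w t c, M₀.FreePath (M₀.init x k) w t c →
      w.length ≤ f k * Nat.log 2 (x.length + 2) := fun x k w t c hp => (h x k w t c hp).2
  -- The oracle language is the strict majority language of the counting machine itself, so its
  -- membership in the class needs only k-restrictedness.
  refine ⟨{q | 1 / 2 < (countingMachine M₀).acceptProb q.1 q.2}, ⟨countingMachine M₀,
    countingMachine_kRestricted hMr, fun x k => ⟨id, fun h => not_lt.1 h⟩⟩, ?_⟩
  -- The number of accepting paths is at most 2^(f(k) · log(n + 2)), so its binary length is at most
  -- f(k)(n + 1) + 1.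
  refine fptRel_subset (((IsFpt.param hf).mul (IsFpt.length.add (.const 1))).add (.const 1))
    (fun y k => ?_) (answerTime_isFpt hf) (Hq := fun k => k + f k)
    (Primrec.nat_add.to_comp.comp .id hf) (fun M => .answerCount) ?_
    (fun M => answers_answerCount hfree hf' (fun m₂ m₃ a z x k => ?_) hO) hL
  · rw [hO, ← Machine.count_numAcc hfree (hf' y k)]
    exact length_bits_le ((Machine.count_le _ _).trans_lt (Nat.pow_lt_pow_right (by norm_num)
      (Nat.lt_succ_of_le (Nat.mul_le_mul_left _ (log_le_length _)))))
  · intro M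
    repeat' constructor
  · rw [Set.indicator_apply]
    simp only [Set.mem_ofPred_eq, countingMachine_acceptProb hMr, Pi.one_apply]

theorem fptRelLangs_subset : FPTRelLangs WPPFPT ⊆ FPTRelFuns SharpWP := by
  rintro L ⟨A, ⟨M₀, hM, hA⟩, hL⟩
  have hMr := hM
  obtain ⟨hfree, f, g, p, hf, hg, h⟩ := hM
  have hf' : ∀ x k w t c, M₀.FreePath (M₀.init x k) w t c →
      w.length ≤ f k * Nat.log 2 (x.length + 2) := fun x k w t c hp => (h x k w t c hp).2
  have hbits : ∀ x k, (A.indicator 1 (x, k) : ℕ).bits =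
      if 1 / 2 < M₀.acceptProb x k then [true] else [] := by
    intro x k
    by_cases hx : (x, k) ∈ A
    · rw [if_pos ((hA x k).1 hx), Set.indicator_of_mem hx]
      exact Nat.one_bits
    · rw [if_neg (not_lt.2 ((hA x k).2 hx)), Set.indicator_of_notMem hx]
      exact Nat.zero_bits
  refine ⟨fun q => (countingMachine M₀).numAcc q.1 q.2, ⟨countingMachine M₀,
    countingMachine_kRestricted hMr, fun x k => rfl⟩, ?_⟩
  refine fptRel_subset (.const 1)
    (fun y k => ?_) (answerTime_isFpt hf) (Hq := fun k => k + f k)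
    (Primrec.nat_add.to_comp.comp .id hf) (fun M => .answerMajority) ?_
    (fun M => answers_answerMajority hfree hf' (fun m₁ m₂ m₃ a z x k => ?_) hbits) hL
  · rw [hbits]
    split_ifs <;> simp
  · intro M
    repeat' constructor
  · exact countingMachine_numAcc hMr

end ParamComplexity

theorem mainTheorem1 :
    ParamComplexity.FPTRelFuns ParamComplexity.SharpWP =
      ParamComplexity.FPTRelLangs ParamComplexity.WPPFPT :=
  Set.Subset.antisymm ParamComplexity.fptRelFuns_subset ParamComplexity.fptRelLangs_subset
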